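/- Let $C$ be the tessellation of $\mathbb{R}^3$ by unit cubes with vertices in $\mathbb{Z}^3$. Write $F,R,U$ for the directions of the positive $x$-, $y$- and $z$-axes and $B,L,D$ for the opposite directions. A cubic gallery is a word $(c_1,\dots,c_n)$ in the letters $F,B,R,L,U,D$; together with a starting cube it describes the path of cubes in which the $i$-th step goes to the neighbouring cube in direction $c_i$. A threefold rotational symmetry of $C$ is a rotation of $\mathbb{R}^3$ of order three (that is, by $\pm120^\circ$ about some axis) that maps the cubes of $C$ onto the cubes of $C$; its linear part permutes the six directions, and it is said to be codified by this permutation $\sigma$. Write $\sigma(c_1,\dots,c_k)=(\sigma(c_1),\dots,\sigma(c_k))$. Two knots have the same type if they are ambient isotopic in $\mathbb{R}^3$. A tame knot has threefold rotational symmetry if some knot of the same type, parametrized by a piecewise $C^1$ regular closed curve without cusps (for instance a polygonal or a smooth knot), is mapped onto itself by a rotation by $120^\circ$ about some axis in $\mathbb{R}^3$. **Proposition.** A tame knot $K\subset\mathbb{R}^3$ has threefold rotational symmetry if and only if there exist a cubic gallery $g=(c_1,\dots,c_k)$, a starting cube, and a threefold rotational symmetry of $C$, codified by a permutation $\sigma$,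 such that the polygonal curve joining the centers of consecutive cubes of the gallery $$(g,\sigma(g),\sigma^2(g))$$ is a simple closed curve and is a knot of the same type as $K$. Moreover, every permutation $\sigma$ that codifies a threefold rotational symmetry of $C$ is a product of two disjoint $3$-cycles. -/

import Mathlib

namespace CubicKnot

/-- Euclidean three-space. -/
abbrev E3 : Type := EuclideanSpace ℝ (Fin 3)

/-! ### Knots and knot types -/

/-- Two subsets of three-space are ambient isotopic: there is a continuous family of
homeomorphisms of the whole space, starting at the identity, whose last member carries `K`
onto `L`. Two knots have the same type when they are ambient isotopic. -/
def AmbientIsotopic (K L : Set E3) : Prop :=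
  ∃ H : unitInterval → (E3 ≃ₜ E3),
    Continuous (fun q : unitInterval × E3 => H q.1 q.2) ∧
    Continuous (fun q : unitInterval × E3 => (H q.1).symm q.2) ∧
    H 0 = Homeomorph.refl E3 ∧
    H 1 '' K = L

/-- The polygonal path through `v 0, v 1, v 2, …`, which runs along the segment from `v i` to
`v (i + 1)` during the time interval `[i, i + 1]`. -/
noncomputable def polyline (v : ℕ → E3) (t : ℝ) : E3 :=
  AffineMap.lineMap (v ⌊t⌋₊) (v (⌊t⌋₊ + 1)) (Int.fract t)

/-- The polygonal path through `v 0, …, v n` closes up and does not intersect itself. -/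
def IsSimpleClosedPolygon (n : ℕ) (v : ℕ → E3) : Prop :=
  0 < n ∧ v n = v 0 ∧ Set.InjOn (polyline v) (Set.Ico (0 : ℝ) n)

/-- The points of the polygonal path through `v 0, …, v n`. -/
def polygonSet (n : ℕ) (v : ℕ → E3) : Set E3 :=
  polyline v '' Set.Icc (0 : ℝ) n

/-- A tame knot: the image of an embedding of the circle in three-space which is ambient
isotopic to a simple closed polygon. -/
def IsTameKnot (K : Set E3) : Prop :=
  (∃ f : Circle → E3, Topology.IsEmbedding f ∧ Set.range f = K) ∧
    ∃ (n : ℕ) (v : ℕ → E3), IsSimpleClosedPolygon n v ∧ AmbientIsotopic K (polygonSet n v)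

/-- A piecewise regular simple closed curve, that is, a closed curve (parametrized with period
`1`) which does not intersect itself, is continuously differentiable up to finitely many corners
in each period, and has nonzero one-sided velocities which nowhere form a cusp. Simple closed
polygons and regular `C¹` (in particular smooth) simple closed curves are of this kind. -/
structure IsPiecewiseRegularCurve (γ : ℝ → E3) : Prop where
  periodic : Function.Periodic γ 1
  injOn : Set.InjOn γ (Set.Ico 0 1)
  right : ∀ t, ∃ ε > 0, ContDiffOn ℝ 1 γ (Set.Icc t (t + ε))
  left : ∀ t, ∃ ε > 0, ContDiffOn ℝ 1 γ (Set.Icc (t - ε) t)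
  right_ne_zero : ∀ t, derivWithin γ (Set.Ici t) t ≠ 0
  left_ne_zero : ∀ t, derivWithin γ (Set.Iic t) t ≠ 0
  no_cusp : ∀ t, ¬ SameRay ℝ (derivWithin γ (Set.Iic t) t) (-derivWithin γ (Set.Ici t) t)

/-- A piecewise regular knot in three-space. -/
def IsPiecewiseRegularKnot (K : Set E3) : Prop :=
  ∃ γ : ℝ → E3, IsPiecewiseRegularCurve γ ∧ Set.range γ = K

/-! ### Threefold rotations -/

/-- A threefold rotation: an orientation preserving isometry of three-space with a fixed point
(hence a rotation about an axis) which has order three (hence its angle is `± 120` degrees). -/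
def IsThreefoldRotation (R : E3 ≃ᵃⁱ[ℝ] E3) : Prop :=
  LinearMap.det (R.linearIsometryEquiv.toLinearEquiv : E3 →ₗ[ℝ] E3) = 1 ∧
    (∃ a : E3, R a = a) ∧ orderOf R = 3

/-- A knot has threefold rotational symmetry when some knot of the same type is carried onto
itself by a rotation of `120` degrees about some axis. -/
def HasThreefoldRotationalSymmetry (K : Set E3) : Prop :=
  ∃ K' : Set E3, IsPiecewiseRegularKnot K' ∧ AmbientIsotopic K K' ∧
    ∃ R : E3 ≃ᵃⁱ[ℝ] E3, IsThreefoldRotation R ∧ R '' K' = K'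

/-! ### The cubic lattice and its galleries -/

/-- The six directions front, back, right, left, up and down. -/
inductive Direction : Type
  | F | B | R | L | U | D
  deriving DecidableEq

instance : Fintype Direction where
  elems := {.F, .B, .R, .L, .U, .D}
  complete := by intro s; cases s <;> decide

/-- The lattice vector of a direction: front, right and up are the directions of the positive
coordinate axes, and back, left and down are opposite to them. -/
def Direction.vec : Direction → (Fin 3 → ℤ)
  | .F => ![1, 0, 0]
  | .B => ![-1, 0, 0]
  | .R => ![0, 1, 0]
  | .L => ![0, -1, 0]
  | .U => ![0, 0, 1]
  | .D => ![0, 0, -1]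

/-- A lattice vector as a vector of three-space. -/
noncomputable def toE3 (m : Fin 3 → ℤ) : E3 :=
  WithLp.toLp 2 (fun i => (m i : ℝ))

/-- The unit cube of the cubic lattice whose smallest vertex is `m`. -/
def cube (m : Fin 3 → ℤ) : Set E3 :=
  {x | ∀ i, (m i : ℝ) ≤ x i ∧ x i ≤ (m i : ℝ) + 1}

/-- The center of `cube m`. -/
noncomputable def center (m : Fin 3 → ℤ) : E3 :=
  WithLp.toLp 2 (fun i => (m i : ℝ) + 1 / 2)

/-- A symmetry of the cubic lattice carries every cube onto a cube of the lattice, and every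
cube is obtained in this way. -/
def IsLatticeSymmetry (R : E3 ≃ᵃⁱ[ℝ] E3) : Prop :=
  (∀ m, ∃ m', R '' cube m = cube m') ∧ ∀ m', ∃ m, R '' cube m = cube m'

/-- The isometry `R` acts on the six directions as the permutation `σ`. -/
def IsCodifiedBy (R : E3 ≃ᵃⁱ[ℝ] E3) (σ : Equiv.Perm Direction) : Prop :=
  ∀ s : Direction, R.linearIsometryEquiv (toE3 s.vec) = toE3 (σ s).vec

/-- `R` is a threefold rotational symmetry of the cubic lattice, and `σ` is the permutation of
the six directions which codifies it. -/
def IsThreefoldLatticeRotation (R : E3 ≃ᵃⁱ[ℝ] E3) (σ : Equiv.Perm Direction) : Prop :=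
  IsThreefoldRotation R ∧ IsLatticeSymmetry R ∧ IsCodifiedBy R σ

/-- The cube reached after the first `i` steps of the cubic gallery which starts at the cube `p`
and is codified by the word `w`. -/
def cubeAt (p : Fin 3 → ℤ) (w : List Direction) (i : ℕ) : Fin 3 → ℤ :=
  p + ((w.take i).map Direction.vec).sum

/-- The word `(g, σ(g), σ²(g))`. -/
def threefoldWord (σ : Equiv.Perm Direction) (g : List Direction) : List Direction :=
  g ++ g.map σ ++ g.map ⇑(σ ^ 2)

/-- The centers of the consecutive cubes of the gallery which starts at the cube `p` and is
codified by the word `w`. -/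
noncomputable def galleryCenters (p : Fin 3 → ℤ) (w : List Direction) (i : ℕ) : E3 :=
  center (cubeAt p w i)

/-- The polygonal curve which joins the consecutive centers of the gallery that starts at the
cube `p` and is codified by the word `w` is a knot of the same type as `K`. -/
def GalleryKnotsAs (p : Fin 3 → ℤ) (w : List Direction) (K : Set E3) : Prop :=
  IsSimpleClosedPolygon w.length (galleryCenters p w) ∧
    AmbientIsotopic K (polygonSet w.length (galleryCenters p w))

end CubicKnot

namespace CubicKnot

open Set Filter Topology
open scoped NNReal

/-! ### Ambient isotopies -/

theorem AmbientIsotopic.refl (K : Set E3) : AmbientIsotopic K K :=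
  ⟨fun _ => Homeomorph.refl E3, continuous_snd, continuous_snd, rfl, by simp⟩

theorem AmbientIsotopic.trans {K L M : Set E3} (h : AmbientIsotopic K L)
    (h' : AmbientIsotopic L M) : AmbientIsotopic K M := by
  obtain ⟨H, h1, h2, h3, h4⟩ := h
  obtain ⟨H', h1', h2', h3', h4'⟩ := h'
  refine ⟨fun t => (H t).trans (H' t), ?_, ?_, ?_, ?_⟩
  · exact h1'.comp (continuous_fst.prodMk h1)
  · exact h2.comp (continuous_fst.prodMk h2')
  · simp only [h3, h3']; rfl
  · rw [← h4', ← h4, ← image_comp]; rfl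

theorem AmbientIsotopic.image {K L : Set E3} (h : AmbientIsotopic K L) (A : E3 ≃ₜ E3) :
    AmbientIsotopic (A '' K) (A '' L) := by
  obtain ⟨H, h1, h2, h3, h4⟩ := h
  refine ⟨fun t => (A.symm.trans (H t)).trans A, ?_, ?_, ?_, ?_⟩
  · exact A.continuous.comp (h1.comp (continuous_fst.prodMk (A.symm.continuous.comp continuous_snd)))
  · exact A.continuous.comp (h2.comp (continuous_fst.prodMk (A.symm.continuous.comp continuous_snd)))
  · simp only [h3]; ext1 x; simp
  · rw [← h4, ← image_comp, ← image_comp]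
    congr 1
    ext1 x; simp

/-- A small Lipschitz perturbation of the identity is the end of an ambient isotopy. -/
theorem ambientIsotopic_of_lipschitz {c : ℝ≥0} (hc : c < 1) {G : E3 → E3}
    (hG : LipschitzWith c G) (K : Set E3) :
    AmbientIsotopic K ((fun x => x + G x) '' K) := by
  have happ : ∀ t : unitInterval, ApproximatesLinearOn (fun x => x + (t : ℝ) • G x)
      ((ContinuousLinearEquiv.refl ℝ E3 : E3 ≃L[ℝ] E3) : E3 →L[ℝ] E3) univ c := by
    intro t x _ y _
    have h1 : x + (t : ℝ) • G x - (y + (t : ℝ) • G y) -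
        ((ContinuousLinearEquiv.refl ℝ E3 : E3 ≃L[ℝ] E3) : E3 →L[ℝ] E3) (x - y)
        = (t : ℝ) • (G x - G y) := by
      simp [smul_sub]; abel
    rw [h1, norm_smul, Real.norm_of_nonneg t.2.1]
    have h2 := hG.dist_le_mul x y
    rw [dist_eq_norm, dist_eq_norm] at h2
    have := t.2.2
    nlinarith [norm_nonneg (G x - G y), t.2.1]
  have hN : Subsingleton E3 ∨ c < ‖((ContinuousLinearEquiv.refl ℝ E3 : E3 ≃L[ℝ] E3).symm :
      E3 →L[ℝ] E3)‖₊⁻¹ := by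
    right
    have : ‖((ContinuousLinearEquiv.refl ℝ E3 : E3 ≃L[ℝ] E3).symm : E3 →L[ℝ] E3)‖₊ = 1 := by
      have : ((ContinuousLinearEquiv.refl ℝ E3 : E3 ≃L[ℝ] E3).symm : E3 →L[ℝ] E3)
        = ContinuousLinearMap.id ℝ E3 := rfl
      rw [this]
      exact NNReal.eq ContinuousLinearMap.norm_id
    rw [this]; simpa using hc
  let H : unitInterval → (E3 ≃ₜ E3) := fun t => (happ t).toHomeomorph _ hN
  have hH : ∀ t x, H t x = x + (t : ℝ) • G x := fun t x => rfl
  refine ⟨H, ?_, ?_, ?_, ?_⟩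
  · simp only [hH]
    have := hG.continuous
    fun_prop
  · rw [continuous_iff_continuousAt]
    rintro ⟨t₀, y₀⟩
    have hk : (0 : ℝ) < 1 - c := by
      have : (c : ℝ) < 1 := by exact_mod_cast hc
      linarith
    set x₀ := (H t₀).symm y₀ with hx₀
    have key : ∀ q : unitInterval × E3, dist ((H q.1).symm q.2) x₀ ≤
        (dist q.2 y₀ + |(q.1 : ℝ) - t₀| * ‖G x₀‖) / (1 - c) := by
      rintro ⟨t, y⟩
      set x := (H t).symm y with hx
      have e1 : x + (t : ℝ) • G x = y := by rw [← hH, hx]; simp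
      have e0 : x₀ + (t₀ : ℝ) • G x₀ = y₀ := by rw [← hH, hx₀]; simp
      have h2 := hG.dist_le_mul x x₀
      rw [dist_eq_norm, dist_eq_norm] at h2
      have h3 : x - x₀ = (y - y₀) - (t : ℝ) • (G x - G x₀) - ((t : ℝ) - t₀) • G x₀ := by
        rw [← e1, ← e0, smul_sub, sub_smul]; abel
      have h4 : ‖x - x₀‖ ≤ ‖y - y₀‖ + (t : ℝ) * ‖G x - G x₀‖ + |(t : ℝ) - t₀| * ‖G x₀‖ := by
        calc ‖x - x₀‖ ≤ ‖(y - y₀) - (t : ℝ) • (G x - G x₀)‖ + ‖((t : ℝ) - t₀) • G x₀‖ := by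
              rw [h3]; exact norm_sub_le _ _
          _ ≤ ‖y - y₀‖ + ‖(t : ℝ) • (G x - G x₀)‖ + ‖((t : ℝ) - t₀) • G x₀‖ := by
              gcongr; exact norm_sub_le _ _
          _ = _ := by rw [norm_smul, norm_smul, Real.norm_of_nonneg t.2.1, Real.norm_eq_abs]
      rw [le_div_iff₀ hk, dist_eq_norm, dist_eq_norm]
      show ‖x - x₀‖ * (1 - c) ≤ ‖y - y₀‖ + |(t : ℝ) - t₀| * ‖G x₀‖
      have := t.2.2
      nlinarith [norm_nonneg (G x - G x₀), t.2.1]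
    rw [ContinuousAt, tendsto_iff_dist_tendsto_zero]
    refine squeeze_zero (fun _ => dist_nonneg) key ?_
    have : Continuous fun q : unitInterval × E3 =>
        (dist q.2 y₀ + |(q.1 : ℝ) - t₀| * ‖G x₀‖) / (1 - c) := by fun_prop
    convert this.tendsto (t₀, y₀) using 2
    simp
  · ext1 x; rw [hH]; simp
  · congr 1
    ext1 x; rw [hH]; simp

theorem ambientIsotopic_of_lipschitzOn {c : ℝ≥0} (hc : lipschitzExtensionConstant E3 * c < 1)
    {X : Set E3} {D : E3 → E3} (hD : LipschitzOnWith c D X) :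
    AmbientIsotopic X ((fun x => x + D x) '' X) := by
  obtain ⟨G, hG, hGD⟩ := hD.extend_finite_dimension
  have := ambientIsotopic_of_lipschitz hc hG X
  convert this using 1
  exact image_congr fun x hx => by rw [hGD hx]

/-- A continuous path of invertible linear maps, which starts at the identity, is an ambient
isotopy. -/
theorem ambientIsotopic_of_linear_path (M : unitInterval → E3 →L[ℝ] E3) (hM : Continuous M)
    (hu : ∀ t, IsUnit (M t)) (h0 : M 0 = 1) (K : Set E3) : AmbientIsotopic K (M 1 '' K) := by
  have hc : Continuous fun t => Ring.inverse (M t) := by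
    rw [continuous_iff_continuousAt]
    intro t
    obtain ⟨u, hu'⟩ := hu t
    have h1 := NormedRing.inverse_continuousAt u
    rw [hu'] at h1
    exact h1.comp hM.continuousAt
  let H : unitInterval → (E3 ≃ₜ E3) := fun t =>
    { toFun := M t
      invFun := ⇑(Ring.inverse (M t) : E3 →L[ℝ] E3)
      left_inv := fun x => by
        have := Ring.inverse_mul_cancel _ (hu t)
        exact congrArg (fun A : E3 →L[ℝ] E3 => A x) this
      right_inv := fun x => by
        have := Ring.mul_inverse_cancel _ (hu t)
        exact congrArg (fun A : E3 →L[ℝ] E3 => A x) this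
      continuous_toFun := (M t).continuous
      continuous_invFun := (Ring.inverse (M t) : E3 →L[ℝ] E3).continuous }
  refine ⟨H, ?_, ?_, ?_, rfl⟩
  · exact (hM.comp continuous_fst).clm_apply continuous_snd
  · exact (hc.comp continuous_fst).clm_apply continuous_snd
  · ext1 x
    show M 0 x = x
    rw [h0]; rfl

/-- A linear automorphism without eigenvalues on the negative half-line is isotopic to the
identity. -/
theorem ambientIsotopic_of_linear (T : E3 →L[ℝ] E3)
    (hT : ∀ t : ℝ, 0 ≤ t → t ≤ 1 → ∀ x, (1 - t) • x + t • T x = 0 → x = 0) (K : Set E3) :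
    AmbientIsotopic K (T '' K) := by
  have := ambientIsotopic_of_linear_path
    (fun t => (1 - (t : ℝ)) • (1 : E3 →L[ℝ] E3) + (t : ℝ) • T) (by fun_prop) ?_
    (by ext1 x; simp) K
  · simpa using this
  intro t
  rw [ContinuousLinearMap.isUnit_iff_bijective]
  have hinj : Function.Injective ((1 - (t : ℝ)) • (1 : E3 →L[ℝ] E3) + (t : ℝ) • T) := by
    rw [injective_iff_map_eq_zero]
    intro x hx
    exact hT t t.2.1 t.2.2 x (by simpa using hx)
  exact ⟨hinj, (LinearMap.injective_iff_surjective (f :=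
    (((1 - (t : ℝ)) • (1 : E3 →L[ℝ] E3) + (t : ℝ) • T : E3 →L[ℝ] E3) : E3 →ₗ[ℝ] E3))).1 hinj⟩

theorem ambientIsotopic_smul {r : ℝ} (hr : 0 < r) (K : Set E3) :
    AmbientIsotopic K ((fun x => r • x) '' K) := by
  have := ambientIsotopic_of_linear (r • (1 : E3 →L[ℝ] E3)) ?_ K
  · simpa using this
  · intro t h0 h1 x hx
    have : ((1 - t) + t * r) • x = 0 := by
      rw [add_smul, mul_smul]; simpa using hx
    rcases smul_eq_zero.1 this with h | h
    · exfalso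
      rcases h0.eq_or_lt with h2 | h2
      · subst h2; simp at h
      · nlinarith [mul_pos h2 hr]
    · exact h

theorem ambientIsotopic_add (a : E3) (K : Set E3) :
    AmbientIsotopic K ((fun x => x + a) '' K) := by
  have := ambientIsotopic_of_lipschitz (c := 0) (by norm_num) (LipschitzWith.const a) K
  simpa using this

theorem exists_stretch (e : E3) {L ε : ℝ} (hL : 0 ≤ L) (hε : 0 < ε) :
    ∃ A : E3 ≃L[ℝ] E3, (∀ x, ‖x‖ ≤ ‖A x‖) ∧ (∀ x, L * |inner ℝ e x| ≤ ε * ‖A x‖) ∧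
      ∀ x, inner ℝ e x = 0 → A x = x := by
  rcases eq_or_ne e 0 with rfl | he
  · exact ⟨ContinuousLinearEquiv.refl ℝ E3, by simp, fun x => by simp; positivity, by simp⟩
  have hn : 0 < ‖e‖ := norm_pos_iff.2 he
  let μ : ℝ := L / (ε * ‖e‖)
  have hμ : 0 ≤ μ := by positivity
  let A₀ : E3 →ₗ[ℝ] E3 := LinearMap.id + μ • ((innerSL ℝ e : E3 →L[ℝ] ℝ) : E3 →ₗ[ℝ] ℝ).smulRight e
  have hA₀ : ∀ x, A₀ x = x + (μ * inner ℝ e x) • e := by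
    intro x; simp [A₀, smul_smul]
  have hsq : ∀ x, ‖A₀ x‖ ^ 2 = ‖x‖ ^ 2 + 2 * μ * (inner ℝ e x) ^ 2
      + μ ^ 2 * (inner ℝ e x) ^ 2 * ‖e‖ ^ 2 := by
    intro x
    rw [hA₀, norm_add_sq_real, norm_smul, inner_smul_right, real_inner_comm, mul_pow,
      Real.norm_eq_abs, sq_abs]
    ring
  have h1 : ∀ x, ‖x‖ ≤ ‖A₀ x‖ := by
    intro x
    refine le_of_sq_le_sq ?_ (norm_nonneg _)
    rw [hsq]
    have : 0 ≤ 2 * μ * (inner ℝ e x) ^ 2 := by positivity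
    have : 0 ≤ μ ^ 2 * (inner ℝ e x) ^ 2 * ‖e‖ ^ 2 := by positivity
    linarith
  have hinj : Function.Injective A₀ := by
    rw [injective_iff_map_eq_zero]
    intro x hx
    have := h1 x
    rw [hx, norm_zero] at this
    exact norm_le_zero_iff.1 this
  let A := (LinearEquiv.ofInjectiveEndo A₀ hinj).toContinuousLinearEquiv
  have hA : ∀ x, A x = A₀ x := fun x => rfl
  refine ⟨A, fun x => by rw [hA]; exact h1 x, fun x => ?_, fun x hx => ?_⟩
  · rw [hA]
    have h2 : μ * |inner ℝ e x| * ‖e‖ ≤ ‖A₀ x‖ := by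
      refine le_of_sq_le_sq ?_ (norm_nonneg _)
      rw [hsq, mul_pow, mul_pow, sq_abs]
      have : 0 ≤ 2 * μ * (inner ℝ e x) ^ 2 := by positivity
      nlinarith [sq_nonneg ‖x‖]
    have h3 : ε * (μ * |inner ℝ e x| * ‖e‖) = L * |inner ℝ e x| := by
      simp only [μ]; field_simp
    rw [← h3]
    gcongr
  · rw [hA, hA₀, hx]; simp

/-- A displacement orthogonal to a direction `e` which is Lipschitz, with a small constant up to
a multiple of the height in direction `e`, is realized by an ambient isotopy. -/
theorem ambientIsotopic_of_shear {c L : ℝ} (hc0 : 0 ≤ c)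
    (hc : (lipschitzExtensionConstant E3 : ℝ) * c < 1) (hL : 0 ≤ L) {X : Set E3} {D : E3 → E3}
    (e : E3) (hD : ∀ x ∈ X, inner ℝ e (D x) = 0)
    (hLip : ∀ x ∈ X, ∀ y ∈ X, ‖D x - D y‖ ≤ c * ‖x - y‖ + L * |inner ℝ e (x - y)|) :
    AmbientIsotopic X ((fun x => x + D x) '' X) := by
  set κ := (lipschitzExtensionConstant E3 : ℝ) with hκ
  have hκ0 : 0 < κ := by exact_mod_cast lipschitzExtensionConstant_pos E3
  obtain ⟨ε, hε, hcε⟩ : ∃ ε > 0, κ * (c + ε) < 1 := by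
    refine ⟨(1 - κ * c) / (2 * κ), div_pos (by linarith) (by positivity), ?_⟩
    have : κ * (c + (1 - κ * c) / (2 * κ)) = (1 + κ * c) / 2 := by field_simp; ring
    rw [this]; linarith
  obtain ⟨A, hA1, hA2, hA3⟩ := exists_stretch e hL hε
  let c' : ℝ≥0 := ⟨c + ε, by linarith⟩
  have hlip : LipschitzOnWith c' (fun z => D (A.symm z)) (A '' X) := by
    refine LipschitzOnWith.of_dist_le_mul ?_
    rintro _ ⟨x, hx, rfl⟩ _ ⟨y, hy, rfl⟩
    simp only [ContinuousLinearEquiv.symm_apply_apply, dist_eq_norm]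
    rw [← map_sub]
    have h1 := hLip x hx y hy
    have h2 := hA1 (x - y)
    have h3 := hA2 (x - y)
    have h4 : c * ‖x - y‖ ≤ c * ‖A (x - y)‖ := by gcongr
    show _ ≤ (c + ε) * _
    linarith
  have hiso := ambientIsotopic_of_lipschitzOn (c := c') (by exact_mod_cast hcε) hlip
  have := hiso.image A.symm.toHomeomorph
  convert this using 1
  · rw [← image_comp]; ext x; simp
  · rw [← image_comp, ← image_comp]
    refine image_congr fun x hx => ?_
    have h5 := hA3 _ (hD x hx)
    apply A.injective
    simp [h5]

/-- The graph move: an arc which is a Lipschitz graph over the direction `e` may be replaced by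
another one, if the displacement is small compared with the distance to the remaining points
whose height lies in the range of the arc. -/
theorem ambientIsotopic_graph_move {c L a b : ℝ} (hc0 : 0 ≤ c)
    (hc : (lipschitzExtensionConstant E3 : ℝ) * c < 1) (hL : 0 ≤ L) {A A' Y : Set E3} (e : E3)
    (hA : ∀ x ∈ A, ∀ y ∈ A, ‖x - y‖ ≤ L * |inner ℝ e (x - y)|)
    (hA' : ∀ x ∈ A', ∀ y ∈ A', ‖x - y‖ ≤ L * |inner ℝ e (x - y)|)
    {T : E3 → E3} (hT : ∀ x ∈ A, T x ∈ A') (hTe : ∀ x ∈ A, inner ℝ e (T x) = inner ℝ e x)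
    (hTs : ∀ y ∈ A', ∃ x ∈ A, T x = y)
    (hab : ∀ x ∈ A, a ≤ inner ℝ e x ∧ inner ℝ e x ≤ b)
    {z w : E3} (hz : z ∈ A) (hz' : z ∈ A') (hza : inner ℝ e z = a)
    (hw : w ∈ A) (hw' : w ∈ A') (hwb : inner ℝ e w = b)
    (hY : ∀ y ∈ Y, ∀ x ∈ A, inner ℝ e y ≤ a ∨ b ≤ inner ℝ e y ∨ ‖T x - x‖ ≤ c * ‖y - x‖) :
    AmbientIsotopic (A ∪ Y) (A' ∪ Y) := by
  classical
  have huniq : ∀ x ∈ A', ∀ y ∈ A', inner ℝ e x = inner ℝ e y → x = y := by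
    intro x hx y hy h
    have := hA' x hx y hy
    rw [inner_sub_right, h, sub_self, abs_zero, mul_zero] at this
    exact sub_eq_zero.1 (norm_le_zero_iff.1 this)
  have huniqA : ∀ x ∈ A, ∀ y ∈ A, inner ℝ e x = inner ℝ e y → x = y := by
    intro x hx y hy h
    have := hA x hx y hy
    rw [inner_sub_right, h, sub_self, abs_zero, mul_zero] at this
    exact sub_eq_zero.1 (norm_le_zero_iff.1 this)
  have hTz : T z = z := huniq _ (hT z hz) _ hz' (hTe z hz)
  have hTw : T w = w := huniq _ (hT w hw) _ hw' (hTe w hw)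
  let D : E3 → E3 := fun x => if x ∈ A then T x - x else 0
  have hDA : ∀ x ∈ A, D x = T x - x := fun x hx => by simp [D, hx]
  have hDn : ∀ x, x ∉ A → D x = 0 := fun x hx => by simp [D, hx]
  have hDAA : ∀ x ∈ A, ∀ y ∈ A, ‖D x - D y‖ ≤ 2 * L * |inner ℝ e (x - y)| := by
    intro x hx y hy
    rw [hDA x hx, hDA y hy]
    have h1 := hA' _ (hT x hx) _ (hT y hy)
    rw [inner_sub_right, hTe x hx, hTe y hy, ← inner_sub_right] at h1
    have h2 := hA x hx y hy
    calc ‖T x - x - (T y - y)‖ = ‖(T x - T y) - (x - y)‖ := by congr 1; abel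
      _ ≤ ‖T x - T y‖ + ‖x - y‖ := norm_sub_le _ _
      _ ≤ _ := by linarith
  have hDY : ∀ x ∈ A, ∀ y ∈ Y, ‖D x‖ ≤ c * ‖x - y‖ + 2 * L * |inner ℝ e (x - y)| := by
    intro x hx y hy
    have hp1 : 0 ≤ c * ‖x - y‖ := by positivity
    have hp2 : 0 ≤ 2 * L * |inner ℝ e (x - y)| := by positivity
    rcases hY y hy x hx with h | h | h
    · have h1 := hDAA x hx z hz
      rw [hDA z hz, hTz, sub_self, sub_zero] at h1
      have h2 : |inner ℝ e (x - z)| ≤ |inner ℝ e (x - y)| := by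
        rw [inner_sub_right, inner_sub_right, hza, abs_of_nonneg, abs_of_nonneg] <;>
          linarith [(hab x hx).1]
      have h3 : 2 * L * |inner ℝ e (x - z)| ≤ 2 * L * |inner ℝ e (x - y)| := by gcongr
      linarith
    · have h1 := hDAA x hx w hw
      rw [hDA w hw, hTw, sub_self, sub_zero] at h1
      have h2 : |inner ℝ e (x - w)| ≤ |inner ℝ e (x - y)| := by
        rw [inner_sub_right, inner_sub_right, hwb, abs_of_nonpos, abs_of_nonpos] <;>
          linarith [(hab x hx).2]
      have h3 : 2 * L * |inner ℝ e (x - w)| ≤ 2 * L * |inner ℝ e (x - y)| := by gcongr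
      linarith
    · rw [hDA x hx, norm_sub_rev x y]
      linarith
  have hfix : ∀ y ∈ Y, y + D y = y := by
    intro y hy
    by_cases hyA : y ∈ A
    · rw [hDA y hyA]
      rcases hY y hy y hyA with h | h | h
      · have : y = z := huniqA y hyA z hz (by rw [hza]; exact le_antisymm h (hab y hyA).1)
        rw [this, hTz]; simp
      · have : y = w := huniqA y hyA w hw (by rw [hwb]; exact le_antisymm (hab y hyA).2 h)
        rw [this, hTw]; simp
      · rw [sub_self, norm_zero, mul_zero] at h
        rw [norm_le_zero_iff.1 h, add_zero]
    · rw [hDn y hyA, add_zero]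
  have hiso := ambientIsotopic_of_shear (X := A ∪ Y) (D := D) hc0 hc (L := 2 * L) (by positivity) e
    (by
      intro x _
      by_cases hx : x ∈ A
      · rw [hDA x hx, inner_sub_right, hTe x hx, sub_self]
      · rw [hDn x hx, inner_zero_right])
    (by
      intro x hx y hy
      have hp1 : 0 ≤ c * ‖x - y‖ := by positivity
      have hp2 : 0 ≤ 2 * L * |inner ℝ e (x - y)| := by positivity
      by_cases hxA : x ∈ A <;> by_cases hyA : y ∈ A
      · linarith [hDAA x hxA y hyA]
      · rw [hDn y hyA, sub_zero]
        exact hDY x hxA y (hy.resolve_left hyA)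
      · rw [hDn x hxA, zero_sub, norm_neg]
        have := hDY y hyA x (hx.resolve_left hxA)
        rwa [norm_sub_rev, ← neg_sub y x, inner_neg_right, abs_neg, norm_neg, norm_sub_rev,
          norm_sub_rev x y] at *
      · rw [hDn x hxA, hDn y hyA, sub_zero, norm_zero]
        linarith)
  convert hiso using 1
  rw [image_union]
  congr 1
  · ext y
    constructor
    · intro hy
      obtain ⟨x, hx, rfl⟩ := hTs y hy
      exact ⟨x, hx, by simp [hDA x hx]⟩
    · rintro ⟨x, hx, rfl⟩
      have : x + D x = T x := by rw [hDA x hx]; abel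
      simp only [this]; exact hT x hx
  · ext y
    constructor
    · intro hy; exact ⟨y, hy, hfix y hy⟩
    · rintro ⟨x, hx, rfl⟩
      simp only [hfix x hx]; exact hx

/-! ### Piecewise linear curves -/

section PiecewiseLinear

variable {E F : Type*} [NormedAddCommGroup E] [NormedSpace ℝ E] [NormedAddCommGroup F]
  [NormedSpace ℝ F]

/-- The piecewise linear curve with the vertices `v i` at the integers. -/
noncomputable def pl (v : ℤ → E) (t : ℝ) : E :=
  AffineMap.lineMap (v ⌊t⌋) (v (⌊t⌋ + 1)) (Int.fract t)

theorem pl_eq (v : ℤ → E) {i : ℤ} {t : ℝ} (h1 : (i : ℝ) ≤ t) (h2 : t ≤ i + 1) :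
    pl v t = v i + (t - i) • (v (i + 1) - v i) := by
  rcases h2.lt_or_eq with h | h
  · have hf : ⌊t⌋ = i := Int.floor_eq_iff.2 ⟨h1, h⟩
    rw [pl, Int.fract, hf, AffineMap.lineMap_apply, vsub_eq_sub, vadd_eq_add, add_comm]
  · have hf : ⌊t⌋ = i + 1 := by rw [h]; exact_mod_cast Int.floor_intCast (i + 1)
    rw [pl, Int.fract, hf, h]
    simp

theorem pl_int (v : ℤ → E) (i : ℤ) : pl v i = v i := by
  rw [pl_eq v (i := i) le_rfl (by linarith)]; simp

theorem pl_sub (v : ℤ → E) {i : ℤ} {s t : ℝ} (h1 : (i : ℝ) ≤ s) (h2 : s ≤ i + 1)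
    (h3 : (i : ℝ) ≤ t) (h4 : t ≤ i + 1) : pl v t - pl v s = (t - s) • (v (i + 1) - v i) := by
  rw [pl_eq v h1 h2, pl_eq v h3 h4, add_sub_add_left_eq_sub, ← sub_smul]
  congr 1; ring

/-- A transitive relation which holds on all unit intervals between integers holds everywhere
in between. -/
theorem glue {Q : ℝ → ℝ → Prop} (hr : ∀ s, Q s s)
    (ht : ∀ s t u, s ≤ t → t ≤ u → Q s t → Q t u → Q s u) {A B : ℤ}
    (h : ∀ i : ℤ, A ≤ i → i < B → ∀ s t : ℝ, i ≤ s → s ≤ t → t ≤ i + 1 → Q s t) :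
    ∀ s t : ℝ, A ≤ s → s ≤ t → t ≤ B → Q s t := by
  rcases lt_or_ge B A with hAB | hAB
  · intro s t h1 h2 h3
    have : (B : ℝ) < A := by exact_mod_cast hAB
    linarith
  obtain ⟨n, rfl⟩ : ∃ n : ℕ, B = A + n := ⟨(B - A).toNat, by omega⟩
  clear hAB
  induction n with
  | zero =>
    intro s t h1 h2 h3
    have : s = t := le_antisymm h2 (by simp at h3; linarith)
    rw [this]; exact hr t
  | succ n ih =>
    have ih' := ih (fun i h1 h2 => h i h1 (by push_cast; omega))
    have hn := h (A + n) (by omega) (by push_cast; omega)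
    push_cast at hn ih' ⊢
    intro s t h1 h2 h3
    rcases le_total t (A + n) with h4 | h4
    · exact ih' s t h1 h2 h4
    rcases le_total (A + n : ℝ) s with h5 | h5
    · exact hn s t h5 h2 (by linarith)
    · exact ht _ _ _ h5 h4 (ih' s _ h1 h5 le_rfl) (hn _ t le_rfl h4 (by linarith))

theorem glue_all {Q : ℝ → ℝ → Prop} (hr : ∀ s, Q s s)
    (ht : ∀ s t u, s ≤ t → t ≤ u → Q s t → Q t u → Q s u)
    (h : ∀ i : ℤ, ∀ s t : ℝ, i ≤ s → s ≤ t → t ≤ i + 1 → Q s t) {s t : ℝ} (hst : s ≤ t) :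
    Q s t :=
  glue hr ht (A := ⌊s⌋) (B := ⌈t⌉) (fun i _ _ => h i) s t (Int.floor_le s) hst (Int.le_ceil t)

theorem pl_map (v : ℤ → E) (A : E →ᵃ[ℝ] F) (t : ℝ) : pl (fun i => A (v i)) t = A (pl v t) := by
  simp only [pl, AffineMap.apply_lineMap]

theorem pl_shift (v : ℤ → E) (n : ℤ) (t : ℝ) : pl v (t + n) = pl (fun i => v (i + n)) t := by
  simp only [pl, Int.floor_add_intCast, Int.fract_add_intCast]
  rw [add_right_comm]

theorem continuous_of_continuousOn_Icc {X : Type*} [TopologicalSpace X] {f : ℝ → X}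
    (h : ∀ i : ℤ, ContinuousOn f (Icc (i : ℝ) (i + 1))) : Continuous f := by
  rw [continuous_iff_continuousAt]
  intro t
  have h1 : ContinuousOn f (Icc ((⌊t⌋ - 1 : ℤ) : ℝ) ((⌊t⌋ - 1 : ℤ) + 1) ∪
      Icc (⌊t⌋ : ℝ) (⌊t⌋ + 1)) :=
    (h _).union_of_isClosed (h _) isClosed_Icc isClosed_Icc
  refine h1.continuousAt ?_
  have h2 : Ioo ((⌊t⌋ : ℝ) - 1) (⌊t⌋ + 1) ∈ 𝓝 t :=
    Ioo_mem_nhds (by linarith [Int.floor_le t]) (Int.lt_floor_add_one t)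
  filter_upwards [h2] with x hx
  push_cast
  rcases le_total x ⌊t⌋ with h | h
  · left; exact ⟨hx.1.le, by linarith⟩
  · right; exact ⟨h, hx.2.le⟩

theorem pl_continuous (v : ℤ → E) : Continuous (pl v) := by
  refine continuous_of_continuousOn_Icc fun i => ?_
  have : ContinuousOn (fun t : ℝ => v i + (t - i) • (v (i + 1) - v i)) (Icc (i : ℝ) (i + 1)) := by
    fun_prop
  exact this.congr fun t ht => pl_eq v ht.1 ht.2

end PiecewiseLinear

/-! ### Periodic curves -/

theorem periodic_int_mul {p : ℝ} {f : ℝ → E3} (hp : ∀ t, f (t + p) = f t) (t : ℝ) (k : ℤ) :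
    f (t + k * p) = f t := by
  have : Function.Periodic f p := hp
  exact this.int_mul k t

theorem exists_shift_mem_Icc {p : ℝ} (hp : 0 < p) (t : ℝ) : ∃ k : ℤ, t + k * p ∈ Icc 0 p := by
  refine ⟨-⌊t / p⌋, ?_, ?_⟩
  · have := Int.floor_le (t / p)
    rw [le_div_iff₀ hp] at this
    push_cast; linarith
  · have := Int.lt_floor_add_one (t / p)
    rw [div_lt_iff₀ hp] at this
    push_cast; linarith

/-- Points of a simple closed curve whose parameters are far apart are far apart. -/
theorem exists_separation {p : ℝ} (hp : 0 < p) {f : ℝ → E3} (hf : Continuous f)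
    (hper : ∀ t, f (t + p) = f t) (hinj : ∀ s t, f s = f t → ∃ k : ℤ, s - t = k * p)
    {μ : ℝ} (hμ : 0 < μ) :
    ∃ ρ > 0, ∀ s t, (∀ k : ℤ, μ ≤ |s - t - k * p|) → ρ ≤ ‖f s - f t‖ := by
  let C : Set (ℝ × ℝ) := (Icc 0 p ×ˢ Icc 0 p) ∩ ⋂ k : ℤ, {q | μ ≤ |q.1 - q.2 - k * p|}
  have hC : IsCompact C := by
    refine (isCompact_Icc.prod isCompact_Icc).inter_right (isClosed_iInter fun k => ?_)
    exact isClosed_le continuous_const (by fun_prop)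
  have hred : ∀ s t, (∀ k : ℤ, μ ≤ |s - t - k * p|) → ∃ q ∈ C, f q.1 = f s ∧ f q.2 = f t := by
    intro s t h
    obtain ⟨k, hk⟩ := exists_shift_mem_Icc hp s
    obtain ⟨l, hl⟩ := exists_shift_mem_Icc hp t
    refine ⟨(s + k * p, t + l * p), ⟨⟨hk, hl⟩, mem_iInter.2 fun n => ?_⟩,
      periodic_int_mul hper s k, periodic_int_mul hper t l⟩
    have := h (n - k + l)
    simp only [mem_ofPred_eq]
    convert this using 2
    push_cast; ring
  rcases C.eq_empty_or_nonempty with he | hne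
  · refine ⟨1, one_pos, fun s t h => ?_⟩
    obtain ⟨q, hq, _⟩ := hred s t h
    rw [he] at hq; exact hq.elim
  · obtain ⟨q, hq, hmin⟩ := hC.exists_isMinOn hne
      (f := fun q : ℝ × ℝ => ‖f q.1 - f q.2‖) (by fun_prop)
    refine ⟨‖f q.1 - f q.2‖, ?_, fun s t h => ?_⟩
    · rw [gt_iff_lt, norm_pos_iff, sub_ne_zero]
      intro h
      obtain ⟨k, hk⟩ := hinj _ _ h
      have := mem_iInter.1 hq.2 k
      simp only [mem_ofPred_eq, hk, sub_self, abs_zero] at this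
      linarith
    · obtain ⟨r, hr, h1, h2⟩ := hred s t h
      have := hmin hr
      simp only [mem_ofPred_eq, h1, h2] at this
      exact this

/-- A simple closed curve which locally satisfies a chord-arc condition satisfies it globally. -/
theorem exists_chord_arc {p : ℝ} (hp : 0 < p) {f : ℝ → E3} (hf : Continuous f)
    (hper : ∀ t, f (t + p) = f t) (hinj : ∀ s t, f s = f t → ∃ k : ℤ, s - t = k * p)
    (hloc : ∀ t₀, ∃ δ > 0, ∃ c > 0, ∀ s t, |s - t₀| < δ → |t - t₀| < δ →
      c * |s - t| ≤ ‖f s - f t‖) :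
    ∃ c > 0, ∀ s t, |s - t| ≤ p / 2 → c * |s - t| ≤ ‖f s - f t‖ := by
  let S : Set (ℝ × ℝ) := (Icc 0 p ×ˢ Icc (-p) (2 * p)) ∩ {q | |q.1 - q.2| ≤ p / 2}
  have hS : IsCompact S := (isCompact_Icc.prod isCompact_Icc).inter_right
    (isClosed_le (by fun_prop) continuous_const)
  have key : ∃ c > 0, ∀ q ∈ S, c * |q.1 - q.2| ≤ ‖f q.1 - f q.2‖ := by
    refine hS.induction_on (p := fun S' => ∃ c > 0, ∀ q ∈ S', c * |q.1 - q.2| ≤ ‖f q.1 - f q.2‖)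
      ⟨1, one_pos, by simp⟩ ?_ ?_ ?_
    · rintro s t hst ⟨c, hc, h⟩
      exact ⟨c, hc, fun q hq => h q (hst hq)⟩
    · rintro s t ⟨c, hc, h⟩ ⟨c', hc', h'⟩
      refine ⟨min c c', lt_min hc hc', ?_⟩
      rintro q (hq | hq)
      · exact (mul_le_mul_of_nonneg_right (min_le_left _ _) (abs_nonneg _)).trans (h q hq)
      · exact (mul_le_mul_of_nonneg_right (min_le_right _ _) (abs_nonneg _)).trans (h' q hq)
    · rintro ⟨s, t⟩ ⟨_, hst⟩
      simp only [mem_ofPred_eq] at hst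
      rcases eq_or_ne s t with rfl | hne
      · obtain ⟨δ, hδ, c, hc, h⟩ := hloc s
        refine ⟨_, mem_nhdsWithin_of_mem_nhds
          (prod_mem_nhds (Metric.ball_mem_nhds s hδ) (Metric.ball_mem_nhds s hδ)), c, hc, ?_⟩
        rintro ⟨x, y⟩ ⟨hx, hy⟩
        exact h x y hx hy
      · have hfst : 0 < ‖f s - f t‖ := by
          rw [norm_pos_iff, sub_ne_zero]
          intro h
          obtain ⟨k, hk⟩ := hinj _ _ h
          have hk0 : k ≠ 0 := by
            rintro rfl
            simp at hk; exact hne (sub_eq_zero.1 hk)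
          have h1 : (1 : ℝ) ≤ |(k : ℝ)| := by exact_mod_cast Int.one_le_abs hk0
          rw [hk, abs_mul, abs_of_pos hp] at hst
          nlinarith
        have hcont : ContinuousAt (fun q : ℝ × ℝ => ‖f q.1 - f q.2‖) (s, t) := by fun_prop
        have h1 : ∀ᶠ q : ℝ × ℝ in 𝓝 (s, t), ‖f s - f t‖ / 2 < ‖f q.1 - f q.2‖ :=
          hcont.eventually_const_lt (by simpa using half_lt_self hfst)
        refine ⟨{q | ‖f s - f t‖ / 2 < ‖f q.1 - f q.2‖} ∩ S,
          inter_mem (mem_nhdsWithin_of_mem_nhds h1) self_mem_nhdsWithin,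
          ‖f s - f t‖ / p, by positivity, ?_⟩
        rintro q ⟨hq, -, hq'⟩
        simp only [mem_ofPred_eq] at hq hq'
        refine le_trans ?_ hq.le
        calc ‖f s - f t‖ / p * |q.1 - q.2| ≤ ‖f s - f t‖ / p * (p / 2) := by gcongr
          _ = _ := by field_simp
  obtain ⟨c, hc, h⟩ := key
  refine ⟨c, hc, fun s t hst => ?_⟩
  obtain ⟨k, hk⟩ := exists_shift_mem_Icc hp s
  have h2 := abs_le.1 hst
  have := h (s + k * p, t + k * p) ⟨⟨hk, ⟨by linarith [hk.1, hk.2], by linarith [hk.1, hk.2]⟩⟩, by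
    simpa using hst⟩
  simpa [periodic_int_mul hper] using this

/-! ### Replacing the arcs of a curve by neighbouring graphs -/

section Replace

variable {N : ℕ} {f g : ℝ → E3} {e : ℤ → E3} {L c : ℝ}

theorem exists_same_height (hf : Continuous f) (hend : ∀ i : ℤ, f i = g i)
    (u : E3) (i : ℤ) (hmg : ∀ t ∈ Icc (i : ℝ) (i + 1),
      inner ℝ u (g i) ≤ inner ℝ u (g t) ∧ inner ℝ u (g t) ≤ inner ℝ u (g (i + 1)))
    {t : ℝ} (ht : t ∈ Icc (i : ℝ) (i + 1)) :
    ∃ s ∈ Icc (i : ℝ) (i + 1), inner ℝ u (f s) = inner ℝ u (g t) := by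
  have hcont : ContinuousOn (fun s => (inner ℝ u (f s) : ℝ)) (Icc (i : ℝ) (i + 1)) := by fun_prop
  have := intermediate_value_Icc (by linarith : (i : ℝ) ≤ i + 1) hcont
  have h1 := hend (i + 1)
  push_cast at h1
  simp only [hend i, h1] at this
  obtain ⟨s, hs, h⟩ := this (hmg t ht)
  exact ⟨s, hs, h⟩

/-- Each of the arcs of `f` and `g` over the unit intervals is a graph over a direction. If
corresponding arcs are sufficiently close compared with the distance to the other arcs, then the
two curves are ambient isotopic. -/
theorem ambientIsotopic_range_of_graphs (hN : 0 < N) (hf : Continuous f) (hg : Continuous g)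
    (pf : ∀ t, f (t + N) = f t) (pg : ∀ t, g (t + N) = g t) (hL : 0 ≤ L) (hc0 : 0 ≤ c)
    (hc : (lipschitzExtensionConstant E3 : ℝ) * c < 1)
    (mf : ∀ i : ℤ, ∀ s t : ℝ, i ≤ s → s ≤ t → t ≤ i + 1 →
      ‖f t - f s‖ ≤ L * inner ℝ (e i) (f t - f s))
    (mg : ∀ i : ℤ, ∀ s t : ℝ, i ≤ s → s ≤ t → t ≤ i + 1 →
      ‖g t - g s‖ ≤ L * inner ℝ (e i) (g t - g s))
    (hend : ∀ i : ℤ, f i = g i)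
    (far : ∀ i j : ℤ, ¬ i ≡ j [ZMOD N] → ∀ s ∈ Icc (i : ℝ) (i + 1), ∀ s' ∈ Icc (i : ℝ) (i + 1),
      inner ℝ (e i) (f s) = inner ℝ (e i) (g s') → ∀ t ∈ Icc (j : ℝ) (j + 1), ∀ y,
      y = f t ∨ y = g t → inner ℝ (e i) y ≤ inner ℝ (e i) (f i) ∨
        inner ℝ (e i) (f (i + 1)) ≤ inner ℝ (e i) y ∨ ‖g s' - f s‖ ≤ c * ‖y - f s‖) :
    AmbientIsotopic (range f) (range g) := by
  have inner_mono : ∀ (h : ℝ → E3) (u : E3) (s t : ℝ),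
      ‖h t - h s‖ ≤ L * inner ℝ u (h t - h s) → inner ℝ u (h s) ≤ inner ℝ u (h t) := by
    intro h u s t hst
    rw [inner_sub_right] at hst
    by_contra hcon
    push Not at hcon
    have h1 : L * (inner ℝ u (h t) - inner ℝ u (h s)) ≤ 0 :=
      mul_nonpos_of_nonneg_of_nonpos hL (by linarith)
    have h2 : h t - h s = 0 := norm_le_zero_iff.1 (hst.trans h1)
    rw [sub_eq_zero.1 h2] at hcon
    exact lt_irrefl _ hcon
  have arc : ∀ (h : ℝ → E3) (u : E3) (i : ℤ), (∀ s t : ℝ, i ≤ s → s ≤ t → t ≤ i + 1 →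
      ‖h t - h s‖ ≤ L * inner ℝ u (h t - h s)) → ∀ x ∈ h '' Icc (i : ℝ) (i + 1),
      ∀ y ∈ h '' Icc (i : ℝ) (i + 1), ‖x - y‖ ≤ L * |inner ℝ u (x - y)| := by
    rintro h u i hm _ ⟨s, hs, rfl⟩ _ ⟨t, ht, rfl⟩
    rcases le_total s t with hst | hst
    · rw [norm_sub_rev, ← neg_sub (h t), inner_neg_right, abs_neg]
      exact (hm s t hs.1 hst ht.2).trans (mul_le_mul_of_nonneg_left (le_abs_self _) hL)
    · exact (hm t s ht.1 hst hs.2).trans (mul_le_mul_of_nonneg_left (le_abs_self _) hL)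
  let Y : ℕ → Set E3 := fun k => (⋃ i ∈ Finset.range k, g '' Icc (i : ℝ) (i + 1)) ∪
    ⋃ i ∈ Finset.Ico (k + 1) N, f '' Icc (i : ℝ) (i + 1)
  let X : ℕ → Set E3 := fun k => (⋃ i ∈ Finset.range k, g '' Icc (i : ℝ) (i + 1)) ∪
    ⋃ i ∈ Finset.Ico k N, f '' Icc (i : ℝ) (i + 1)
  have hX0 : ∀ k < N, X k = f '' Icc (k : ℝ) (k + 1) ∪ Y k := by
    intro k hk
    have : Finset.Ico k N = insert k (Finset.Ico (k + 1) N) := by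
      ext i; simp; omega
    simp only [X, Y]
    rw [this, Finset.set_biUnion_insert, union_left_comm]
  have hX1 : ∀ k, X (k + 1) = g '' Icc (k : ℝ) (k + 1) ∪ Y k := by
    intro k
    simp only [X, Y]
    rw [Finset.range_add_one, Finset.set_biUnion_insert, union_assoc]
  have hrange : ∀ h : ℝ → E3, (∀ t, h (t + N) = h t) →
      range h = ⋃ i ∈ Finset.range N, h '' Icc (i : ℝ) (i + 1) := by
    intro h hp
    ext x
    simp only [mem_range, mem_iUnion, Finset.mem_range]
    constructor
    · rintro ⟨t, rfl⟩
      have hN' : (0 : ℝ) < N := by exact_mod_cast hN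
      obtain ⟨k, hk⟩ := exists_shift_mem_Icc hN' t
      have hN1 : ((N - 1 : ℕ) : ℝ) = N - 1 := by
        rw [Nat.cast_sub hN]; simp
      rcases hk.2.lt_or_eq with h1 | h1
      · refine ⟨⌊t + k * N⌋₊, (Nat.floor_lt hk.1).2 h1, t + k * N,
          ⟨Nat.floor_le hk.1, (Nat.lt_floor_add_one _).le⟩, periodic_int_mul hp t k⟩
      · refine ⟨N - 1, by omega, t + k * N, ⟨?_, ?_⟩, periodic_int_mul hp t k⟩ <;>
          rw [h1, hN1] <;> linarith
    · rintro ⟨i, _, t, _, rfl⟩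
      exact ⟨t, rfl⟩
  have step : ∀ k < N, AmbientIsotopic (X k) (X (k + 1)) := by
    intro k hk
    rw [hX0 k hk, hX1 k]
    have mfk := mf k
    have mgk := mg k
    have hek := hend k
    have hek1 := hend (k + 1)
    push_cast at mfk mgk hek hek1
    have hk1 : (k : ℝ) ≤ k + 1 := by linarith
    have hbf : ∀ t ∈ Icc (k : ℝ) (k + 1), inner ℝ (e k) (f k) ≤ inner ℝ (e k) (f t) ∧
        inner ℝ (e k) (f t) ≤ inner ℝ (e k) (f (k + 1)) := fun t ht =>
      ⟨inner_mono f _ _ _ (mfk k t le_rfl ht.1 ht.2),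
        inner_mono f _ _ _ (mfk t _ ht.1 ht.2 le_rfl)⟩
    have hbg : ∀ t ∈ Icc (k : ℝ) (k + 1), inner ℝ (e k) (g k) ≤ inner ℝ (e k) (g t) ∧
        inner ℝ (e k) (g t) ≤ inner ℝ (e k) (g (k + 1)) := fun t ht =>
      ⟨inner_mono g _ _ _ (mgk k t le_rfl ht.1 ht.2),
        inner_mono g _ _ _ (mgk t _ ht.1 ht.2 le_rfl)⟩
    have hT : ∀ x ∈ f '' Icc (k : ℝ) (k + 1), ∃ y ∈ g '' Icc (k : ℝ) (k + 1),
        inner ℝ (e k) y = inner ℝ (e k) x := by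
      rintro _ ⟨t, ht, rfl⟩
      obtain ⟨s, hs, h⟩ := exists_same_height (i := k) hg (fun i => (hend i).symm) (e k)
        (by simpa using hbf) (t := t) (by simpa using ht)
      exact ⟨_, ⟨s, by simpa using hs, rfl⟩, h⟩
    choose! T hTm hTe using hT
    refine ambientIsotopic_graph_move (c := c) (L := L) (T := T) (a := inner ℝ (e k) (f k))
      (b := inner ℝ (e k) (f (k + 1))) (z := f k) (w := f (k + 1)) hc0 hc hL (e k)
      (by simpa using arc f (e k) k (by simpa using mfk))
      (by simpa using arc g (e k) k (by simpa using mgk)) hTm hTe ?_ ?_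
      ⟨k, ⟨le_rfl, hk1⟩, rfl⟩ ⟨k, ⟨le_rfl, hk1⟩, hek.symm⟩ rfl
      ⟨k + 1, ⟨hk1, le_rfl⟩, rfl⟩ ⟨k + 1, ⟨hk1, le_rfl⟩, hek1.symm⟩ rfl ?_
    · rintro _ ⟨t, ht, rfl⟩
      obtain ⟨s, hs, h⟩ := exists_same_height (i := k) hf hend (e k)
        (by simpa using hbg) (t := t) (by simpa using ht)
      have hs' : f s ∈ f '' Icc (k : ℝ) (k + 1) := ⟨s, by simpa using hs, rfl⟩
      refine ⟨f s, hs', ?_⟩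
      have h2 := arc g (e k) k (by simpa using mgk) (T (f s)) (by simpa using hTm _ hs') (g t)
        (by simpa using ⟨t, ht, rfl⟩)
      rw [inner_sub_right, hTe _ hs', h, sub_self, abs_zero, mul_zero] at h2
      exact sub_eq_zero.1 (norm_le_zero_iff.1 h2)
    · rintro _ ⟨t, ht, rfl⟩
      exact hbf t ht
    · rintro y hy _ ⟨s, hs, rfl⟩
      obtain ⟨s', hs', hTs⟩ := hTm (f s) ⟨s, hs, rfl⟩
      have hh : inner ℝ (e k) (f s) = inner ℝ (e k) (g s') := by
        rw [hTs, hTe _ ⟨s, hs, rfl⟩]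
      have main : ∀ j : ℕ, j < N → j ≠ k → ∀ t ∈ Icc (j : ℝ) (j + 1), (y = f t ∨ y = g t) →
          inner ℝ (e k) y ≤ inner ℝ (e k) (f k) ∨
          inner ℝ (e k) (f (k + 1)) ≤ inner ℝ (e k) y ∨ ‖T (f s) - f s‖ ≤ c * ‖y - f s‖ := by
        intro j hj hjk t ht hyt
        rw [← hTs]
        have := far k j (by
          rw [Int.natCast_modEq_iff]
          intro hcon
          exact hjk ((Nat.ModEq.eq_of_lt_of_lt hcon hk hj).symm)) s (by simpa using hs) s'
          (by simpa using hs') hh t (by simpa using ht) y hyt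
        simpa using this
      rcases hy with hy | hy
      · simp only [mem_iUnion, Finset.mem_range] at hy
        obtain ⟨j, hj, t, ht, rfl⟩ := hy
        exact main j (by omega) (by omega) t ht (Or.inr rfl)
      · simp only [mem_iUnion, Finset.mem_Ico] at hy
        obtain ⟨j, hj, t, ht, rfl⟩ := hy
        exact main j (by omega) (by omega) t ht (Or.inl rfl)
  have all : ∀ k ≤ N, AmbientIsotopic (X 0) (X k) := by
    intro k
    induction k with
    | zero => intro _; exact AmbientIsotopic.refl _
    | succ k ih => intro hk; exact (ih (by omega)).trans (step k (by omega))
  have := all N le_rfl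
  rw [hrange f pf, hrange g pg]
  simpa [X] using this

theorem injective_of_graphs (hf : Continuous f)
    (pg : ∀ t, g (t + N) = g t) (hL : 0 ≤ L) (hc : c < 1)
    (mg : ∀ i : ℤ, ∀ s t : ℝ, i ≤ s → s ≤ t → t ≤ i + 1 →
      ‖g t - g s‖ ≤ L * inner ℝ (e i) (g t - g s))
    (mg' : ∀ i : ℤ, ∀ s t : ℝ, i ≤ s → s < t → t ≤ i + 1 → g s ≠ g t)
    (hend : ∀ i : ℤ, f i = g i)
    (hinj : ∀ s t, f s = f t → ∃ k : ℤ, s - t = k * N)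
    (far : ∀ i j : ℤ, ¬ i ≡ j [ZMOD N] → ∀ s ∈ Icc (i : ℝ) (i + 1), ∀ s' ∈ Icc (i : ℝ) (i + 1),
      inner ℝ (e i) (f s) = inner ℝ (e i) (g s') → ∀ t ∈ Icc (j : ℝ) (j + 1), ∀ y,
      y = f t ∨ y = g t → inner ℝ (e i) y ≤ inner ℝ (e i) (f i) ∨
        inner ℝ (e i) (f (i + 1)) ≤ inner ℝ (e i) y ∨ ‖g s' - f s‖ ≤ c * ‖y - f s‖) :
    ∀ s t, g s = g t → ∃ k : ℤ, s - t = k * N := by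
  have heq : ∀ (u : E3) (s t : ℝ), ‖g t - g s‖ ≤ L * inner ℝ u (g t - g s) →
      inner ℝ u (g t) ≤ inner ℝ u (g s) → g t = g s := by
    intro u s t h1 h2
    rw [inner_sub_right] at h1
    have : L * (inner ℝ u (g t) - inner ℝ u (g s)) ≤ 0 :=
      mul_nonpos_of_nonneg_of_nonpos hL (by linarith)
    exact sub_eq_zero.1 (norm_le_zero_iff.1 (h1.trans this))
  have hmono : ∀ (u : E3) (s t : ℝ), ‖g t - g s‖ ≤ L * inner ℝ u (g t - g s) →
      inner ℝ u (g s) ≤ inner ℝ u (g t) := by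
    intro u s t h
    by_contra hcon
    push Not at hcon
    have := heq u s t h hcon.le
    rw [this] at hcon
    exact lt_irrefl _ hcon
  have bnd : ∀ i : ℤ, ∀ t ∈ Icc (i : ℝ) (i + 1), inner ℝ (e i) (g i) ≤ inner ℝ (e i) (g t) ∧
      inner ℝ (e i) (g t) ≤ inner ℝ (e i) (g (i + 1)) := fun i t ht =>
    ⟨hmono _ _ _ (mg i i t le_rfl ht.1 ht.2), hmono _ _ _ (mg i t _ ht.1 ht.2 le_rfl)⟩
  have hend1 : ∀ i : ℤ, f (i + 1) = g (i + 1) := fun i => by exact_mod_cast hend (i + 1)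
  have hbot : ∀ i : ℤ, ∀ t ∈ Ico (i : ℝ) (i + 1), inner ℝ (e i) (g t) ≤ inner ℝ (e i) (f i) →
      g t = f i := by
    intro i t ht h
    rw [hend i] at h ⊢
    exact heq _ _ _ (mg i i t le_rfl ht.1 ht.2.le) h
  have htop : ∀ i : ℤ, ∀ t ∈ Ico (i : ℝ) (i + 1),
      ¬ inner ℝ (e i) (f (i + 1)) ≤ inner ℝ (e i) (g t) := by
    intro i t ht h
    rw [hend1 i] at h
    exact mg' i t (i + 1) ht.1 ht.2 le_rfl (heq _ _ _ (mg i t _ ht.1 ht.2.le le_rfl) h).symm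
  have int_eq : ∀ (i j : ℤ) (t : ℝ), t ∈ Ico (i : ℝ) (i + 1) → t ∈ Ico (j : ℝ) (j + 1) →
      i = j := by
    intro i j t hi hj
    rw [← Int.floor_eq_iff.2 hi, ← Int.floor_eq_iff.2 hj]
  have fin : ∀ i j : ℤ, ¬ i ≡ j [ZMOD N] → ∀ s ∈ Ico (i : ℝ) (i + 1), ∀ r ∈ Ico (j : ℝ) (j + 1),
      f s ≠ f r := by
    intro i j hij s hs r hr h
    obtain ⟨k, hk⟩ := hinj _ _ h
    apply hij
    have : i = j + N * k := by
      refine int_eq _ _ s hs ⟨?_, ?_⟩ <;> push_cast <;> linarith [hr.1, hr.2]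
    rw [this]
    exact (Int.modEq_iff_dvd.2 ⟨-k, by ring⟩)
  have claim : ∀ i j : ℤ, ¬ i ≡ j [ZMOD N] → ∀ s ∈ Ico (i : ℝ) (i + 1),
      ∀ t ∈ Ico (j : ℝ) (j + 1), f s ≠ g t := by
    intro i j hij s hs t ht h
    have hji : ¬ j ≡ i [ZMOD N] := fun h => hij h.symm
    obtain ⟨r, hr, hrt⟩ := exists_same_height hf hend (e j) j (bnd j) (Ico_subset_Icc_self ht)
    rcases far j i hji r hr t (Ico_subset_Icc_self ht) hrt s (Ico_subset_Icc_self hs) (f s)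
      (Or.inl rfl) with h1 | h1 | h1
    · rw [h] at h1
      have := hbot j t ht h1
      rw [← h] at this
      exact fin i j hij s hs j ⟨le_rfl, by linarith⟩ this
    · rw [h] at h1
      exact htop j t ht h1
    · rw [h] at h1
      have h2 : ‖g t - f r‖ = 0 := by nlinarith [norm_nonneg (g t - f r)]
      have h3 : g t = f r := sub_eq_zero.1 (norm_eq_zero.1 h2)
      rcases hr.2.lt_or_eq with h4 | h4
      · exact fin i j hij s hs r ⟨hr.1, h4⟩ (h.trans h3)
      · rw [h4] at h3
        exact htop j t ht (by rw [h3])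
  intro s t hst
  set i := ⌊s⌋ with hi
  set j := ⌊t⌋ with hj
  have hs : s ∈ Ico (i : ℝ) (i + 1) := ⟨Int.floor_le s, Int.lt_floor_add_one s⟩
  have ht : t ∈ Ico (j : ℝ) (j + 1) := ⟨Int.floor_le t, Int.lt_floor_add_one t⟩
  by_cases hij : i ≡ j [ZMOD N]
  · obtain ⟨k, hk⟩ := Int.modEq_iff_dvd.1 hij
    have hjk : (j : ℝ) = i + k * N := by
      have : j = i + k * N := by linarith
      rw [this]; push_cast; ring
    have h1 : g (t + (-k : ℤ) * N) = g t := periodic_int_mul pg t (-k)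
    have h2 : t + (-k : ℤ) * N ∈ Ico (i : ℝ) (i + 1) := by
      push_cast; exact ⟨by linarith [ht.1], by linarith [ht.2]⟩
    have h3 : s = t + (-k : ℤ) * N := by
      rcases lt_trichotomy s (t + (-k : ℤ) * N) with h | h | h
      · exact (mg' i _ _ hs.1 h h2.2.le (hst.trans h1.symm)).elim
      · exact h
      · exact (mg' i _ _ h2.1 h hs.2.le (h1.trans hst.symm)).elim
    exact ⟨-k, by linarith⟩
  · exfalso
    obtain ⟨r, hr, hrs⟩ := exists_same_height hf hend (e i) i (bnd i) (Ico_subset_Icc_self hs)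
    rcases far i j hij r hr s (Ico_subset_Icc_self hs) hrs t (Ico_subset_Icc_self ht) (g t)
      (Or.inr rfl) with h1 | h1 | h1
    · rw [← hst] at h1
      have := hbot i s hs h1
      exact claim i j hij i ⟨le_rfl, by linarith⟩ t ht (this.symm.trans hst)
    · rw [← hst] at h1
      exact htop i s hs h1
    · rw [← hst] at h1
      have h2 : ‖g s - f r‖ = 0 := by nlinarith [norm_nonneg (g s - f r)]
      have h3 : g s = f r := sub_eq_zero.1 (norm_eq_zero.1 h2)
      rcases hr.2.lt_or_eq with h4 | h4
      · exact claim i j hij r ⟨hr.1, h4⟩ t ht (h3.symm.trans hst)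
      · rw [h4] at h3
        exact htop i s hs (by rw [h3])

end Replace

/-! ### One-sided tangents -/

theorem exists_bisector {u w : E3} (hu : u ≠ 0) (hw : w ≠ 0) (h : ¬ SameRay ℝ u (-w)) :
    ∃ e : E3, 0 < inner ℝ e u ∧ 0 < inner ℝ e w := by
  have hu' := norm_pos_iff.2 hu
  have hw' := norm_pos_iff.2 hw
  have key : 0 < ‖u‖ * ‖w‖ + inner ℝ u w := by
    have h1 := real_inner_le_norm u (-w)
    have h2 : inner ℝ u (-w) ≠ ‖u‖ * ‖-w‖ := by
      intro h3
      rw [inner_eq_norm_mul_iff_real] at h3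
      exact h (sameRay_iff_norm_smul_eq.2 h3.symm)
    have h3 := lt_of_le_of_ne h1 h2
    rw [inner_neg_right, norm_neg] at h3
    linarith
  refine ⟨‖w‖ • u + ‖u‖ • w, ?_, ?_⟩
  · rw [inner_add_left, inner_smul_left, inner_smul_left, real_inner_self_eq_norm_sq,
      real_inner_comm u w]
    simp only [conj_trivial]
    nlinarith
  · rw [inner_add_left, inner_smul_left, inner_smul_left, real_inner_self_eq_norm_sq]
    simp only [conj_trivial]
    nlinarith

/-- Near `t`, the curve `γ` restricted to `S` is well approximated by a line with velocity `v`. -/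
def HasTangent (γ : ℝ → E3) (S : Set ℝ) (t : ℝ) (v : E3) : Prop :=
  ∀ ε > 0, ∃ δ > 0, ∀ s ∈ S, ∀ s' ∈ S, |s - t| ≤ δ → |s' - t| ≤ δ →
    ‖γ s' - γ s - (s' - s) • v‖ ≤ ε * |s' - s|

theorem hasTangent_Icc {γ : ℝ → E3} {a b t : ℝ} (hab : a < b) (h : ContDiffOn ℝ 1 γ (Icc a b))
    (ht : t ∈ Icc a b) : HasTangent γ (Icc a b) t (derivWithin γ (Icc a b) t) := by
  intro ε hε
  have hu := uniqueDiffOn_Icc hab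
  have hc := (h.continuousOn_derivWithin hu le_rfl) t ht
  obtain ⟨δ, hδ, hδ'⟩ := Metric.continuousWithinAt_iff.1 hc ε hε
  refine ⟨δ / 2, by positivity, fun s hs s' hs' h1 h2 => ?_⟩
  set v := derivWithin γ (Icc a b) t
  let S := Icc a b ∩ Metric.closedBall t (δ / 2)
  have hconv : Convex ℝ S := (convex_Icc a b).inter (convex_closedBall t _)
  have := hconv.norm_image_sub_le_of_norm_hasDerivWithin_le (f := fun x => γ x - x • v)
    (f' := fun x => derivWithin γ (Icc a b) x - (1 : ℝ) • v) (C := ε) (x := s) (y := s')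
    (fun x hx => by
      have h3 := ((h.differentiableOn one_ne_zero) x hx.1).hasDerivWithinAt
      have h4 := h3.sub ((hasDerivWithinAt_id x (Icc a b)).smul_const v)
      exact h4.mono inter_subset_left)
    (fun x hx => by
      have h5 := hδ' hx.1 (lt_of_le_of_lt hx.2 (by linarith))
      rw [one_smul, ← dist_eq_norm]
      exact h5.le)
    ⟨hs, h1⟩ ⟨hs', h2⟩
  rw [Real.norm_eq_abs] at this
  have h3 : γ s' - γ s - (s' - s) • v = γ s' - s' • v - (γ s - s • v) := by
    rw [sub_smul]; abel
  rw [h3]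
  exact this

theorem HasTangent.right {γ : ℝ → E3} {t ε : ℝ} {v : E3} (hε : 0 < ε)
    (h : HasTangent γ (Icc t (t + ε)) t v) : HasTangent γ (Ici t) t v := by
  intro η hη
  obtain ⟨δ, hδ, h1⟩ := h η hη
  refine ⟨min δ ε, lt_min hδ hε, fun s hs s' hs' h2 h3 => ?_⟩
  have h2' := (abs_le.1 (h2.trans (min_le_right _ _))).2
  have h3' := (abs_le.1 (h3.trans (min_le_right _ _))).2
  exact h1 s ⟨hs, by linarith⟩ s' ⟨hs', by linarith⟩ (h2.trans (min_le_left _ _))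
    (h3.trans (min_le_left _ _))

theorem HasTangent.left {γ : ℝ → E3} {t ε : ℝ} {v : E3} (hε : 0 < ε)
    (h : HasTangent γ (Icc (t - ε) t) t v) : HasTangent γ (Iic t) t v := by
  intro η hη
  obtain ⟨δ, hδ, h1⟩ := h η hη
  refine ⟨min δ ε, lt_min hδ hε, fun s hs s' hs' h2 h3 => ?_⟩
  have h2' := (abs_le.1 (h2.trans (min_le_right _ _))).1
  have h3' := (abs_le.1 (h3.trans (min_le_right _ _))).1
  exact h1 s ⟨by linarith, hs⟩ s' ⟨by linarith, hs'⟩ (h2.trans (min_le_left _ _))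
    (h3.trans (min_le_left _ _))

theorem HasTangent.map {γ : ℝ → E3} {S : Set ℝ} {t : ℝ} {v : E3} (h : HasTangent γ S t v)
    (T : E3 ≃ᵃⁱ[ℝ] E3) : HasTangent (fun t => T (γ t)) S t (T.linearIsometryEquiv v) := by
  intro ε hε
  obtain ⟨δ, hδ, h1⟩ := h ε hε
  refine ⟨δ, hδ, fun s hs s' hs' h2 h3 => ?_⟩
  have := h1 s hs s' hs' h2 h3
  have h4 : T (γ s') - T (γ s) - (s' - s) • T.linearIsometryEquiv v =
      T.linearIsometryEquiv (γ s' - γ s - (s' - s) • v) := by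
    rw [map_sub, map_smul, ← vsub_eq_sub (γ s'), ← vsub_eq_sub (T (γ s')),
      AffineIsometryEquiv.map_vsub]
  rw [h4, LinearIsometryEquiv.norm_map]
  exact this

/-- A simple closed curve with one-sided tangents which is locally bi-Lipschitz. -/
structure IsTangentLoop (γ : ℝ → E3) : Prop where
  periodic : ∀ t, γ (t + 1) = γ t
  inj : ∀ s t, γ s = γ t → ∃ k : ℤ, s - t = k * (1 : ℝ)
  right : ∀ t, ∃ v, HasTangent γ (Ici t) t v
  left : ∀ t, ∃ v, HasTangent γ (Iic t) t v
  upper : ∀ t, ∃ δ > 0, ∃ M > 0, ∀ s s', |s - t| < δ → |s' - t| < δ →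
    ‖γ s' - γ s‖ ≤ M * |s' - s|
  lower : ∀ t, ∃ δ > 0, ∃ c > 0, ∀ s s', |s - t| < δ → |s' - t| < δ →
    c * |s' - s| ≤ ‖γ s' - γ s‖

theorem IsTangentLoop.continuous {γ : ℝ → E3} (h : IsTangentLoop γ) : Continuous γ := by
  rw [continuous_iff_continuousAt]
  intro t
  obtain ⟨δ, hδ, M, hM, h1⟩ := h.upper t
  rw [ContinuousAt, tendsto_iff_norm_sub_tendsto_zero]
  have h2 : ∀ᶠ s in 𝓝 t, ‖γ s - γ t‖ ≤ M * |s - t| := by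
    filter_upwards [Metric.ball_mem_nhds t hδ] with s hs
    exact h1 t s (by simpa using hδ) hs
  refine squeeze_zero' (Eventually.of_forall fun _ => norm_nonneg _) h2 ?_
  have : Continuous fun s : ℝ => M * |s - t| := by fun_prop
  simpa using this.tendsto t

theorem IsTangentLoop.map {γ : ℝ → E3} (h : IsTangentLoop γ) (T : E3 ≃ᵃⁱ[ℝ] E3) :
    IsTangentLoop fun t => T (γ t) := by
  have hd : ∀ s s', ‖T (γ s') - T (γ s)‖ = ‖γ s' - γ s‖ := fun s s' => by
    rw [← dist_eq_norm, ← dist_eq_norm, T.dist_map]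
  refine ⟨fun t => by simp only [h.periodic], fun s t hst => h.inj s t (T.injective hst),
    fun t => ?_, fun t => ?_, ?_, ?_⟩
  · obtain ⟨v, hv⟩ := h.right t
    exact ⟨_, hv.map T⟩
  · obtain ⟨v, hv⟩ := h.left t
    exact ⟨_, hv.map T⟩
  · simpa only [hd] using h.upper
  · simpa only [hd] using h.lower

theorem IsPiecewiseRegularCurve.isTangentLoop {γ : ℝ → E3} (h : IsPiecewiseRegularCurve γ) :
    IsTangentLoop γ := by
  have hR : ∀ t, HasTangent γ (Ici t) t (derivWithin γ (Ici t) t) := by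
    intro t
    obtain ⟨ε, hε, h1⟩ := h.right t
    have h2 := hasTangent_Icc (by linarith : t < t + ε) h1 (t := t) ⟨le_rfl, by linarith⟩
    rw [derivWithin_congr_set (t := Ici t)] at h2
    · exact h2.right hε
    · have := Iio_mem_nhds (show t < t + ε by linarith)
      filter_upwards [this] with x hx
      refine propext ⟨fun h => h.1, fun h => ⟨h, le_of_lt hx⟩⟩
  have hL : ∀ t, HasTangent γ (Iic t) t (derivWithin γ (Iic t) t) := by
    intro t
    obtain ⟨ε, hε, h1⟩ := h.left t
    have h2 := hasTangent_Icc (by linarith : t - ε < t) h1 (t := t) ⟨by linarith, le_rfl⟩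
    rw [derivWithin_congr_set (t := Iic t)] at h2
    · exact h2.left hε
    · have := Ioi_mem_nhds (show t - ε < t by linarith)
      filter_upwards [this] with x hx
      refine propext ⟨fun h => h.2, fun h => ⟨le_of_lt hx, h⟩⟩
  refine ⟨h.periodic, ?_, fun t => ⟨_, hR t⟩, fun t => ⟨_, hL t⟩, ?_, ?_⟩
  · intro s t hst
    have h1 : γ (Int.fract s) = γ (Int.fract t) := by
      have : ∀ s, γ (Int.fract s) = γ s := fun s => by
        have := periodic_int_mul h.periodic s (-⌊s⌋)
        rw [← this, Int.fract]
        congr 1; push_cast; ring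
      rw [this, this, hst]
    have h2 := h.injOn ⟨Int.fract_nonneg s, Int.fract_lt_one s⟩
      ⟨Int.fract_nonneg t, Int.fract_lt_one t⟩ h1
    obtain ⟨k, hk⟩ := Int.fract_eq_fract.1 h2
    exact ⟨k, by rw [hk]; ring⟩
  · intro t
    obtain ⟨δ, hδ, h1⟩ := hR t 1 one_pos
    obtain ⟨δ', hδ', h2⟩ := hL t 1 one_pos
    set v := derivWithin γ (Ici t) t
    set w := derivWithin γ (Iic t) t
    have h1' : ∀ s s', t ≤ s → t ≤ s' → |s - t| ≤ δ → |s' - t| ≤ δ →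
        ‖γ s' - γ s‖ ≤ (1 + ‖v‖ + ‖w‖) * |s' - s| := by
      intro s s' hs hs' h3 h4
      have := h1 s hs s' hs' h3 h4
      have h5 := norm_le_norm_add_norm_sub' (γ s' - γ s) ((s' - s) • v)
      rw [norm_smul, Real.norm_eq_abs] at h5
      nlinarith [mul_nonneg (norm_nonneg w) (abs_nonneg (s' - s))]
    have h2' : ∀ s s', s ≤ t → s' ≤ t → |s - t| ≤ δ' → |s' - t| ≤ δ' →
        ‖γ s' - γ s‖ ≤ (1 + ‖v‖ + ‖w‖) * |s' - s| := by
      intro s s' hs hs' h3 h4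
      have := h2 s hs s' hs' h3 h4
      have h5 := norm_le_norm_add_norm_sub' (γ s' - γ s) ((s' - s) • w)
      rw [norm_smul, Real.norm_eq_abs] at h5
      nlinarith [mul_nonneg (norm_nonneg v) (abs_nonneg (s' - s))]
    have hm : ∀ s s', s ≤ t → t ≤ s' → |s - t| ≤ δ' → |s' - t| ≤ δ →
        ‖γ s' - γ s‖ ≤ (1 + ‖v‖ + ‖w‖) * |s' - s| := by
      intro s s' hs hs' h3 h4
      have h5 := h2' s t hs le_rfl h3 (by simpa using hδ'.le)
      have h6 := h1' t s' le_rfl hs' (by simpa using hδ.le) h4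
      have h7 : γ s' - γ s = (γ s' - γ t) + (γ t - γ s) := by abel
      rw [h7, abs_of_nonneg (by linarith)]
      rw [abs_of_nonneg (by linarith)] at h5 h6
      refine (norm_add_le _ _).trans ?_
      linarith
    refine ⟨min δ δ', lt_min hδ hδ', 1 + ‖v‖ + ‖w‖, by positivity, fun s s' hs hs' => ?_⟩
    have a1 := hs.le.trans (min_le_left _ _)
    have a2 := hs.le.trans (min_le_right _ _)
    have b1 := hs'.le.trans (min_le_left _ _)
    have b2 := hs'.le.trans (min_le_right _ _)
    rcases le_total s t with h3 | h3 <;> rcases le_total s' t with h4 | h4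
    · exact h2' s s' h3 h4 a2 b2
    · exact hm s s' h3 h4 a2 b1
    · rw [norm_sub_rev, abs_sub_comm]
      exact hm s' s h4 h3 b2 a1
    · exact h1' s s' h3 h4 a1 b1
  · intro t
    obtain ⟨e, hew, hev⟩ := exists_bisector (h.left_ne_zero t) (h.right_ne_zero t) (h.no_cusp t)
    set v := derivWithin γ (Ici t) t
    set w := derivWithin γ (Iic t) t
    have he : 0 < ‖e‖ := by
      rw [norm_pos_iff]; rintro rfl
      simp at hew
    set c := min (inner ℝ e v) (inner ℝ e w) / 2 with hc
    have hcp : 0 < c := half_pos (lt_min hev hew)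
    have hcv : 2 * c ≤ inner ℝ e v := by rw [hc]; linarith [min_le_left (inner ℝ e v) (inner ℝ e w)]
    have hcw : 2 * c ≤ inner ℝ e w := by rw [hc]; linarith [min_le_right (inner ℝ e v) (inner ℝ e w)]
    obtain ⟨δ, hδ, h1⟩ := hR t (c / ‖e‖) (by positivity)
    obtain ⟨δ', hδ', h2⟩ := hL t (c / ‖e‖) (by positivity)
    have gen : ∀ (u : E3) (s s' : ℝ), 2 * c ≤ inner ℝ e u → s ≤ s' →
        ‖γ s' - γ s - (s' - s) • u‖ ≤ c / ‖e‖ * |s' - s| →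
        c * (s' - s) ≤ inner ℝ e (γ s' - γ s) := by
      intro u s s' hu hss h3
      have h4 := (abs_le.1 (abs_real_inner_le_norm e (γ s' - γ s - (s' - s) • u))).1
      rw [inner_sub_right, inner_smul_right] at h4
      rw [abs_of_nonneg (by linarith : 0 ≤ s' - s)] at h3
      have h5 : ‖e‖ * ‖γ s' - γ s - (s' - s) • u‖ ≤ c * (s' - s) := by
        calc _ ≤ ‖e‖ * (c / ‖e‖ * (s' - s)) := by gcongr
          _ = _ := by field_simp
      have h6 : (s' - s) * (2 * c) ≤ (s' - s) * inner ℝ e u :=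
        mul_le_mul_of_nonneg_left hu (by linarith)
      linarith
    have main : ∀ s s', s ≤ s' → |s - t| ≤ min δ δ' → |s' - t| ≤ min δ δ' →
        c * (s' - s) ≤ inner ℝ e (γ s' - γ s) := by
      intro s s' hss a b
      have a1 := a.trans (min_le_left _ _)
      have a2 := a.trans (min_le_right _ _)
      have b1 := b.trans (min_le_left _ _)
      have b2 := b.trans (min_le_right _ _)
      rcases le_total s t with h3 | h3 <;> rcases le_total s' t with h4 | h4
      · exact gen w s s' hcw hss (h2 s h3 s' h4 a2 b2)
      · have h5 := gen w s t hcw h3 (h2 s h3 t (mem_Iic.2 le_rfl) a2 (by simpa using hδ'.le))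
        have h6 := gen v t s' hcv h4 (h1 t (mem_Ici.2 le_rfl) s' h4 (by simpa using hδ.le) b1)
        rw [inner_sub_right] at *
        linarith
      · have : s = s' := by linarith
        rw [this]; simp
      · exact gen v s s' hcv hss (h1 s h3 s' h4 a1 b1)
    refine ⟨min δ δ', lt_min hδ hδ', c / ‖e‖, by positivity, ?_⟩
    have fin : ∀ s s', s ≤ s' → |s - t| ≤ min δ δ' → |s' - t| ≤ min δ δ' →
        c / ‖e‖ * |s' - s| ≤ ‖γ s' - γ s‖ := by
      intro s s' hss a b
      have h3 := (main s s' hss a b).trans (real_inner_le_norm _ _)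
      rw [abs_of_nonneg (by linarith), div_mul_eq_mul_div, div_le_iff₀ he]
      linarith
    intro s s' a b
    rcases le_total s s' with h3 | h3
    · exact fin s s' h3 a.le b.le
    · rw [abs_sub_comm, norm_sub_rev]
      exact fin s' s h3 b.le a.le

/-! ### Curves which are equivariant under a rotation -/

theorem eq_of_continuous_of_int {h : ℝ → ℝ} (hc : Continuous h) (hz : ∀ t, ∃ k : ℤ, h t = k) :
    ∃ k : ℤ, ∀ t, h t = k := by
  choose k hk using hz
  have hkc : Continuous k := by
    rw [Int.isClosedEmbedding_coe_real.isEmbedding.continuous_iff]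
    convert hc using 1
    ext t; simp [hk]
  refine ⟨k 0, fun t => ?_⟩
  rw [hk t, PreconnectedSpace.constant inferInstance hkc (x := t) (y := 0)]

theorem HasTangent.reverse {β : ℝ → E3} {S S' : Set ℝ} {t : ℝ} {v : E3}
    (h : HasTangent β S t v) (hS : ∀ s ∈ S', 1 - s ∈ S) :
    HasTangent (fun s => β (1 - s)) S' (1 - t) (-v) := by
  intro ε hε
  obtain ⟨δ, hδ, h1⟩ := h ε hε
  refine ⟨δ, hδ, fun s hs s' hs' h2 h3 => ?_⟩
  have := h1 (1 - s) (hS s hs) (1 - s') (hS s' hs')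
    (by rw [abs_sub_comm]; convert h2 using 2; ring)
    (by rw [abs_sub_comm]; convert h3 using 2; ring)
  have e1 : (1 - s') - (1 - s) = -(s' - s) := by ring
  rw [e1, abs_neg] at this
  rwa [smul_neg, ← neg_smul]

/-- A curve which is equivariant under the rotation `R` of order three, and closes up and does not
meet itself in three periods. -/
structure IsSymmetricLoop (R : E3 ≃ᵃⁱ[ℝ] E3) (β : ℝ → E3) : Prop where
  equivariant : ∀ t, β (t + 1) = R (β t)
  continuous : Continuous β
  inj : ∀ s t, β s = β t → ∃ k : ℤ, s - t = k * (3 : ℝ)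
  right : ∀ t ∈ Ico (0 : ℝ) 1, ∃ v, HasTangent β (Icc t 1) t v
  left : ∀ t ∈ Ioc (0 : ℝ) 1, ∃ v, HasTangent β (Icc 0 t) t v
  lower : ∀ t, ∃ δ > 0, ∃ c > 0, ∀ s s', |s - t| < δ → |s' - t| < δ →
    c * |s' - s| ≤ ‖β s' - β s‖

theorem IsSymmetricLoop.reverse {R S : E3 ≃ᵃⁱ[ℝ] E3} {β : ℝ → E3} (h : IsSymmetricLoop R β)
    (hS : ∀ x, S (R x) = x) : IsSymmetricLoop S fun t => β (1 - t) := by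
  refine ⟨fun t => ?_, h.continuous.comp (by fun_prop), fun s t hst => ?_, fun t ht => ?_,
    fun t ht => ?_, fun t => ?_⟩
  · have := h.equivariant (-t)
    rw [show (1 : ℝ) - (t + 1) = -t by ring, show (1 : ℝ) - t = -t + 1 by ring, this, hS]
  · obtain ⟨k, hk⟩ := h.inj _ _ hst
    exact ⟨-k, by push_cast; linarith⟩
  · obtain ⟨v, hv⟩ := h.left (1 - t) ⟨by linarith [ht.2], by linarith [ht.1]⟩
    have := hv.reverse (S' := Icc t 1) (fun s hs => ⟨by linarith [hs.2], by linarith [hs.1]⟩)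
    rw [sub_sub_cancel] at this
    exact ⟨_, this⟩
  · obtain ⟨v, hv⟩ := h.right (1 - t) ⟨by linarith [ht.2], by linarith [ht.1]⟩
    have := hv.reverse (S' := Icc 0 t) (fun s hs => ⟨by linarith [hs.2], by linarith [hs.1]⟩)
    rw [sub_sub_cancel] at this
    exact ⟨_, this⟩
  · obtain ⟨δ, hδ, c, hc, h1⟩ := h.lower (1 - t)
    refine ⟨δ, hδ, c, hc, fun s s' hs hs' => ?_⟩
    have := h1 (1 - s) (1 - s') (by rw [abs_sub_comm]; convert hs using 2; ring)
      (by rw [abs_sub_comm]; convert hs' using 2; ring)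
    rwa [show (1 - s') - (1 - s) = -(s' - s) by ring, abs_neg] at this

theorem exists_lift {γ : ℝ → E3} (h : IsTangentLoop γ) {R : E3 → E3} (hRc : Continuous R)
    (hK : ∀ t, R (γ t) ∈ range γ) : ∃ φ : ℝ → ℝ, Continuous φ ∧ ∀ t, γ (φ t) = R (γ t) := by
  have hper : Function.Periodic γ 1 := h.periodic
  have hcov := AddCircle.isCoveringMap_coe (1 : ℝ)
  have hcomm : ∀ t : ℝ, hper.lift (t : AddCircle (1 : ℝ)) = γ t := hper.lift_coe
  have hc : Continuous (hper.lift : AddCircle (1 : ℝ) → E3) := by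
    rw [QuotientAddGroup.isOpenQuotientMap_mk.isQuotientMap.continuous_iff]
    exact h.continuous
  have hi : Function.Injective (hper.lift : AddCircle (1 : ℝ) → E3) := by
    intro x y hxy
    induction x using QuotientAddGroup.induction_on with | H x => ?_
    induction y using QuotientAddGroup.induction_on with | H y => ?_
    rw [show hper.lift (x : ℝ ⧸ AddSubgroup.zmultiples (1 : ℝ)) = γ x from hcomm x,
      show hper.lift (y : ℝ ⧸ AddSubgroup.zmultiples (1 : ℝ)) = γ y from hcomm y] at hxy
    obtain ⟨k, hk⟩ := h.inj _ _ hxy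
    have : x = y + k • (1 : ℝ) := by simp; linarith
    rw [this]
    exact (AddCircle.coe_add (1 : ℝ) y (k • (1 : ℝ))).trans (by
      rw [AddCircle.coe_zsmul, AddCircle.coe_period, smul_zero, add_zero])
  have hemb := (hc.isClosedEmbedding hi).isEmbedding
  have hex : ∀ t, ∃ q : AddCircle (1 : ℝ), hper.lift q = R (γ t) := by
    intro t
    obtain ⟨s, hs⟩ := hK t
    exact ⟨(s : AddCircle (1 : ℝ)), (hcomm s).trans hs⟩
  choose q hq using hex
  have hqc : Continuous q := by
    rw [hemb.continuous_iff]
    convert hRc.comp h.continuous using 1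
    ext1 t; exact hq t
  obtain ⟨e₀, he₀⟩ := QuotientAddGroup.mk_surjective (q 0)
  obtain ⟨F, ⟨-, hF⟩, -⟩ := hcov.existsUnique_continuousMap_lifts ⟨q, hqc⟩ 0 e₀ he₀
  refine ⟨F, F.continuous, fun t => ?_⟩
  rw [← hq t, ← hcomm]
  exact congrArg _ (congrFun hF t)

theorem isSymmetricLoop_of_lift {γ : ℝ → E3} (h : IsTangentLoop γ) (R : E3 ≃ᵃⁱ[ℝ] E3)
    {φ : ℝ → ℝ} (hφ : Continuous φ) (hφR : ∀ t, γ (φ t) = R (γ t)) (hm : StrictMono φ)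
    (h3 : ∀ t, φ (φ (φ t)) = t + 1) : ∃ β, IsSymmetricLoop R β ∧ range β = range γ := by
  have hgt : ∀ t, t < φ t := by
    intro t
    by_contra hcon
    push Not at hcon
    have h1 := hm.monotone hcon
    have h2 := hm.monotone h1
    rw [h3] at h2
    linarith
  set a := φ 0 with ha
  have ha0 : 0 < a := hgt 0
  have hsurj : Function.Surjective φ := fun t => ⟨φ (φ (t - 1)), by rw [h3]; ring⟩
  let F : ℝ ≃o ℝ := hm.orderIsoOfSurjective φ hsurj
  have hF : ∀ t, F t = φ t := fun t => rfl
  let Φ : ℝ → ℝ := fun t => (F ^ ⌊t⌋) (a * Int.fract t)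
  let β : ℝ → E3 := fun t => (R ^ ⌊t⌋) (γ (a * Int.fract t))
  have hFR : ∀ (k : ℤ) t, γ ((F ^ k) t) = (R ^ k) (γ t) := by
    intro k
    induction k using Int.induction_on with
    | zero => intro t; simp
    | succ n ih =>
      intro t
      rw [zpow_add_one, zpow_add_one]
      show γ ((F ^ (n : ℤ)) (φ t)) = (R ^ (n : ℤ)) (R (γ t))
      rw [ih, hφR]
    | pred n ih =>
      intro t
      obtain ⟨s, rfl⟩ := hsurj t
      have e1 : (F ^ (-(n : ℤ) - 1)) (φ s) = (F ^ (-(n : ℤ))) s := by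
        show (F ^ (-(n : ℤ) - 1) * F) s = _
        rw [← zpow_add_one, sub_add_cancel]
      have e2 : (R ^ (-(n : ℤ) - 1)) (R (γ s)) = (R ^ (-(n : ℤ))) (γ s) := by
        show (R ^ (-(n : ℤ) - 1) * R) (γ s) = _
        rw [← zpow_add_one, sub_add_cancel]
      rw [e1, hφR, e2, ih]
  have hβΦ : ∀ t, β t = γ (Φ t) := fun t => (hFR _ _).symm
  have hΦI : ∀ (k : ℤ) (t : ℝ), (k : ℝ) ≤ t → t ≤ k + 1 → Φ t = (F ^ k) (a * (t - k)) := by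
    intro k t h1 h2
    rcases h2.lt_or_eq with h2 | h2
    · simp only [Φ]
      rw [Int.fract, Int.floor_eq_iff.2 ⟨h1, h2⟩]
    · have : ⌊t⌋ = k + 1 := by rw [h2]; exact_mod_cast Int.floor_intCast (k + 1)
      simp only [Φ]
      rw [Int.fract, this, h2, zpow_add_one]
      show (F ^ k) (F _) = _
      rw [hF]
      congr 1
      push_cast
      rw [sub_self, mul_zero, ← ha]; ring
  have hβI : ∀ (k : ℤ) (t : ℝ), (k : ℝ) ≤ t → t ≤ k + 1 → β t = (R ^ k) (γ (a * (t - k))) := by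
    intro k t h1 h2
    rw [hβΦ, hΦI k t h1 h2, hFR]
  have hΦm : StrictMono Φ := by
    intro s t hst
    have := glue_all (Q := fun s t => s = t ∨ s < t ∧ Φ s < Φ t) (fun s => Or.inl rfl)
      (by
        rintro s t u _ _ (rfl | h1) (rfl | h2)
        · exact Or.inl rfl
        · exact Or.inr h2
        · exact Or.inr h1
        · exact Or.inr ⟨h1.1.trans h2.1, h1.2.trans h2.2⟩)
      (by
        intro i s t h1 h2 h4
        rcases h2.eq_or_lt with rfl | h5
        · exact Or.inl rfl
        · refine Or.inr ⟨h5, ?_⟩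
          rw [hΦI i s h1 (by linarith), hΦI i t (by linarith) h4]
          exact (F ^ i).strictMono (mul_lt_mul_of_pos_left (by linarith) ha0)) hst.le
    rcases this with h1 | h1
    · exact (hst.ne h1).elim
    · exact h1.2
  have hΦc : Continuous Φ := by
    refine continuous_of_continuousOn_Icc fun i => ?_
    have : ContinuousOn (fun t : ℝ => (F ^ i) (a * (t - i))) (Icc (i : ℝ) (i + 1)) :=
      ((F ^ i).continuous.comp (by fun_prop)).continuousOn
    exact this.congr fun t ht => hΦI i t ht.1 ht.2
  have hΦ1 : ∀ t, Φ (t + 1) = φ (Φ t) := by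
    intro t
    simp only [Φ, Int.floor_add_one, Int.fract_add_one]
    rw [add_comm, zpow_one_add]; rfl
  have hΦ3 : ∀ t, Φ (t + 3) = Φ t + 1 := by
    intro t
    rw [show t + 3 = t + 1 + 1 + 1 by ring, hΦ1, hΦ1, hΦ1, h3]
  have hΦ3k : ∀ t (k : ℤ), Φ (t + k * 3) = Φ t + k := by
    intro t k
    induction k using Int.induction_on with
    | zero => simp
    | succ n ih =>
      push_cast at ih ⊢
      rw [show t + ((n : ℝ) + 1) * 3 = t + n * 3 + 3 by ring, hΦ3, ih]; ring
    | pred n ih =>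
      push_cast at ih ⊢
      have := hΦ3 (t + (-(n : ℝ) - 1) * 3)
      rw [show t + (-(n : ℝ) - 1) * 3 + 3 = t + -(n : ℝ) * 3 by ring, ih] at this
      linarith
  have hequi : ∀ t, β (t + 1) = R (β t) := by
    intro t
    rw [hβΦ, hβΦ, hΦ1, hφR]
  have hβ0 : ∀ t ∈ Icc (0 : ℝ) 1, β t = γ (a * t) := by
    intro t ht
    have := hβI 0 t (by simpa using ht.1) (by simpa using ht.2)
    simpa using this
  have htan : ∀ (S : Set ℝ) (S' : Set ℝ) (t : ℝ) (v : E3), HasTangent γ S (a * t) v →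
      S' ⊆ Icc 0 1 → (∀ s ∈ S', a * s ∈ S) → HasTangent β S' t (a • v) := by
    intro S S' t v hv hS' hSS ε hε
    obtain ⟨δ, hδ, h1⟩ := hv (ε / a) (by positivity)
    refine ⟨δ / a, by positivity, fun s hs s' hs' h2 h4 => ?_⟩
    rw [le_div_iff₀ ha0] at h2 h4
    have := h1 (a * s) (hSS s hs) (a * s') (hSS s' hs')
      (by rw [← mul_sub, abs_mul, abs_of_pos ha0]; linarith)
      (by rw [← mul_sub, abs_mul, abs_of_pos ha0]; linarith)
    rw [hβ0 s (hS' hs), hβ0 s' (hS' hs'), smul_smul, mul_comm (s' - s), mul_sub]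
    refine this.trans (le_of_eq ?_)
    rw [← mul_sub, abs_mul, abs_of_pos ha0]
    field_simp
  refine ⟨β, ⟨hequi, ?_, ?_, ?_, ?_, ?_⟩, ?_⟩
  · have : β = γ ∘ Φ := funext hβΦ
    rw [this]
    exact h.continuous.comp hΦc
  · intro s t hst
    rw [hβΦ, hβΦ] at hst
    obtain ⟨k, hk⟩ := h.inj _ _ hst
    refine ⟨k, ?_⟩
    have : Φ s = Φ (t + k * 3) := by rw [hΦ3k]; linarith
    linarith [hΦm.injective this]
  · intro t ht
    obtain ⟨v, hv⟩ := h.right (a * t)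
    refine ⟨_, htan _ _ t v hv (fun s hs => ⟨ht.1.trans hs.1, hs.2⟩) fun s hs => ?_⟩
    exact mul_le_mul_of_nonneg_left hs.1 ha0.le
  · intro t ht
    obtain ⟨v, hv⟩ := h.left (a * t)
    refine ⟨_, htan _ _ t v hv (fun s hs => ⟨hs.1, hs.2.trans ht.2⟩) fun s hs => ?_⟩
    exact mul_le_mul_of_nonneg_left hs.2 ha0.le
  · have shift : ∀ (k : ℤ) (t : ℝ), β (t + k) = (R ^ k) (β t) := by
      intro k t
      simp only [β, Int.floor_add_intCast, Int.fract_add_intCast]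
      rw [add_comm, zpow_add]; rfl
    have hiso : ∀ (k : ℤ) (x y : E3), ‖(R ^ k) x - (R ^ k) y‖ = ‖x - y‖ := fun k x y => by
      rw [← dist_eq_norm, ← dist_eq_norm, AffineIsometryEquiv.dist_map]
    have base : ∀ t ∈ Ioc (0 : ℝ) 1, ∃ δ > 0, ∃ c > 0, ∀ s s', |s - t| < δ → |s' - t| < δ →
        c * |s' - s| ≤ ‖β s' - β s‖ := by
      intro t ht
      obtain ⟨δ, hδ, c, hc, h1⟩ := h.lower (a * t)
      rcases ht.2.lt_or_eq with ht1 | ht1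
      · refine ⟨min (δ / a) (min t (1 - t)), lt_min (by positivity) (lt_min ht.1 (by linarith)),
          c * a, by positivity, fun s s' hs hs' => ?_⟩
        have b1 := hs.trans_le (min_le_left _ _)
        have b2 := hs'.trans_le (min_le_left _ _)
        rw [lt_div_iff₀ ha0] at b1 b2
        have mem : ∀ s, |s - t| < min (δ / a) (min t (1 - t)) → s ∈ Icc (0 : ℝ) 1 := by
          intro s hs
          have h4 := abs_lt.1 (hs.trans_le ((min_le_right _ _).trans (min_le_left _ _)))
          have h5 := abs_lt.1 (hs.trans_le ((min_le_right _ _).trans (min_le_right _ _)))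
          exact ⟨by linarith [h4.1], by linarith [h5.2]⟩
        rw [hβ0 s (mem s hs), hβ0 s' (mem s' hs')]
        have := h1 (a * s) (a * s') (by rw [← mul_sub, abs_mul, abs_of_pos ha0]; linarith)
          (by rw [← mul_sub, abs_mul, abs_of_pos ha0]; linarith)
        rw [← mul_sub, abs_mul, abs_of_pos ha0] at this
        linarith
      · subst ht1
        obtain ⟨δ₀, hδ₀, c₀, hc₀, h0⟩ := h.lower 0
        obtain ⟨δ₁, hδ₁, M, hM, hM1⟩ := h.upper a
        rw [mul_one] at h1
        have hcontφ : ∀ᶠ x in 𝓝 (0 : ℝ), |φ x - a| < min δ δ₁ := by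
          have := (hφ.tendsto 0).eventually (Metric.ball_mem_nhds (φ 0) (lt_min hδ hδ₁))
          exact this
        obtain ⟨η, hη, hη1⟩ := Metric.eventually_nhds_iff.1 hcontφ
        set r := min (min (δ / a) (δ₀ / a)) (min (η / a) 1) with hr
        have hrpos : 0 < r := by positivity
        have r1 : ∀ s, |s| < r → |a * s| < δ ∧ |a * s| < δ₀ ∧ |a * s| < η ∧ |s| < 1 := by
          intro s hs
          rw [abs_mul, abs_of_pos ha0]
          refine ⟨?_, ?_, ?_, ?_⟩
          · have := hs.trans_le ((min_le_left _ _).trans (min_le_left _ _))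
            rw [lt_div_iff₀ ha0] at this; linarith
          · have := hs.trans_le ((min_le_left _ _).trans (min_le_right _ _))
            rw [lt_div_iff₀ ha0] at this; linarith
          · have := hs.trans_le ((min_le_right _ _).trans (min_le_left _ _))
            rw [lt_div_iff₀ ha0] at this; linarith
          · exact hs.trans_le ((min_le_right _ _).trans (min_le_right _ _))
        set c₁ := min 1 (c₀ / M) with hc₁
        have hc₁p : 0 < c₁ := by positivity
        -- the lift `φ` does not contract too much near `0`
        have hφl : ∀ s s', 0 ≤ s → s ≤ s' → |s| < r → |s'| < r →
            c₁ * (a * (s' - s)) ≤ φ (a * s') - φ (a * s) := by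
          intro s s' h4 h5 h6 h7
          obtain ⟨-, p2, p3, -⟩ := r1 s h6
          obtain ⟨-, q2, q3, -⟩ := r1 s' h7
          have h8 := h0 (a * s) (a * s') (by simpa using p2) (by simpa using q2)
          have h9 := hM1 (φ (a * s)) (φ (a * s'))
            ((hη1 (by simpa using p3)).trans_le (min_le_right _ _))
            ((hη1 (by simpa using q3)).trans_le (min_le_right _ _))
          rw [hφR, hφR] at h9
          have h10 : ‖R (γ (a * s')) - R (γ (a * s))‖ = ‖γ (a * s') - γ (a * s)‖ := by
            rw [← dist_eq_norm, ← dist_eq_norm, AffineIsometryEquiv.dist_map]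
          rw [h10] at h9
          have h11 : 0 ≤ a * s' - a * s := by rw [← mul_sub]; exact mul_nonneg ha0.le (by linarith)
          have h12 : 0 ≤ φ (a * s') - φ (a * s) := by
            have := hm.monotone (by linarith : a * s ≤ a * s'); linarith
          rw [abs_of_nonneg h11] at h8
          rw [abs_of_nonneg h12] at h9
          have h13 : c₀ / M * (a * (s' - s)) ≤ φ (a * s') - φ (a * s) := by
            rw [div_mul_eq_mul_div, div_le_iff₀ hM, mul_sub]; linarith
          refine le_trans ?_ h13
          rw [mul_sub]
          exact mul_le_mul_of_nonneg_right (min_le_right _ _) h11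
        refine ⟨r, hrpos, c * c₁ * a, by positivity, ?_⟩
        let u : ℝ → ℝ := fun s => if s ≤ 1 then a * s else φ (a * (s - 1))
        have hu : ∀ s, |s - 1| < r → β s = γ (u s) ∧ |u s - a| < δ := by
          intro s hs
          obtain ⟨p1, p2, p3, p4⟩ := r1 (s - 1) hs
          have p5 := abs_lt.1 p4
          by_cases h4 : s ≤ 1
          · simp only [u, h4, if_true]
            refine ⟨hβ0 s ⟨by linarith, h4⟩, ?_⟩
            convert p1 using 2; ring
          · simp only [u, h4, if_false]
            push Not at h4
            refine ⟨?_, (hη1 (by simpa using p3)).trans_le (min_le_left _ _)⟩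
            have := hβI 1 s (by simpa using h4.le) (by push_cast; linarith)
            rw [this, hφR]
            simp
        have hul : ∀ s s', s ≤ s' → |s - 1| < r → |s' - 1| < r →
            c₁ * (a * (s' - s)) ≤ u s' - u s := by
          intro s s' hss hs hs'
          have hc1 : c₁ ≤ 1 := min_le_left _ _
          have hφ0 : ∀ s, 1 ≤ s → |s - 1| < r → c₁ * (a * (s - 1)) ≤ φ (a * (s - 1)) - a := by
            intro s h4 h5
            have := hφl 0 (s - 1) le_rfl (by linarith) (by simpa using hrpos) h5
            simpa [← ha] using this
          by_cases h4 : s ≤ 1 <;> by_cases h5 : s' ≤ 1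
          · simp only [u, h4, h5, if_true]
            rw [← mul_sub]
            have : 0 ≤ a * (s' - s) := mul_nonneg ha0.le (by linarith)
            nlinarith
          · simp only [u, h4, h5, if_true, if_false]
            push Not at h5
            have h6 := hφ0 s' h5.le hs'
            have : 0 ≤ a * (1 - s) := mul_nonneg ha0.le (by linarith)
            nlinarith
          · push Not at h4; linarith
          · simp only [u, h4, h5, if_false]
            push Not at h4 h5
            have := hφl (s - 1) (s' - 1) (by linarith) (by linarith) hs hs'
            convert this using 3; ring
        have fin : ∀ s s', s ≤ s' → |s - 1| < r → |s' - 1| < r →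
            c * c₁ * a * |s' - s| ≤ ‖β s' - β s‖ := by
          intro s s' hss hs hs'
          obtain ⟨e1, e2⟩ := hu s hs
          obtain ⟨e1', e2'⟩ := hu s' hs'
          rw [e1, e1']
          refine le_trans ?_ (h1 _ _ e2 e2')
          have h4 := hul s s' hss hs hs'
          have h5 : 0 ≤ c₁ * (a * (s' - s)) :=
            mul_nonneg hc₁p.le (mul_nonneg ha0.le (by linarith))
          rw [abs_of_nonneg (by linarith), abs_of_nonneg (by linarith)]
          have := mul_le_mul_of_nonneg_left h4 hc.le
          linarith
        intro s s' hs hs'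
        rcases le_total s s' with h4 | h4
        · exact fin s s' h4 hs hs'
        · rw [abs_sub_comm, norm_sub_rev]
          exact fin s' s h4 hs' hs
    intro t
    obtain ⟨δ, hδ, c, hc, h1⟩ := base (t - (⌈t⌉ - 1 : ℤ))
      ⟨by push_cast; linarith [Int.ceil_lt_add_one t], by push_cast; linarith [Int.le_ceil t]⟩
    refine ⟨δ, hδ, c, hc, fun s s' hs hs' => ?_⟩
    set k := ⌈t⌉ - 1
    have h4 := h1 (s - k) (s' - k) (by convert hs using 2; ring) (by convert hs' using 2; ring)
    have e1 := shift k (s - k)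
    have e2 := shift k (s' - k)
    rw [sub_add_cancel] at e1 e2
    rw [e1, e2, hiso]
    convert h4 using 3; ring
  · apply Subset.antisymm
    · rintro _ ⟨t, rfl⟩
      exact ⟨Φ t, (hβΦ t).symm⟩
    · rintro _ ⟨u, rfl⟩
      have h0 : Φ 0 = 0 := by simp [Φ]
      have h1 : Φ (0 + (⌊u⌋ : ℤ) * 3) ≤ u := by
        rw [hΦ3k, h0, zero_add]; exact Int.floor_le u
      have h2 : u ≤ Φ (0 + (⌈u⌉ : ℤ) * 3) := by
        rw [hΦ3k, h0, zero_add]; exact Int.le_ceil u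
      obtain ⟨t, ht⟩ := mem_range_of_exists_le_of_exists_ge hΦc ⟨_, h1⟩ ⟨_, h2⟩
      exact ⟨t, by rw [hβΦ, ht]⟩

/-- A loop which is carried onto itself, but not pointwise fixed, by a rotation of order three
consists of an arc and its two images. -/
theorem exists_isSymmetricLoop {γ : ℝ → E3} (h : IsTangentLoop γ) (R : E3 ≃ᵃⁱ[ℝ] E3)
    (hR3 : ∀ x, R (R (R x)) = x) (hK : ∀ t, R (γ t) ∈ range γ) (hne : ∃ t, R (γ t) ≠ γ t) :
    ∃ β, IsSymmetricLoop R β ∧ range β = range γ := by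
  obtain ⟨φ, hφ, hφR⟩ := exists_lift h R.continuous hK
  have hper : ∀ (t : ℝ) (k : ℤ), γ (t + k) = γ t := fun t k => by
    simpa using periodic_int_mul h.periodic t k
  obtain ⟨k, hk⟩ := eq_of_continuous_of_int (h := fun t => φ (φ (φ t)) - t) (by fun_prop)
    (fun t => by
      obtain ⟨k, hk⟩ := h.inj (φ (φ (φ t))) t (by rw [hφR, hφR, hφR, hR3])
      exact ⟨k, by rw [hk]; ring⟩)
  have hk' : ∀ t, φ (φ (φ t)) = t + k := fun t => by linarith [hk t]
  have hinj : Function.Injective φ := by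
    intro s t hst
    have h1 := hk' s
    rw [hst, hk'] at h1
    linarith
  have hm : StrictMono φ := by
    rcases hφ.strictMono_of_inj hinj with h1 | h1
    · exact h1
    · have h2 := h1 (h1 (h1 (zero_lt_one (α := ℝ))))
      rw [hk', hk'] at h2
      linarith
  obtain ⟨d, hd⟩ := eq_of_continuous_of_int (h := fun t => φ (t + 1) - φ t) (by fun_prop)
    (fun t => by
      obtain ⟨k, hk⟩ := h.inj (φ (t + 1)) (φ t) (by rw [hφR, hφR, h.periodic])
      exact ⟨k, by rw [hk]; ring⟩)
  have hdn : ∀ (n : ℤ) t, φ (t + n) = φ t + n * d := by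
    intro n
    induction n using Int.induction_on with
    | zero => simp
    | succ n ih =>
      intro t
      push_cast at ih ⊢
      have := hd (t + n)
      rw [← add_assoc, eq_add_of_sub_eq this, ih]; ring
    | pred n ih =>
      intro t
      push_cast at ih ⊢
      have h1 := hd (t + (-(n : ℝ) - 1))
      have h2 := ih t
      rw [show t + (-(n : ℝ) - 1) + 1 = t + -(n : ℝ) by ring, h2] at h1
      linarith
  -- a lift of finite order is the identity
  have noid : ∀ ψ : ℝ → ℝ, StrictMono ψ → (∀ t, γ (ψ t) = R (γ t)) →
      (∀ t, ψ (ψ (ψ t)) = t) → False := by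
    intro ψ h1 h2 h4
    obtain ⟨t, ht⟩ := hne
    apply ht
    rw [← h2]
    congr 1
    rcases lt_trichotomy (ψ t) t with h5 | h5 | h5
    · have h6 := h1 h5
      have h7 := h1 h6
      rw [h4] at h7
      linarith
    · exact h5
    · have h6 := h1 h5
      have h7 := h1 h6
      rw [h4] at h7
      linarith
  by_cases hk0 : k = 0
  · exact (noid φ hm hφR (fun t => by rw [hk', hk0]; simp)).elim
  have hd1 : (d : ℝ) = 1 := by
    have h1 := hdn k 0
    rw [zero_add] at h1
    have h2 : φ k = φ 0 + k := by
      have := hk' 0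
      rw [zero_add] at this
      rw [← hk' (φ 0), this]
    have hk0' : (k : ℝ) ≠ 0 := by exact_mod_cast hk0
    have h3 : (k : ℝ) * d = k * 1 := by linarith
    exact mul_left_cancel₀ hk0' h3
  have hn : ∀ t (n : ℤ), φ (t - n) = φ t - n := by
    intro t n
    have := hdn (-n) t
    rw [hd1] at this
    push_cast at this
    rw [← sub_eq_add_neg] at this
    linarith
  have hcase : k % 3 = 0 ∨ k % 3 = 1 ∨ k % 3 = 2 := by omega
  rcases hcase with h1 | h1 | h1
  · exfalso
    obtain ⟨q, hq⟩ : ∃ q, k = 3 * q := ⟨k / 3, by omega⟩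
    refine noid (fun t => φ t - q) (fun s t hst => sub_lt_sub_right (hm hst) _) (fun t => ?_)
      (fun t => ?_)
    · have := hper (φ t) (-q)
      push_cast at this
      rw [← hφR, ← this]; rfl
    · simp only [hn, hk', hq]; push_cast; ring
  · obtain ⟨q, hq⟩ : ∃ q, k = 3 * q + 1 := ⟨k / 3, by omega⟩
    refine isSymmetricLoop_of_lift h R (φ := fun t => φ t - q) (by fun_prop) (fun t => ?_)
      (fun s t hst => sub_lt_sub_right (hm hst) _) (fun t => ?_)
    · have := hper (φ t) (-q)
      push_cast at this
      rw [← hφR, ← this]; rfl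
    · simp only [hn, hk', hq]; push_cast; ring
  · obtain ⟨q, hq⟩ : ∃ q, k = 3 * q + 2 := ⟨k / 3, by omega⟩
    have hRR : ∃ β, IsSymmetricLoop (R * R) β ∧ range β = range γ := by
      refine isSymmetricLoop_of_lift h (R * R) (φ := fun t => φ (φ t) - (2 * q + 1 : ℤ))
        (by fun_prop) (fun t => ?_) (fun s t hst => sub_lt_sub_right (hm (hm hst)) _)
        (fun t => ?_)
      · have := hper (φ (φ t)) (-(2 * q + 1))
        show _ = R (R (γ t))
        rw [← hφR, ← hφR, ← this]; push_cast; rfl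
      · have e : ∀ s, φ (φ (s - (2 * q + 1 : ℤ))) = φ (φ s) - (2 * q + 1 : ℤ) := fun s => by
          rw [hn, hn]
        simp only [e, hk', hq]
        push_cast; ring
    obtain ⟨β, hβ, hβr⟩ := hRR
    refine ⟨_, hβ.reverse (S := R) (fun x => hR3 x), ?_⟩
    rw [← hβr]
    ext x
    constructor
    · rintro ⟨t, rfl⟩; exact ⟨1 - t, rfl⟩
    · rintro ⟨t, rfl⟩; exact ⟨1 - t, by simp⟩

/-! ### Normal form of threefold rotations -/

/-- The rotation which permutes the coordinates cyclically. -/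
noncomputable def cycLin : E3 ≃ₗᵢ[ℝ] E3 := LinearIsometryEquiv.piLpCongrLeft 2 ℝ ℝ (finRotate 3)

noncomputable def cyc : E3 ≃ᵃⁱ[ℝ] E3 := cycLin.toAffineIsometryEquiv

theorem cycLin_apply (x : E3) : cycLin x = !₂[x 2, x 0, x 1] := by
  ext i
  fin_cases i <;>
    simp [cycLin, LinearIsometryEquiv.piLpCongrLeft_apply] <;> rfl

theorem cyc_apply (x : E3) : cyc x = cycLin x := rfl

theorem cycLin_cube (x : E3) : cycLin (cycLin (cycLin x)) = x := by
  ext i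
  fin_cases i <;> simp [cycLin_apply]

theorem affineIsometry_apply (R : E3 ≃ᵃⁱ[ℝ] E3) (x a : E3) :
    R x = R.linearIsometryEquiv (x - a) + R a := by
  have := R.map_vadd a (x - a)
  simpa using this

section Rotation

variable {A : E3 ≃ₗᵢ[ℝ] E3}

theorem exists_fixed_unit_vector (h3 : ∀ x, A (A (A x)) = x) : ∃ n : E3, ‖n‖ = 1 ∧ A n = n := by
  by_cases h : ∃ x, x + A x + A (A x) ≠ 0
  · obtain ⟨x, hx⟩ := h
    refine ⟨‖x + A x + A (A x)‖⁻¹ • (x + A x + A (A x)), ?_, ?_⟩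
    · rw [norm_smul, norm_inv, norm_norm, inv_mul_cancel₀ (norm_ne_zero_iff.2 hx)]
    · rw [map_smul, map_add, map_add, h3]
      congr 1; abel
  · exfalso
    push Not at h
    let B : E3 →ₗ[ℝ] E3 := (2 : ℝ) • (A.toLinearEquiv : E3 →ₗ[ℝ] E3) + LinearMap.id
    have hB : B * B = (-3 : ℝ) • LinearMap.id := by
      ext1 x
      have : A (A x) = -x - A x := by
        have := h x
        rw [← sub_eq_zero, ← this]; abel
      simp only [B, Module.End.mul_apply, LinearMap.add_apply, LinearMap.smul_apply,
        LinearMap.id_apply, map_add, map_smul]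
      simp only [LinearEquiv.coe_coe, LinearIsometryEquiv.coe_toLinearEquiv, this]
      module
    have hd := congrArg LinearMap.det hB
    rw [map_mul, LinearMap.det_smul, LinearMap.det_id] at hd
    simp at hd
    nlinarith [mul_self_nonneg (LinearMap.det B)]

theorem eq_smul_of_fixed (h3 : ∀ x, A (A (A x)) = x) (h1 : ∃ x, A x ≠ x) {n : E3} (hn : n ≠ 0)
    (hAn : A n = n) {w : E3} (hw : A w = w) : ∃ r : ℝ, w = r • n := by
  let W : Submodule ℝ E3 := LinearMap.ker ((A.toLinearEquiv : E3 →ₗ[ℝ] E3) - LinearMap.id)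
  have hW : ∀ x, x ∈ W ↔ A x = x := by
    intro x
    simp [W, LinearMap.mem_ker, sub_eq_zero]
  have hfr : Module.finrank ℝ W ≤ 1 := by
    by_contra hcon
    push Not at hcon
    have hsum := Submodule.finrank_add_finrank_orthogonal W
    have h3' : Module.finrank ℝ E3 = 3 := by simp
    have horth : ∀ z ∈ Wᗮ, A z ∈ Wᗮ := by
      intro z hz
      rw [Submodule.mem_orthogonal] at hz ⊢
      intro u hu
      have := hz u hu
      rw [← this, ← A.inner_map_map u z, (hW u).1 hu]
    have hfix : ∀ z ∈ Wᗮ, A z = z := by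
      intro z hz
      have hle : Module.finrank ℝ Wᗮ ≤ 1 := by omega
      rw [finrank_le_one_iff] at hle
      obtain ⟨v, hv⟩ := hle
      rcases eq_or_ne z 0 with rfl | hz0
      · simp
      obtain ⟨r, hr⟩ := hv ⟨z, hz⟩
      obtain ⟨s, hs⟩ := hv ⟨A z, horth z hz⟩
      have hr' : r • (v : E3) = z := congrArg Subtype.val hr
      have hs' : s • (v : E3) = A z := congrArg Subtype.val hs
      have hr0 : r ≠ 0 := by
        rintro rfl
        rw [zero_smul] at hr'
        exact hz0 hr'.symm
      have hl : A z = (s / r) • z := by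
        rw [← hs', ← hr', smul_smul, div_mul_cancel₀ _ hr0]
      have h4 := h3 z
      rw [hl, map_smul, hl, map_smul, map_smul, hl, smul_smul, smul_smul] at h4
      have h5 : ((s / r) * ((s / r) * (s / r)) - 1) • z = 0 := by
        rw [sub_smul, one_smul, sub_eq_zero, mul_assoc] at *
        exact h4
      have h6 := (smul_eq_zero.1 h5).resolve_right hz0
      have h7 : s / r = 1 := by
        set l := s / r
        have : (l - 1) * (l * l + l + 1) = 0 := by linarith
        rcases mul_eq_zero.1 this with h | h
        · linarith
        · nlinarith [sq_nonneg (l + 1 / 2)]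
      rw [hl, h7, one_smul]
    obtain ⟨x, hx⟩ := h1
    apply hx
    obtain ⟨y, hy, z, hz, rfl⟩ := W.exists_add_mem_mem_orthogonal x
    rw [map_add, (hW y).1 hy, hfix z hz]
  rw [finrank_le_one_iff] at hfr
  obtain ⟨v, hv⟩ := hfr
  obtain ⟨r, hr⟩ := hv ⟨n, (hW n).2 hAn⟩
  obtain ⟨s, hs⟩ := hv ⟨w, (hW w).2 hw⟩
  have hr' : r • (v : E3) = n := congrArg Subtype.val hr
  have hs' : s • (v : E3) = w := congrArg Subtype.val hs
  have hr0 : r ≠ 0 := by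
    rintro rfl
    rw [zero_smul] at hr'
    exact hn hr'.symm
  exact ⟨s / r, by rw [← hs', ← hr', smul_smul, div_mul_cancel₀ _ hr0]⟩

/-- The rotation about the axis perpendicular to `n` and `m` which carries `n` to `m`. -/
theorem exists_rotation {n m : E3} (hn : ‖n‖ = 1) (hm : ‖m‖ = 1) (hnm : -1 < inner ℝ n m) :
    ∃ T : E3 ≃ₗᵢ[ℝ] E3, T n = m ∧ ∀ K, AmbientIsotopic K (T '' K) := by
  set c : ℝ := inner ℝ n m with hc
  have hc1 : 1 + c ≠ 0 := by linarith
  have hnn : (inner ℝ n n : ℝ) = 1 := by rw [real_inner_self_eq_norm_sq, hn]; norm_num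
  have hmm : (inner ℝ m m : ℝ) = 1 := by rw [real_inner_self_eq_norm_sq, hm]; norm_num
  have hmn : (inner ℝ m n : ℝ) = c := by rw [hc, real_inner_comm]
  let ι : E3 → E3 →ₗ[ℝ] ℝ := fun u => ((innerSL ℝ u : E3 →L[ℝ] ℝ) : E3 →ₗ[ℝ] ℝ)
  let T₀ : E3 →ₗ[ℝ] E3 := LinearMap.id - ((1 + c)⁻¹ • (ι n + ι m)).smulRight (n + m)
    + (2 • ι n).smulRight m
  have hT₀ : ∀ x, T₀ x = x - ((inner ℝ n x + inner ℝ m x) / (1 + c)) • (n + m)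
      + (2 * inner ℝ n x) • m := by
    intro x
    simp [T₀, ι, div_eq_inv_mul]
    module
  have hnorm : ∀ x, ‖T₀ x‖ = ‖x‖ := by
    intro x
    have hsq : ‖T₀ x‖ ^ 2 = ‖x‖ ^ 2 := by
      rw [← real_inner_self_eq_norm_sq, ← real_inner_self_eq_norm_sq, hT₀]
      set p : ℝ := inner ℝ n x
      set q : ℝ := inner ℝ m x
      set s : ℝ := (p + q) / (1 + c) with hs
      have hs' : s * (1 + c) = p + q := by rw [hs]; field_simp
      have hxn : (inner ℝ x n : ℝ) = p := real_inner_comm _ _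
      have hxm : (inner ℝ x m : ℝ) = q := real_inner_comm _ _
      simp only [inner_add_left, inner_add_right, inner_sub_left, inner_sub_right,
        inner_smul_left, inner_smul_right, conj_trivial, hnn, hmm, hmn, hxn, hxm, smul_add]
      rw [show (inner ℝ n m : ℝ) = c from rfl, show (inner ℝ n x : ℝ) = p from rfl,
        show (inner ℝ m x : ℝ) = q from rfl]
      linear_combination (2 * s - 4 * p) * hs'
    have := sq_eq_sq₀ (norm_nonneg (T₀ x)) (norm_nonneg x)
    exact this.1 hsq
  let T : E3 ≃ₗᵢ[ℝ] E3 := LinearIsometry.toLinearIsometryEquiv ⟨T₀, hnorm⟩ rfl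
  have hT : ∀ x, T x = T₀ x := fun x => rfl
  have hTn : T n = m := by
    rw [hT, hT₀, hnn, hmn, div_self hc1]
    module
  refine ⟨T, hTn, fun K => ?_⟩
  have := ambientIsotopic_of_linear (T.toContinuousLinearEquiv : E3 →L[ℝ] E3) ?_ K
  · exact this
  intro t ht0 ht1 x hx
  by_contra hx0
  have hxn := norm_pos_iff.2 hx0
  have hx' : (1 - t) • x + t • T x = 0 := hx
  have e1 : (1 - t) • x = -(t • T x) := by
    rw [← sub_eq_zero, sub_neg_eq_add]; exact hx'
  have e2 := congrArg norm e1
  rw [norm_neg, norm_smul, norm_smul, T.norm_map, Real.norm_of_nonneg ht0,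
    Real.norm_of_nonneg (by linarith)] at e2
  have e3 : t = 1 / 2 := by
    have := mul_right_cancel₀ hxn.ne' e2
    linarith
  have e4 : T x = -x := by
    rw [e3, show (1 : ℝ) - 1 / 2 = 1 / 2 by norm_num, ← smul_neg] at e1
    have := smul_right_injective E3 (by norm_num : (1 / 2 : ℝ) ≠ 0) e1
    exact neg_eq_iff_eq_neg.mp this.symm
  have e5 : (inner ℝ n x : ℝ) = -inner ℝ m x := by
    rw [← T.inner_map_map n x, hTn, e4, inner_neg_right]
  rw [hT, hT₀, e5, neg_add_cancel, zero_div, zero_smul, sub_zero] at e4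
  set q : ℝ := inner ℝ m x with hq
  have e6 : x = q • m := by
    have h2 : (2 : ℝ) • x = (2 : ℝ) • (q • m) := by
      have : x + x = -((2 * -q) • m) := by
        rw [← sub_eq_zero] at e4 ⊢
        rw [← e4]; abel
      rw [two_smul, this]; module
    exact smul_right_injective E3 (by norm_num : (2 : ℝ) ≠ 0) h2
  have e7 : (inner ℝ n x : ℝ) = q * c := by
    conv_lhs => rw [e6]
    rw [inner_smul_right]
  have e8 : q * (1 + c) = 0 := by rw [e7] at e5; linarith
  have e9 : q = 0 := (mul_eq_zero.1 e8).resolve_right hc1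
  rw [e9, zero_smul] at e6
  exact hx0 e6

/-- A rotation of order three which fixes the main diagonal permutes the coordinates. -/
theorem eq_cyc_of_fixed (h3 : ∀ x, A (A (A x)) = x) (h1 : ∃ x, A x ≠ x)
    (hm : A !₂[1, 1, 1] = !₂[1, 1, 1]) : (∀ x, A x = cycLin x) ∨ ∀ x, A (cycLin x) = x := by
  set m : E3 := !₂[1, 1, 1] with hmdef
  have hm0 : m ≠ 0 := by
    intro h
    have := congrArg (fun x : E3 => x 0) h
    simp [hmdef] at this
  set e : E3 := !₂[1, 0, 0] with he
  have inn : ∀ x y : E3, (inner ℝ x y : ℝ) = x 0 * y 0 + x 1 * y 1 + x 2 * y 2 := by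
    intro x y
    rw [PiLp.inner_apply, Fin.sum_univ_three]
    simp; ring
  obtain ⟨r, hr⟩ := eq_smul_of_fixed h3 h1 hm0 hm (w := e + A e + A (A e)) (by
    rw [map_add, map_add, h3]; abel)
  have hme : ∀ x : E3, (inner ℝ m (A x) : ℝ) = inner ℝ m x := fun x => by
    conv_lhs => rw [← hm]
    exact A.inner_map_map m x
  have hr1 : r = 1 := by
    have h4 : (inner ℝ m (e + A e + A (A e)) : ℝ) = inner ℝ m (r • m) := by rw [hr]
    rw [inner_add_right, inner_add_right, hme, hme, hme, inner_smul_right, inn, inn] at h4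
    simp [hmdef, he] at h4
    linarith
  rw [hr1, one_smul] at hr
  set b := A e with hb
  have hAA : (inner ℝ e (A b) : ℝ) = inner ℝ b e := by
    rw [← A.inner_map_map e (A b), hb, h3]
  have hb0 : b 0 = 0 := by
    have h4 := congrArg (fun x => (inner ℝ e x : ℝ)) hr
    simp only [inner_add_right, hAA] at h4
    rw [inn, inn, inn, inn] at h4
    simp [hmdef, he] at h4
    linarith
  have hbs : b 1 + b 2 = 1 := by
    have h4 := hme e
    rw [inn, inn] at h4
    simp [hmdef, he] at h4
    rw [← he, ← hb, hb0] at h4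
    linarith
  have hbn : b 1 * b 1 + b 2 * b 2 = 1 := by
    have h4 := A.inner_map_map e e
    rw [inn, inn] at h4
    simp [he] at h4
    rw [← he, ← hb, hb0] at h4
    linarith
  have hprod : b 1 * b 2 = 0 := by nlinarith
  have decomp : ∀ x : E3, x = x 0 • (!₂[1, 0, 0] : E3) + x 1 • (!₂[0, 1, 0] : E3)
      + x 2 • (!₂[0, 0, 1] : E3) := by
    intro x; ext i; fin_cases i <;> simp
  rcases mul_eq_zero.1 hprod with h | h
  · right
    have hbe : b = !₂[0, 0, 1] := by
      ext i; fin_cases i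
      · simpa using hb0
      · simpa using h
      · simp; linarith
    have hAb : A b = !₂[0, 1, 0] := by
      have : A b = m - e - b := by rw [← hr]; abel
      rw [this, hbe]
      ext i; fin_cases i <;> simp [hmdef, he]
    have hAAb : A (A b) = e := h3 e
    rw [hAb] at hAAb
    rw [hbe] at hAb
    intro x
    conv_lhs => rw [cycLin_apply, decomp !₂[x 2, x 0, x 1]]
    rw [map_add, map_add, map_smul, map_smul, map_smul, hAAb, hAb, ← he, ← hb, hbe, he]
    conv_rhs => rw [decomp x]
    simp; abel
  · left
    have hbe : b = !₂[0, 1, 0] := by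
      ext i; fin_cases i
      · simpa using hb0
      · simp; linarith
      · simpa using h
    have hAb : A b = !₂[0, 0, 1] := by
      have : A b = m - e - b := by rw [← hr]; abel
      rw [this, hbe]
      ext i; fin_cases i <;> simp [hmdef, he]
    have hAAb : A (A b) = e := h3 e
    rw [hAb] at hAAb
    rw [hbe] at hAb
    intro x
    conv_lhs => rw [decomp x]
    rw [map_add, map_add, map_smul, map_smul, map_smul, hAAb, hAb, ← he, ← hb, hbe, he]
    rw [cycLin_apply]
    conv_rhs => rw [decomp !₂[x 2, x 0, x 1]]
    simp; abel

end Rotation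

theorem IsThreefoldRotation.cube {R : E3 ≃ᵃⁱ[ℝ] E3} (h : IsThreefoldRotation R) (x : E3) :
    R (R (R x)) = x := by
  have := pow_orderOf_eq_one R
  rw [h.2.2] at this
  exact congrArg (fun S : E3 ≃ᵃⁱ[ℝ] E3 => S x) this

theorem IsThreefoldRotation.linear_cube {R : E3 ≃ᵃⁱ[ℝ] E3} (h : IsThreefoldRotation R) (x : E3) :
    R.linearIsometryEquiv (R.linearIsometryEquiv (R.linearIsometryEquiv x)) = x := by
  obtain ⟨a, ha⟩ := h.2.1
  have h1 := h.cube (x + a)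
  have h2 : ∀ y, R (y + a) = R.linearIsometryEquiv y + a := fun y => by
    rw [affineIsometry_apply R (y + a) a, ha, add_sub_cancel_right]
  rw [h2, h2, h2] at h1
  exact add_right_cancel h1

theorem IsThreefoldRotation.linear_ne {R : E3 ≃ᵃⁱ[ℝ] E3} (h : IsThreefoldRotation R) :
    ∃ x, R.linearIsometryEquiv x ≠ x := by
  by_contra hcon
  push Not at hcon
  obtain ⟨a, ha⟩ := h.2.1
  have : R = 1 := by
    ext1 x
    rw [affineIsometry_apply R x a, hcon, ha]
    simp
  have h3 := h.2.2
  rw [this, orderOf_one] at h3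
  norm_num at h3

/-- Every threefold rotation is conjugate to the cyclic permutation of the coordinates or its
inverse, by an isometry which is isotopic to the identity. -/
theorem IsThreefoldRotation.exists_conj {R : E3 ≃ᵃⁱ[ℝ] E3} (h : IsThreefoldRotation R) :
    ∃ T : E3 ≃ᵃⁱ[ℝ] E3, (∀ K, AmbientIsotopic K (T '' K)) ∧
      ((∀ x, T (R x) = cyc (T x)) ∨ ∀ x, cyc (T (R x)) = T x) := by
  obtain ⟨a, ha⟩ := h.2.1
  set A := R.linearIsometryEquiv with hA
  obtain ⟨n, hn, hAn⟩ : ∃ n : E3, ‖n‖ = 1 ∧ A n = n := exists_fixed_unit_vector h.linear_cube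
  set m : E3 := (√3)⁻¹ • !₂[1, 1, 1] with hm
  have h3 : ‖(!₂[1, 1, 1] : E3)‖ = √3 := by
    rw [EuclideanSpace.norm_eq, Fin.sum_univ_three]; simp; norm_num
  have hm1 : ‖m‖ = 1 := by
    rw [hm, norm_smul, h3, norm_inv, Real.norm_of_nonneg (Real.sqrt_nonneg _)]
    exact inv_mul_cancel₀ (by positivity)
  obtain ⟨n, hn, hAn, hc⟩ : ∃ n : E3, ‖n‖ = 1 ∧ A n = n ∧ -1 < (inner ℝ n m : ℝ) := by
    rcases le_total 0 (inner ℝ n m : ℝ) with h | h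
    · exact ⟨n, hn, hAn, by linarith⟩
    · exact ⟨-n, by rw [norm_neg, hn], by rw [map_neg, hAn], by rw [inner_neg_left]; linarith⟩
  obtain ⟨T₀, hT₀, hiso⟩ := exists_rotation hn hm1 hc
  let T : E3 ≃ᵃⁱ[ℝ] E3 := (AffineIsometryEquiv.constVAdd ℝ E3 (-a)).trans T₀.toAffineIsometryEquiv
  have hT : ∀ x, T x = T₀ (x - a) := by
    intro x
    show T₀ (-a + x) = _
    congr 1; abel
  let A' : E3 ≃ₗᵢ[ℝ] E3 := (T₀.symm.trans A).trans T₀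
  have hA' : ∀ x, A' (T₀ x) = T₀ (A x) := fun x => by
    show T₀ (A (T₀.symm (T₀ x))) = _
    rw [T₀.symm_apply_apply]
  have hTR : ∀ x, T (R x) = A' (T x) := by
    intro x
    rw [hT, hT, hA', affineIsometry_apply R x a, ha, add_sub_cancel_right]
  refine ⟨T, fun K => ?_, ?_⟩
  · have h4 := (ambientIsotopic_add (-a) K).trans (hiso _)
    rw [← image_comp] at h4
    convert h4 using 1
    refine image_congr fun x _ => ?_
    rw [hT, sub_eq_add_neg]; rfl
  have hs : ∀ x, ∃ y, T₀ y = x := T₀.surjective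
  have key := eq_cyc_of_fixed (A := A')
    (by
      intro x
      obtain ⟨y, rfl⟩ := hs x
      rw [hA', hA', hA', h.linear_cube])
    (by
      obtain ⟨x, hx⟩ := h.linear_ne
      refine ⟨T₀ x, ?_⟩
      rw [hA']
      exact fun h => hx (T₀.injective h))
    (by
      have h5 : A' m = m := by rw [← hT₀, hA', hAn]
      rw [hm, map_smul] at h5
      exact smul_right_injective E3 (inv_ne_zero (by positivity : √(3 : ℝ) ≠ 0)) h5)
  rcases key with h6 | h6
  · left; intro x; rw [hTR, h6, cyc_apply]
  · right; intro x
    have h7 : ∀ y, cycLin (A' y) = y := by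
      intro y
      have := h6 (cycLin (cycLin y))
      rw [cycLin_cube] at this
      rw [this, cycLin_cube]
    rw [hTR, cyc_apply, h7]

theorem not_fixed_by_cyc {γ : ℝ → E3} (h : IsTangentLoop γ) : ∃ t, cyc (γ t) ≠ γ t := by
  by_contra hcon
  push Not at hcon
  have hco : ∀ t, γ t 1 = γ t 0 ∧ γ t 2 = γ t 0 := by
    intro t
    have h1 := hcon t
    rw [cyc_apply, cycLin_apply] at h1
    have h0 := congrArg (fun x : E3 => x 0) h1
    have h2 := congrArg (fun x : E3 => x 1) h1
    simp at h0 h2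
    exact ⟨h2.symm, h0⟩
  have hc := h.continuous
  have hd : Continuous fun t => γ t 0 - γ (t + 1 / 2) 0 := by fun_prop
  have hanti : (γ (0 + 1 / 2) 0 - γ (0 + 1 / 2 + 1 / 2) 0 : ℝ) = -(γ 0 0 - γ (0 + 1 / 2) 0) := by
    rw [show (0 : ℝ) + 1 / 2 + 1 / 2 = 0 + 1 by norm_num, h.periodic]; ring
  obtain ⟨t, ht⟩ : ∃ t, γ t 0 - γ (t + 1 / 2) 0 = 0 := by
    rcases le_total (γ 0 0 - γ (0 + 1 / 2) 0) 0 with h1 | h1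
    · exact mem_range_of_exists_le_of_exists_ge hd ⟨0, h1⟩ ⟨0 + 1 / 2, by rw [hanti]; linarith⟩
    · exact mem_range_of_exists_le_of_exists_ge hd ⟨0 + 1 / 2, by rw [hanti]; linarith⟩ ⟨0, h1⟩
  have heq : γ t = γ (t + 1 / 2) := by
    ext i
    fin_cases i
    · simpa using sub_eq_zero.1 ht
    · simp only [Fin.mk_one]
      rw [(hco t).1, (hco (t + 1 / 2)).1]; exact sub_eq_zero.1 ht
    · show γ t 2 = γ (t + 1 / 2) 2
      rw [(hco t).2, (hco (t + 1 / 2)).2]; exact sub_eq_zero.1 ht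
  obtain ⟨k, hk⟩ := h.inj _ _ heq
  have h2 : (2 * k : ℝ) = -1 := by linarith
  have : 2 * k = -1 := by exact_mod_cast h2
  omega

/-- A knot with threefold rotational symmetry is isotopic to a curve which is equivariant under
the cyclic permutation of the coordinates. -/
theorem HasThreefoldRotationalSymmetry.exists_isSymmetricLoop {K : Set E3}
    (h : HasThreefoldRotationalSymmetry K) :
    ∃ β, IsSymmetricLoop cyc β ∧ AmbientIsotopic K (range β) := by
  obtain ⟨K', ⟨γ, hγ, rfl⟩, hK, R, hR, hRK⟩ := h
  obtain ⟨T, hT, hTR⟩ := hR.exists_conj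
  have hloop := hγ.isTangentLoop.map T
  have hc3 : ∀ x, cyc (cyc (cyc x)) = x := cycLin_cube
  have hinv : ∀ t, cyc (T (γ t)) ∈ range fun t => T (γ t) := by
    intro t
    rcases hTR with h1 | h1
    · rw [← h1]
      have : R (γ t) ∈ range γ := by rw [← hRK]; exact ⟨_, ⟨t, rfl⟩, rfl⟩
      obtain ⟨s, hs⟩ := this
      exact ⟨s, congrArg T hs⟩
    · have : γ t ∈ R '' range γ := by rw [hRK]; exact ⟨t, rfl⟩
      obtain ⟨_, ⟨s, rfl⟩, hs⟩ := this
      refine ⟨s, ?_⟩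
      simp only
      rw [← hs, h1]
  obtain ⟨β, hβ, hβr⟩ := CubicKnot.exists_isSymmetricLoop hloop cyc hc3 hinv
    (not_fixed_by_cyc hloop)
  refine ⟨β, hβ, hK.trans ?_⟩
  rw [hβr]
  have := hT (range γ)
  rwa [← range_comp] at this

/-! ### Approximation by polygons with vertices in the integer lattice -/

theorem ambientIsotopic_range_of_close {p q : ℝ → E3} {c : ℝ} (hc0 : 0 ≤ c)
    (hc : (lipschitzExtensionConstant E3 : ℝ) * c < 1)
    (h : ∀ s s', ‖(q s - p s) - (q s' - p s')‖ ≤ c * ‖p s - p s'‖) :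
    AmbientIsotopic (range p) (range q) := by
  classical
  let D : E3 → E3 := fun x => if h : ∃ s, p s = x then q h.choose - p h.choose else 0
  have hD : ∀ s, D (p s) = q s - p s := by
    intro s
    have hex : ∃ s', p s' = p s := ⟨s, rfl⟩
    have h1 : D (p s) = q hex.choose - p hex.choose := dif_pos hex
    have h2 := h hex.choose s
    rw [hex.choose_spec, sub_self, norm_zero, mul_zero] at h2
    rw [h1, hex.choose_spec]
    exact sub_eq_zero.1 (norm_le_zero_iff.1 h2)
  have hlip : LipschitzOnWith ⟨c, hc0⟩ D (range p) := by
    refine LipschitzOnWith.of_dist_le_mul ?_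
    rintro _ ⟨s, rfl⟩ _ ⟨s', rfl⟩
    rw [hD, hD, dist_eq_norm, dist_eq_norm]
    exact h s s'
  have := ambientIsotopic_of_lipschitzOn (c := ⟨c, hc0⟩) (by exact_mod_cast hc) hlip
  convert this using 1
  rw [← range_comp]
  congr 1
  ext1 s
  simp [hD]

/-- The cyclic permutation of the coordinates of lattice points. -/
def rot : Equiv.Perm (Fin 3 → ℤ) where
  toFun x := ![x 2, x 0, x 1]
  invFun x := ![x 1, x 2, x 0]
  left_inv x := by ext i; fin_cases i <;> rfl
  right_inv x := by ext i; fin_cases i <;> rfl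

theorem toE3_rot (x : Fin 3 → ℤ) : toE3 (rot x) = cycLin (toE3 x) := by
  rw [cycLin_apply]
  ext i
  fin_cases i <;> simp [toE3, rot]

theorem rot_cube (x : Fin 3 → ℤ) : rot (rot (rot x)) = x := by
  ext i; fin_cases i <;> rfl

/-- The piecewise linear curve with the lattice points `v i` as vertices. -/
noncomputable def latticeCurve (v : ℤ → Fin 3 → ℤ) : ℝ → E3 := pl fun i => toE3 (v i)

/-- A closed polygon with vertices in the integer lattice which is invariant under the cyclic
permutation of the coordinates and does not intersect itself. -/
structure IsSymmetricPolygon (m : ℕ) (v : ℤ → Fin 3 → ℤ) : Prop where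
  pos : 0 < m
  equivariant : ∀ i, v (i + m) = rot (v i)
  inj : ∀ s t, latticeCurve v s = latticeCurve v t → ∃ k : ℤ, s - t = k * ((3 * m : ℕ) : ℝ)

theorem latticeCurve_equivariant {m : ℕ} {v : ℤ → Fin 3 → ℤ}
    (h : ∀ i, v (i + m) = rot (v i)) (t : ℝ) :
    latticeCurve v (t + m) = cycLin (latticeCurve v t) := by
  have h1 := pl_shift (fun i => toE3 (v i)) m t
  have h2 := pl_map (fun i => toE3 (v i)) (cyc.toAffineEquiv : E3 →ᵃ[ℝ] E3) t
  push_cast at h1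
  rw [latticeCurve, h1]
  simp only [h, toE3_rot]
  exact h2

theorem latticeCurve_periodic {m : ℕ} {v : ℤ → Fin 3 → ℤ}
    (h : ∀ i, v (i + m) = rot (v i)) (t : ℝ) :
    latticeCurve v (t + (3 * m : ℕ)) = latticeCurve v t := by
  rw [show t + ((3 * m : ℕ) : ℝ) = t + m + m + m by push_cast; ring]
  rw [latticeCurve_equivariant h, latticeCurve_equivariant h, latticeCurve_equivariant h,
    cycLin_cube]

/-- A sequence on `{0, …, m}` extended equivariantly to all integers. -/
def equivariantExt (m : ℕ) (w : ℕ → Fin 3 → ℤ) (i : ℤ) : Fin 3 → ℤ :=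
  (rot ^ (i / m)) (w (i % m).toNat)

theorem equivariantExt_add {m : ℕ} (hm : 0 < m) (w : ℕ → Fin 3 → ℤ) (i : ℤ) :
    equivariantExt m w (i + m) = rot (equivariantExt m w i) := by
  have hm' : (m : ℤ) ≠ 0 := by exact_mod_cast hm.ne'
  rw [equivariantExt, equivariantExt, Int.add_emod_right, Int.add_ediv_of_dvd_right (dvd_refl _),
    Int.ediv_self hm', add_comm, zpow_one_add]
  rfl

theorem equivariantExt_of_lt {m : ℕ} (w : ℕ → Fin 3 → ℤ) {r : ℕ} (hr : r < m) :
    equivariantExt m w r = w r := by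
  have h1 : (r : ℤ) / m = 0 := by
    exact_mod_cast Nat.div_eq_of_lt hr
  have h2 : (r : ℤ) % m = r := by
    exact_mod_cast Nat.mod_eq_of_lt hr
  rw [equivariantExt, h1, h2]; simp

theorem int_induction_mod {m : ℕ} (hm : 0 < m) {B : ℤ → Prop} (h : ∀ i, B i ↔ B (i + m))
    (h0 : ∀ r : ℕ, r < m → B r) (i : ℤ) : B i := by
  have key : ∀ q r : ℤ, B r → B (r + m * q) := by
    intro q r hr
    induction q using Int.induction_on with
    | zero => simpa using hr
    | succ n ih =>
      rw [h] at ih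
      rwa [mul_add, mul_one, ← add_assoc]
    | pred n ih =>
      rw [h]
      convert ih using 1; ring
  have hm' : (0 : ℤ) < m := by exact_mod_cast hm
  have h1 := Int.emod_nonneg i hm'.ne'
  have h2 := Int.emod_lt_of_pos i hm'
  have := key (i / m) (i % m) (by
    have := h0 (i % m).toNat (by omega)
    rwa [Int.toNat_of_nonneg h1] at this)
  rwa [Int.emod_add_mul_ediv] at this

theorem norm_le_of_coord {x : E3} {η : ℝ} (hη : 0 ≤ η) (h : ∀ i, |x i| ≤ η) : ‖x‖ ≤ 2 * η := by
  refine le_of_sq_le_sq ?_ (by positivity)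
  rw [EuclideanSpace.norm_sq_eq, Fin.sum_univ_three]
  have : ∀ i, ‖x i‖ ^ 2 ≤ η ^ 2 := fun i => pow_le_pow_left₀ (norm_nonneg _) (h i) 2
  nlinarith [this 0, this 1, this 2]

/-- Every point has a neighbouring lattice point. -/
theorem exists_lattice_near (x : E3) : ∃ n : Fin 3 → ℤ, ‖toE3 n - x‖ ≤ 1 := by
  refine ⟨fun i => round (x i), ?_⟩
  have := norm_le_of_coord (x := toE3 (fun i => round (x i)) - x) (η := 1 / 2) (by norm_num)
    (fun i => by
      have := abs_sub_round (x i)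
      rw [abs_sub_comm] at this
      simpa [toE3] using this)
  linarith

/-- The curve is close to a line between the parameters `a` and `b`. -/
def IsAlmostLinear (ε : ℝ) (β : ℝ → E3) (a b : ℝ) : Prop :=
  ∃ w : E3, ∀ s ∈ Icc a b, ∀ s' ∈ Icc a b, ‖β s' - β s - (s' - s) • w‖ ≤ ε * |s' - s|

theorem exists_partition {R : E3 ≃ᵃⁱ[ℝ] E3} {β : ℝ → E3} (h : IsSymmetricLoop R β) {ε : ℝ}
    (hε : 0 < ε) : ∃ (m : ℕ) (τ : ℕ → ℝ), τ 0 = 0 ∧ τ m = 1 ∧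
      ∀ i < m, τ i < τ (i + 1) ∧ IsAlmostLinear ε β (τ i) (τ (i + 1)) := by
  let G : ℝ → ℝ → Prop := fun a b => a < b ∧ IsAlmostLinear ε β a b
  have hloc : ∀ t ∈ Icc (0 : ℝ) 1, ∃ δ > 0,
      (∀ a b, t ≤ a → a < b → b ≤ 1 → b - t ≤ δ → G a b) ∧
      (∀ a b, 0 ≤ a → a < b → b ≤ t → t - a ≤ δ → G a b) := by
    intro t ht
    have hr : ∃ δ > 0, ∀ a b, t ≤ a → a < b → b ≤ 1 → b - t ≤ δ → G a b := by
      rcases ht.2.lt_or_eq with h1 | h1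
      · obtain ⟨v, hv⟩ := h.right t ⟨ht.1, h1⟩
        obtain ⟨δ, hδ, h2⟩ := hv ε hε
        refine ⟨δ, hδ, fun a b h3 h4 h5 h6 => ⟨h4, v, fun s hs s' hs' => ?_⟩⟩
        refine h2 s ⟨h3.trans hs.1, hs.2.trans h5⟩ s' ⟨h3.trans hs'.1, hs'.2.trans h5⟩ ?_ ?_ <;>
        · rw [abs_of_nonneg] <;> linarith [hs.1, hs.2, hs'.1, hs'.2]
      · exact ⟨1, one_pos, fun a b h3 h4 h5 _ => by linarith⟩
    have hl : ∃ δ > 0, ∀ a b, 0 ≤ a → a < b → b ≤ t → t - a ≤ δ → G a b := by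
      rcases ht.1.lt_or_eq with h1 | h1
      · obtain ⟨v, hv⟩ := h.left t ⟨h1, ht.2⟩
        obtain ⟨δ, hδ, h2⟩ := hv ε hε
        refine ⟨δ, hδ, fun a b h3 h4 h5 h6 => ⟨h4, v, fun s hs s' hs' => ?_⟩⟩
        refine h2 s ⟨h3.trans hs.1, hs.2.trans h5⟩ s' ⟨h3.trans hs'.1, hs'.2.trans h5⟩ ?_ ?_ <;>
        · rw [abs_sub_comm, abs_of_nonneg] <;> linarith [hs.1, hs.2, hs'.1, hs'.2]
      · exact ⟨1, one_pos, fun a b h3 h4 h5 _ => by linarith⟩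
    obtain ⟨δ, hδ, h1⟩ := hr
    obtain ⟨δ', hδ', h2⟩ := hl
    exact ⟨min δ δ', lt_min hδ hδ',
      fun a b h3 h4 h5 h6 => h1 a b h3 h4 h5 (h6.trans (min_le_left _ _)),
      fun a b h3 h4 h5 h6 => h2 a b h3 h4 h5 (h6.trans (min_le_right _ _))⟩
  choose! δ hδ hright hleft using hloc
  obtain ⟨η, hη, hball⟩ := lebesgue_number_lemma_of_metric (s := Icc (0 : ℝ) 1)
    (c := fun t : Icc (0 : ℝ) 1 => Metric.ball (t : ℝ) (δ t)) isCompact_Icc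
    (fun _ => Metric.isOpen_ball) (fun t ht => mem_iUnion.2 ⟨⟨t, ht⟩, Metric.mem_ball_self (hδ t ht)⟩)
  have step : ∀ a b, 0 ≤ a → a < b → b ≤ 1 → b - a < η → Relation.ReflTransGen G a b := by
    intro a b h1 h2 h3 h4
    obtain ⟨⟨t, ht⟩, hsub⟩ := hball a ⟨h1, by linarith⟩
    have ha := abs_lt.1 (show |a - t| < δ t from hsub (Metric.mem_ball_self hη))
    have hb := abs_lt.1 (show |b - t| < δ t from hsub (show |b - a| < η by
      rw [abs_of_pos] <;> linarith))
    rcases le_or_gt b t with h5 | h5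
    · exact Relation.ReflTransGen.single (hleft t ht a b h1 h2 h5 (by linarith [ha.1]))
    rcases le_or_gt t a with h6 | h6
    · exact Relation.ReflTransGen.single (hright t ht a b h6 h2 h3 (by linarith [hb.2]))
    · exact (Relation.ReflTransGen.single (hleft t ht a t h1 h6 le_rfl (by linarith [ha.1]))).tail
        (hright t ht t b le_rfl h5 h3 (by linarith [hb.2]))
  obtain ⟨n, hn⟩ := exists_nat_gt (1 / η)
  have hn0 : (0 : ℝ) < n := lt_trans (by positivity) hn
  have chain : ∀ k : ℕ, k ≤ n → Relation.ReflTransGen G 0 ((k : ℝ) / n) := by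
    intro k
    induction k with
    | zero => intro _; simp; exact Relation.ReflTransGen.refl
    | succ k ih =>
      intro hk
      refine (ih (by omega)).trans (step _ _ (by positivity) ?_ ?_ ?_)
      · rw [div_lt_div_iff_of_pos_right hn0]; push_cast; linarith
      · rw [div_le_one hn0]; exact_mod_cast hk
      · rw [← sub_div, div_lt_iff₀ hn0]
        push_cast
        rw [div_lt_iff₀ hη] at hn
        linarith
  have h01 : Relation.ReflTransGen G 0 1 := by
    have := chain n le_rfl
    rwa [div_self hn0.ne'] at this
  have conv : ∀ b, Relation.ReflTransGen G 0 b → ∃ (m : ℕ) (τ : ℕ → ℝ), τ 0 = 0 ∧ τ m = b ∧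
      ∀ i < m, G (τ i) (τ (i + 1)) := by
    intro b hb
    induction hb with
    | refl => exact ⟨0, fun _ => 0, rfl, rfl, by simp⟩
    | @tail b c _ hbc ih =>
      obtain ⟨m, τ, h1, h2, h3⟩ := ih
      refine ⟨m + 1, fun i => if i ≤ m then τ i else c, by simpa using h1, by simp, ?_⟩
      intro i hi
      rcases (Nat.lt_succ_iff.1 hi).lt_or_eq with h4 | h4
      · simp only [h4.le, if_true, Nat.succ_le_of_lt h4]
        exact h3 i h4
      · subst h4
        simpa [h2] using hbc
  exact conv 1 h01

theorem IsSymmetricLoop.exists_polygon {β : ℝ → E3} (h : IsSymmetricLoop cyc β) :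
    ∃ (m : ℕ) (v : ℤ → Fin 3 → ℤ), IsSymmetricPolygon m v ∧
      AmbientIsotopic (range β) (range (latticeCurve v)) := by
  have hβ3 : ∀ t, β (t + 3) = β t := by
    intro t
    rw [show t + 3 = t + 1 + 1 + 1 by ring, h.equivariant, h.equivariant, h.equivariant]
    exact cycLin_cube _
  obtain ⟨c, hc, hca⟩ := exists_chord_arc (by norm_num) h.continuous hβ3 h.inj (fun t => by
    obtain ⟨δ, hδ, c, hc, h1⟩ := h.lower t
    refine ⟨δ, hδ, c, hc, fun s s' hs hs' => ?_⟩
    rw [abs_sub_comm, norm_sub_rev]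
    exact h1 s s' hs hs')
  set κ := (lipschitzExtensionConstant E3 : ℝ) with hκ
  have hκ0 : 0 ≤ κ := NNReal.coe_nonneg _
  set ε : ℝ := c / (6 * (1 + κ)) with hε
  have hεp : 0 < ε := by positivity
  obtain ⟨m, τ, hτ0, hτm, hτ⟩ := exists_partition h hεp
  have hm : 0 < m := by
    rcases Nat.eq_zero_or_pos m with rfl | h1
    · rw [hτ0] at hτm; norm_num at hτm
    · exact h1
  have hm0 : (0 : ℝ) < m := by exact_mod_cast hm
  -- the scale of the lattice
  obtain ⟨Q, hQ0, hQ⟩ : ∃ Q : ℝ, 0 < Q ∧ ∀ i < m, 2 / Q ≤ ε * (τ (i + 1) - τ i) := by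
    have h1 : ∀ i ∈ Finset.range m, ∀ᶠ Q : ℝ in atTop, 2 / Q ≤ ε * (τ (i + 1) - τ i) := by
      intro i hi
      have h2 : Tendsto (fun Q : ℝ => 2 / Q) atTop (𝓝 0) := tendsto_const_nhds.div_atTop tendsto_id
      have h3 : 0 < ε * (τ (i + 1) - τ i) :=
        mul_pos hεp (sub_pos.2 (hτ i (Finset.mem_range.1 hi)).1)
      exact (h2.eventually_lt_const h3).mono fun _ h => h.le
    have h4 := (Finset.eventually_all _).2 h1
    obtain ⟨Q, h5, h6⟩ := (h4.and (eventually_gt_atTop 0)).exists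
    exact ⟨Q, h6, fun i hi => h5 i (Finset.mem_range.2 hi)⟩
  choose near hnear using exists_lattice_near
  let w : ℕ → Fin 3 → ℤ := fun i => near (Q • β (τ i))
  let v : ℤ → Fin 3 → ℤ := equivariantExt m w
  have hve : ∀ i, v (i + m) = rot (v i) := equivariantExt_add hm w
  let τZ : ℤ → ℝ := fun i => τ (i % m).toNat + ((i / m : ℤ) : ℝ)
  have hm' : (m : ℤ) ≠ 0 := by exact_mod_cast hm.ne'
  have hτZ : ∀ i, τZ (i + m) = τZ i + 1 := by
    intro i
    simp only [τZ]
    rw [Int.add_emod_right, Int.add_ediv_of_dvd_right (dvd_refl _), Int.ediv_self hm']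
    push_cast; ring
  have hτZr : ∀ r : ℕ, r ≤ m → τZ r = τ r := by
    intro r hr
    rcases hr.lt_or_eq with h1 | h1
    · have e1 : (r : ℤ) / m = 0 := by exact_mod_cast Nat.div_eq_of_lt h1
      have e2 : (r : ℤ) % m = r := by exact_mod_cast Nat.mod_eq_of_lt h1
      simp only [τZ, e1, e2]; simp
    · subst h1
      have := hτZ 0
      rw [zero_add] at this
      rw [this, hτm]
      simp [τZ, hτ0]
  have hvr : ∀ r : ℕ, r ≤ m → ‖Q⁻¹ • toE3 (v r) - β (τ r)‖ ≤ 1 / Q := by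
    have base : ∀ r : ℕ, ‖Q⁻¹ • toE3 (w r) - β (τ r)‖ ≤ 1 / Q := by
      intro r
      have h1 := hnear (Q • β (τ r))
      have h2 : Q⁻¹ • toE3 (w r) - β (τ r) = Q⁻¹ • (toE3 (w r) - Q • β (τ r)) := by
        rw [smul_sub, smul_smul, inv_mul_cancel₀ hQ0.ne', one_smul]
      rw [h2, norm_smul, norm_inv, Real.norm_of_nonneg hQ0.le, one_div]
      exact mul_le_of_le_one_right (by positivity) h1
    intro r hr
    rcases hr.lt_or_eq with h1 | h1
    · simp only [v]
      rw [equivariantExt_of_lt w h1]; exact base r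
    · subst h1
      have h2 := hve 0
      rw [zero_add] at h2
      have h3 : v 0 = w 0 := by simpa using equivariantExt_of_lt w hm
      have h4 : β (τ r) = cycLin (β (τ 0)) := by
        rw [hτm, hτ0, ← zero_add (1 : ℝ), h.equivariant]; rfl
      rw [h2, h3, toE3_rot, h4, ← map_smul, ← map_sub, LinearIsometryEquiv.norm_map]
      exact base 0
  let T : ℝ → ℝ := pl τZ
  have hT1 : ∀ s, T (s + m) = T s + 1 := by
    intro s
    have h1 := pl_shift τZ m s
    push_cast at h1
    simp only [T, h1, hτZ]
    simp only [pl, AffineMap.lineMap_apply, vsub_eq_sub, vadd_eq_add, smul_eq_mul]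
    ring
  have hTlt : ∀ i : ℤ, τZ i < τZ (i + 1) := by
    refine int_induction_mod hm (fun i => ?_) (fun r hr => ?_)
    · rw [add_right_comm, hτZ, hτZ]
      exact (add_lt_add_iff_right 1).symm
    · have h2 := hτZr (r + 1) hr
      push_cast at h2
      rw [hτZr r hr.le, h2]; exact (hτ r hr).1
  have hTm : ∀ s t, s < t → T s < T t := by
    intro s t hst
    have := glue_all (Q := fun s t => s = t ∨ s < t ∧ T s < T t) (fun s => Or.inl rfl)
      (by
        rintro s t u _ _ (rfl | h1) (rfl | h2)
        · exact Or.inl rfl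
        · exact Or.inr h2
        · exact Or.inr h1
        · exact Or.inr ⟨h1.1.trans h2.1, h1.2.trans h2.2⟩)
      (by
        intro i s t h1 h2 h4
        rcases h2.eq_or_lt with rfl | h5
        · exact Or.inl rfl
        · refine Or.inr ⟨h5, ?_⟩
          have := pl_sub τZ h1 (by linarith) (by linarith) h4
          rw [smul_eq_mul] at this
          have h6 := mul_pos (sub_pos.2 h5) (sub_pos.2 (hTlt i))
          linarith) hst.le
    rcases this with h1 | h1
    · exact (hst.ne h1).elim
    · exact h1.2
  have hTsm : StrictMono T := fun s t => hTm s t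
  let P : ℝ → E3 := fun s => β (T s)
  let q : ℝ → E3 := fun s => Q⁻¹ • latticeCurve v s
  let D : ℝ → E3 := fun s => q s - P s
  have hD1 : ∀ s, D (s + m) = cycLin (D s) := by
    intro s
    simp only [D, q, P, latticeCurve_equivariant hve, hT1, h.equivariant, map_sub, map_smul]
    rfl
  have hloc : ∀ i : ℤ, ∀ s t : ℝ, i ≤ s → s ≤ t → t ≤ i + 1 →
      ‖D t - D s‖ ≤ 3 * ε * (T t - T s) := by
    refine int_induction_mod hm (fun i => ⟨fun hi s t h1 h2 h3 => ?_, fun hi s t h1 h2 h3 => ?_⟩)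
      (fun r hr => ?_)
    · push_cast at h1 h3
      have := hi (s - m) (t - m) (by linarith) (by linarith) (by linarith)
      have e1 := hD1 (s - m)
      have e2 := hD1 (t - m)
      have e3 := hT1 (s - m)
      have e4 := hT1 (t - m)
      rw [sub_add_cancel] at e1 e2 e3 e4
      rw [e1, e2, e3, e4, ← map_sub, LinearIsometryEquiv.norm_map]
      linarith
    · have := hi (s + m) (t + m) (by push_cast; linarith) (by linarith) (by push_cast; linarith)
      rw [hD1, hD1, hT1, hT1, ← map_sub, LinearIsometryEquiv.norm_map] at this
      linarith
    · intro s t h1 h2 h3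
      push_cast at h1 h3
      obtain ⟨hlt, u, hu⟩ := hτ r hr
      set a := τ r
      set b := τ (r + 1)
      have ea : τZ (r : ℤ) = a := hτZr r hr.le
      have eb : τZ ((r : ℤ) + 1) = b := by exact_mod_cast hτZr (r + 1) hr
      have hTI : ∀ x : ℝ, (r : ℝ) ≤ x → x ≤ r + 1 → T x = a + (x - r) * (b - a) := by
        intro x hx hx'
        have := pl_eq τZ (i := r) (t := x) (by simpa using hx) (by simpa using hx')
        rw [ea, eb, smul_eq_mul] at this
        simpa using this
      have hTmem : ∀ x : ℝ, (r : ℝ) ≤ x → x ≤ r + 1 → T x ∈ Icc a b := by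
        intro x hx hx'
        rw [hTI x hx hx']
        constructor <;> nlinarith
      have hs1 : s ≤ r + 1 := by linarith
      have ht1 : (r : ℝ) ≤ t := by linarith
      have hTd : T t - T s = (t - s) * (b - a) := by
        rw [hTI s h1 hs1, hTI t ht1 h3]; ring
      have hpl : latticeCurve v t - latticeCurve v s
          = (t - s) • (toE3 (v (r + 1)) - toE3 (v r)) := by
        have := pl_sub (fun i => toE3 (v i)) (i := r) (s := s) (t := t) (by simpa using h1)
          (by simpa using hs1) (by simpa using ht1) (by simpa using h3)
        exact this
      have k1 := hvr r hr.le
      have k2 := hvr (r + 1) hr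
      push_cast at k2
      have k3 := hu a ⟨le_rfl, hlt.le⟩ b ⟨hlt.le, le_rfl⟩
      rw [abs_of_pos (sub_pos.2 hlt)] at k3
      have k4 := hu (T s) (hTmem s h1 hs1) (T t) (hTmem t ht1 h3)
      have hTst : 0 ≤ T t - T s := by
        rw [hTd]; exact mul_nonneg (by linarith) (by linarith)
      rw [abs_of_nonneg hTst] at k4
      have e : D t - D s = (t - s) • ((Q⁻¹ • toE3 (v (r + 1)) - β b) - (Q⁻¹ • toE3 (v r) - β a))
          + (t - s) • (β b - β a - (b - a) • u) - (β (T t) - β (T s) - (T t - T s) • u) := by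
        have : D t - D s = Q⁻¹ • (latticeCurve v t - latticeCurve v s) - (β (T t) - β (T s)) := by
          simp only [D, q, P, smul_sub]; abel
        rw [this, hpl, hTd]
        module
      rw [e]
      refine (norm_sub_le _ _).trans ?_
      have n1 : ‖(t - s) • ((Q⁻¹ • toE3 (v (r + 1)) - β b) - (Q⁻¹ • toE3 (v r) - β a))
          + (t - s) • (β b - β a - (b - a) • u)‖ ≤
          (t - s) * (1 / Q + 1 / Q) + (t - s) * (ε * (b - a)) := by
        refine (norm_add_le _ _).trans ?_
        rw [norm_smul, norm_smul, Real.norm_of_nonneg (by linarith : 0 ≤ t - s)]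
        refine add_le_add (mul_le_mul_of_nonneg_left ?_ (by linarith))
          (mul_le_mul_of_nonneg_left k3 (by linarith))
        exact (norm_sub_le _ _).trans (add_le_add k2 k1)
      have n2 : (t - s) * (1 / Q + 1 / Q) ≤ (t - s) * (ε * (b - a)) := by
        refine mul_le_mul_of_nonneg_left ?_ (by linarith)
        have := hQ r hr
        have e5 : 1 / Q + 1 / Q = 2 / Q := by ring
        rw [e5]; exact this
      have n3 : (t - s) * (ε * (b - a)) = ε * (T t - T s) := by rw [hTd]; ring
      linarith
  have hglob : ∀ s t, s ≤ t → ‖D t - D s‖ ≤ 3 * ε * (T t - T s) := fun s t hst =>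
    glue_all (Q := fun s t => ‖D t - D s‖ ≤ 3 * ε * (T t - T s)) (by simp)
      (fun s t u _ _ h1 h2 => by
        have : D u - D s = (D u - D t) + (D t - D s) := by abel
        rw [this]
        refine (norm_add_le _ _).trans ?_
        linarith) hloc hst
  have hglob' : ∀ s t, ‖D s - D t‖ ≤ 3 * ε * |T s - T t| := by
    intro s t
    rcases le_total s t with h1 | h1
    · rw [norm_sub_rev, abs_sub_comm, abs_of_nonneg (sub_nonneg.2 (hTsm.monotone h1))]
      exact hglob s t h1
    · rw [abs_of_nonneg (sub_nonneg.2 (hTsm.monotone h1))]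
      exact hglob t s h1
  have hT3 : ∀ (s : ℝ) (k : ℤ), T (s + k * (3 * m)) = T s + k * 3 := by
    intro s k
    induction k using Int.induction_on with
    | zero => simp
    | succ n ih =>
      push_cast at ih ⊢
      rw [show s + ((n : ℝ) + 1) * (3 * m) = s + n * (3 * m) + m + m + m by ring, hT1, hT1, hT1, ih]
      ring
    | pred n ih =>
      push_cast at ih ⊢
      rw [show s + -(n : ℝ) * (3 * m) = s + (-(n : ℝ) - 1) * (3 * m) + m + m + m by ring,
        hT1, hT1, hT1] at ih
      linarith
  have hD3 : ∀ (s : ℝ) (k : ℤ), D (s + k * (3 * m)) = D s := by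
    intro s k
    refine periodic_int_mul (fun t => ?_) s k
    rw [show t + 3 * (m : ℝ) = t + m + m + m by ring, hD1, hD1, hD1, cycLin_cube]
  set c' : ℝ := 3 * ε / c with hc'
  have hc'v : c' = 1 / (2 * (1 + κ)) := by
    rw [hc', hε]; field_simp; norm_num
  have hc'0 : 0 ≤ c' := by positivity
  have hκc' : κ * c' < 1 := by
    rw [hc'v, mul_one_div, div_lt_one (by positivity)]; linarith
  have hc'1 : c' < 1 := by
    rw [hc'v, div_lt_one (by positivity)]; linarith
  have hclose : ∀ s s', ‖(q s - P s) - (q s' - P s')‖ ≤ c' * ‖P s - P s'‖ := by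
    intro s s'
    set k := round ((T s - T s') / 3)
    have h1 : |T s - (T s' + k * 3)| ≤ 3 / 2 := by
      have := abs_sub_round ((T s - T s') / 3)
      have e : T s - (T s' + k * 3) = 3 * ((T s - T s') / 3 - k) := by ring
      rw [e, abs_mul, abs_of_pos (by norm_num : (0 : ℝ) < 3)]
      linarith
    have h2 := hca (T s) (T s' + k * 3) h1
    rw [periodic_int_mul hβ3] at h2
    have h3 := hglob' s (s' + k * (3 * m))
    rw [hD3, hT3] at h3
    refine h3.trans ?_
    calc 3 * ε * |T s - (T s' + k * 3)| = c' * (c * |T s - (T s' + k * 3)|) := by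
          rw [hc']; field_simp
      _ ≤ c' * ‖P s - P s'‖ := mul_le_mul_of_nonneg_left h2 hc'0
  have hrange : range P = range β := by
    apply Subset.antisymm
    · rintro _ ⟨s, rfl⟩; exact ⟨T s, rfl⟩
    · rintro _ ⟨u, rfl⟩
      have hT0 : T 0 = 0 := by
        have h1 := pl_int τZ 0
        have h2 := hτZr 0 (Nat.zero_le _)
        push_cast at h1 h2
        rw [h2, hτ0] at h1
        exact h1
      have h1 := hT3 0 (⌊u / 3⌋)
      have h2 := hT3 0 (⌈u / 3⌉)
      rw [hT0] at h1 h2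
      obtain ⟨t, ht⟩ := mem_range_of_exists_le_of_exists_ge (c := u) (pl_continuous τZ)
        ⟨_, show T _ ≤ u by rw [h1]; linarith [Int.floor_le (u / 3)]⟩
        ⟨_, show u ≤ T _ by rw [h2]; linarith [Int.le_ceil (u / 3)]⟩
      exact ⟨t, congrArg β ht⟩
  refine ⟨m, v, ⟨hm, hve, fun s t hst => ?_⟩, ?_⟩
  · have h1 := hclose s t
    have h2 : q s = q t := by simp only [q, hst]
    rw [h2] at h1
    have h3 : q t - P s - (q t - P t) = -(P s - P t) := by abel
    rw [h3, norm_neg] at h1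
    have h4 : ‖P s - P t‖ = 0 := by nlinarith [norm_nonneg (P s - P t)]
    obtain ⟨k, hk⟩ := h.inj _ _ (sub_eq_zero.1 (norm_eq_zero.1 h4))
    refine ⟨k, ?_⟩
    have h5 : T s = T (t + k * (3 * m)) := by rw [hT3]; linarith
    have := hTsm.injective h5
    push_cast; linarith
  · have h1 := ambientIsotopic_range_of_close hc'0 hκc' hclose
    rw [hrange] at h1
    have h2 := h1.trans (ambientIsotopic_smul hQ0 (range q))
    rw [← range_comp] at h2
    convert h2 using 2
    ext1 s
    simp only [q, Function.comp_apply, smul_smul, mul_inv_cancel₀ hQ0.ne', one_smul]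

/-! ### Lattice vectors -/

theorem toE3_apply (x : Fin 3 → ℤ) (l : Fin 3) : toE3 x l = x l := rfl

theorem toE3_add (x y : Fin 3 → ℤ) : toE3 (x + y) = toE3 x + toE3 y := by
  ext l; simp [toE3_apply]

theorem toE3_sub (x y : Fin 3 → ℤ) : toE3 (x - y) = toE3 x - toE3 y := by
  ext l; simp [toE3_apply]

theorem toE3_zero : toE3 0 = 0 := by
  ext l; simp [toE3_apply]

theorem toE3_nsmul (n : ℕ) (x : Fin 3 → ℤ) : toE3 (n • x) = (n : ℝ) • toE3 x := by
  ext l; simp [toE3_apply]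

theorem toE3_injective : Function.Injective toE3 := by
  intro x y h
  ext l
  have := congrArg (fun z : E3 => z l) h
  simpa [toE3_apply] using this

theorem rot_add (x y : Fin 3 → ℤ) : rot (x + y) = rot x + rot y := by
  ext l; fin_cases l <;> rfl

theorem rot_sub (x y : Fin 3 → ℤ) : rot (x - y) = rot x - rot y := by
  ext l; fin_cases l <;> rfl

theorem rot_nsmul (n : ℕ) (x : Fin 3 → ℤ) : rot (n • x) = n • rot x := by
  ext l; fin_cases l <;> rfl

theorem exists_bound_of_periodic {N : ℕ} (hN : 0 < N) {F : ℤ → ℝ} (h : ∀ i, F (i + N) = F i) :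
    ∃ C > 0, ∀ i, F i ≤ C := by
  refine ⟨1 + ∑ r ∈ Finset.range N, |F r|, by positivity, ?_⟩
  refine int_induction_mod hN (fun i => by rw [h]) fun r hr => ?_
  have := Finset.single_le_sum (f := fun r : ℕ => |F r|) (fun _ _ => abs_nonneg _)
    (Finset.mem_range.2 hr)
  have h1 := le_abs_self (F r)
  linarith

theorem pl_strict {V : ℤ → E3} {e : E3} {A B : ℤ}
    (h : ∀ i, A ≤ i → i < B → 0 < (inner ℝ e (V (i + 1) - V i) : ℝ)) :
    ∀ s t : ℝ, A ≤ s → s < t → t ≤ B → (inner ℝ e (pl V s) : ℝ) < inner ℝ e (pl V t) := by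
  intro s t h1 h2 h3
  have := glue (Q := fun s t => s = t ∨ s < t ∧ (inner ℝ e (pl V s) : ℝ) < inner ℝ e (pl V t))
    (fun s => Or.inl rfl)
    (by
      rintro s t u _ _ (rfl | h1) (rfl | h2)
      · exact Or.inl rfl
      · exact Or.inr h2
      · exact Or.inr h1
      · exact Or.inr ⟨h1.1.trans h2.1, h1.2.trans h2.2⟩)
    (by
      intro i hA hB s t h1 h2 h4
      rcases h2.eq_or_lt with rfl | h5
      · exact Or.inl rfl
      · refine Or.inr ⟨h5, ?_⟩
        have h6 := pl_sub V h1 (by linarith) (by linarith) h4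
        have h7 := mul_pos (sub_pos.2 h5) (h i hA hB)
        rw [← inner_smul_right, ← h6, inner_sub_right] at h7
        linarith) s t h1 h2.le h3
  rcases this with h4 | h4
  · exact (h2.ne h4).elim
  · exact h4.2

theorem pl_graph {V : ℤ → E3} {e : E3} {L : ℝ} {A B : ℤ}
    (h : ∀ i, A ≤ i → i < B → ‖V (i + 1) - V i‖ ≤ L * inner ℝ e (V (i + 1) - V i)) :
    ∀ s t : ℝ, A ≤ s → s ≤ t → t ≤ B → ‖pl V t - pl V s‖ ≤ L * inner ℝ e (pl V t - pl V s) := by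
  refine glue (by simp) (fun s t u _ _ h1 h2 => ?_) (fun i hA hB s t h1 h2 h3 => ?_)
  · have : pl V u - pl V s = (pl V u - pl V t) + (pl V t - pl V s) := by abel
    rw [this, inner_add_right]
    refine (norm_add_le _ _).trans ?_
    linarith
  · rw [pl_sub V h1 (by linarith) (by linarith) h3, norm_smul, inner_smul_right,
      Real.norm_of_nonneg (by linarith)]
    have := mul_le_mul_of_nonneg_left (h i hA hB) (by linarith : 0 ≤ t - s)
    linarith

/-! ### Halving the edges -/

/-- The polygon with the doubled vertices and the doubled midpoints of the edges. -/
def halve (v : ℤ → Fin 3 → ℤ) (i : ℤ) : Fin 3 → ℤ := v (i / 2) + v ((i + 1) / 2)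

theorem halve_even (v : ℤ → Fin 3 → ℤ) (i : ℤ) : halve v (2 * i) = v i + v i := by
  rw [halve, show 2 * i / 2 = i by omega, show (2 * i + 1) / 2 = i by omega]

theorem halve_odd (v : ℤ → Fin 3 → ℤ) (i : ℤ) : halve v (2 * i + 1) = v i + v (i + 1) := by
  rw [halve, show (2 * i + 1) / 2 = i by omega, show (2 * i + 1 + 1) / 2 = i + 1 by omega]

theorem latticeCurve_halve (v : ℤ → Fin 3 → ℤ) (t : ℝ) :
    latticeCurve (halve v) t = (2 : ℝ) • latticeCurve v (t / 2) := by
  set i := ⌊t / 2⌋ with hi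
  have h1 : (i : ℝ) ≤ t / 2 := Int.floor_le _
  have h2 : t / 2 ≤ i + 1 := (Int.lt_floor_add_one _).le
  have e0 : toE3 (halve v (2 * i)) = (2 : ℝ) • toE3 (v i) := by
    rw [halve_even, toE3_add, two_smul]
  have e1 : toE3 (halve v (2 * i + 1)) = toE3 (v i) + toE3 (v (i + 1)) := by
    rw [halve_odd, toE3_add]
  have e2 : toE3 (halve v (2 * i + 1 + 1)) = (2 : ℝ) • toE3 (v (i + 1)) := by
    rw [show 2 * i + 1 + 1 = 2 * (i + 1) by ring, halve_even, toE3_add, two_smul]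
  rw [latticeCurve, latticeCurve, pl_eq (fun i => toE3 (v i)) h1 h2]
  rcases le_total t (2 * i + 1) with h3 | h3
  · rw [pl_eq _ (i := 2 * i) (by push_cast; linarith) (by push_cast; linarith), e0, e1]
    push_cast
    module
  · rw [pl_eq _ (i := 2 * i + 1) (by push_cast; linarith) (by push_cast; linarith), e1, e2]
    push_cast
    module

theorem range_latticeCurve_halve (v : ℤ → Fin 3 → ℤ) :
    range (latticeCurve (halve v)) = (fun x => (2 : ℝ) • x) '' range (latticeCurve v) := by
  rw [← range_comp]
  ext x
  constructor
  · rintro ⟨t, rfl⟩; exact ⟨t / 2, (latticeCurve_halve v t).symm⟩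
  · rintro ⟨t, rfl⟩
    refine ⟨2 * t, ?_⟩
    rw [latticeCurve_halve]; simp

theorem IsSymmetricPolygon.halve {m : ℕ} {v : ℤ → Fin 3 → ℤ} (h : IsSymmetricPolygon m v) :
    IsSymmetricPolygon (2 * m) (halve v) := by
  refine ⟨by have := h.pos; omega, fun i => ?_, fun s t hst => ?_⟩
  · simp only [CubicKnot.halve]
    rw [rot_add, ← h.equivariant, ← h.equivariant]
    congr 2 <;> push_cast <;> omega
  · rw [latticeCurve_halve, latticeCurve_halve] at hst
    obtain ⟨k, hk⟩ := h.inj _ _ (smul_right_injective E3 (two_ne_zero (α := ℝ)) hst)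
    refine ⟨k, ?_⟩
    push_cast at hk ⊢
    linarith

/-! ### Chains of directions -/

/-- Two lattice vectors lie in a common closed octant. -/
def SameOctant (a b : Fin 3 → ℤ) : Prop := ∀ l, 0 ≤ a l * b l

theorem sameOctant_rot {a b : Fin 3 → ℤ} : SameOctant (rot a) (rot b) ↔ SameOctant a b := by
  constructor
  · intro h l
    fin_cases l
    · exact h 1
    · exact h 2
    · exact h 0
  · intro h l
    fin_cases l
    · exact h 2
    · exact h 0
    · exact h 1

theorem SameOctant.nsmul_left {a b : Fin 3 → ℤ} (h : SameOctant a b) (n : ℕ) :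
    SameOctant (n • a) b := by
  intro l
  have := mul_nonneg (Int.natCast_nonneg n) (h l)
  simp only [Pi.smul_apply, nsmul_eq_mul]
  linarith

theorem SameOctant.symm {a b : Fin 3 → ℤ} (h : SameOctant a b) : SameOctant b a := by
  intro l
  rw [mul_comm]; exact h l

theorem SameOctant.nsmul_right {a b : Fin 3 → ℤ} (h : SameOctant a b) (n : ℕ) :
    SameOctant a (n • b) := (h.symm.nsmul_left n).symm

theorem SameOctant.refl (a : Fin 3 → ℤ) : SameOctant a a := fun l => mul_self_nonneg (a l)

/-- A combination of two lattice vectors with natural coefficients. -/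
def comb (a b : Fin 3 → ℤ) (p : ℕ × ℕ) : Fin 3 → ℤ := p.1 • a + p.2 • b

theorem comb_apply (a b : Fin 3 → ℤ) (p : ℕ × ℕ) (l : Fin 3) :
    comb a b p l = p.1 * a l + p.2 * b l := by
  simp [comb]

theorem exists_split (a b : Fin 3 → ℤ) (p q : ℕ × ℕ) (l : Fin 3) (hp : p ≠ 0) (hq : q ≠ 0) :
    ∃ r : ℕ × ℕ, r ≠ 0 ∧ 0 ≤ comb a b p l * comb a b r l ∧ 0 ≤ comb a b r l * comb a b q l ∧
      ∀ l', 0 ≤ comb a b p l' * comb a b q l' →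
        0 ≤ comb a b p l' * comb a b r l' ∧ 0 ≤ comb a b r l' * comb a b q l' := by
  by_cases h : 0 ≤ comb a b p l * comb a b q l
  · exact ⟨p, hp, mul_self_nonneg _, h, fun l' h' => ⟨mul_self_nonneg _, h'⟩⟩
  push Not at h
  set x := comb a b p l with hx
  set y := comb a b q l with hy
  have hx0 : x ≠ 0 := by rintro h0; rw [h0] at h; simp at h
  have hlin : ∀ l', comb a b (y.natAbs • p + x.natAbs • q) l' =
      |y| * comb a b p l' + |x| * comb a b q l' := by
    intro l'
    simp only [comb_apply, Prod.fst_add, Prod.snd_add, Prod.smul_fst, Prod.smul_snd, smul_eq_mul,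
      Nat.cast_add, Nat.cast_mul, Int.natCast_natAbs]
    ring
  have hzero : comb a b (y.natAbs • p + x.natAbs • q) l = 0 := by
    rw [hlin, ← hx, ← hy]
    rcases mul_neg_iff.1 h with ⟨h1, h2⟩ | ⟨h1, h2⟩
    · rw [abs_of_neg h2, abs_of_pos h1]; ring
    · rw [abs_of_pos h2, abs_of_neg h1]; ring
  refine ⟨y.natAbs • p + x.natAbs • q, ?_, by rw [hzero, mul_zero], by rw [hzero, zero_mul], ?_⟩
  · intro h0
    have hx1 : 0 < x.natAbs := Int.natAbs_pos.2 hx0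
    apply hq
    have h1 := congrArg Prod.fst h0
    have h2 := congrArg Prod.snd h0
    simp at h1 h2
    ext
    · exact h1.2.resolve_left hx0
    · exact h2.2.resolve_left hx0
  · intro l' h'
    rw [hlin]
    have h1 := abs_nonneg x
    have h2 := abs_nonneg y
    constructor
    · have e : comb a b p l' * (|y| * comb a b p l' + |x| * comb a b q l') =
        |y| * (comb a b p l' * comb a b p l') + |x| * (comb a b p l' * comb a b q l') := by ring
      rw [e]
      exact add_nonneg (mul_nonneg h2 (mul_self_nonneg _)) (mul_nonneg h1 h')
    · have e : (|y| * comb a b p l' + |x| * comb a b q l') * comb a b q l' =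
        |y| * (comb a b p l' * comb a b q l') + |x| * (comb a b q l' * comb a b q l') := by ring
      rw [e]
      exact add_nonneg (mul_nonneg h2 h') (mul_nonneg h1 (mul_self_nonneg _))

/-- A chain of `n` steps from `a` to `b` through nonnegative combinations; neighbours have no
opposite coordinates in `S`. -/
def IsOctantChain (a b : Fin 3 → ℤ) (n : ℕ) (S : Set (Fin 3)) (w : ℕ → ℕ × ℕ) : Prop :=
  w 0 = (1, 0) ∧ w n = (0, 1) ∧ (∀ k, w k ≠ 0) ∧
    ∀ k < n, ∀ l ∈ S, 0 ≤ comb a b (w k) l * comb a b (w (k + 1)) l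

theorem IsOctantChain.refine {a b : Fin 3 → ℤ} {n : ℕ} {S : Set (Fin 3)} {w : ℕ → ℕ × ℕ}
    (h : IsOctantChain a b n S w) (l : Fin 3) :
    ∃ w', IsOctantChain a b (2 * n) (insert l S) w' := by
  obtain ⟨h0, hn, hne, hS⟩ := h
  choose r hr0 hr1 hr2 hr3 using fun k => exists_split a b (w k) (w (k + 1)) l (hne k) (hne (k + 1))
  let w' : ℕ → ℕ × ℕ := fun j => if j % 2 = 0 then w (j / 2) else r (j / 2)
  have he : ∀ k, w' (2 * k) = w k := fun k => by simp [w']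
  have ho : ∀ k, w' (2 * k + 1) = r k := fun k => by
    simp only [w', show (2 * k + 1) % 2 = 1 by omega, show (2 * k + 1) / 2 = k by omega]
    simp
  refine ⟨w', by simpa [h0] using he 0, by rw [he, hn], fun k => ?_, fun k hk l' hl' => ?_⟩
  · rcases Nat.even_or_odd' k with ⟨j, rfl | rfl⟩
    · rw [he]; exact hne j
    · rw [ho]; exact hr0 j
  · rcases Nat.even_or_odd' k with ⟨j, rfl | rfl⟩
    · rw [he, ho]
      rcases hl' with rfl | hl'
      · exact hr1 j
      · exact (hr3 j l' (hS j (by omega) l' hl')).1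
    · rw [show 2 * j + 1 + 1 = 2 * (j + 1) by ring, he, ho]
      rcases hl' with rfl | hl'
      · exact hr2 j
      · exact (hr3 j l' (hS j (by omega) l' hl')).2

theorem exists_octant_chain (a b : Fin 3 → ℤ) :
    ∃ w : ℕ → ℕ × ℕ, w 0 = (1, 0) ∧ w 8 = (0, 1) ∧ (∀ k, w k ≠ 0) ∧
      ∀ k < 8, SameOctant (comb a b (w k)) (comb a b (w (k + 1))) := by
  have h1 : IsOctantChain a b 1 ∅ (fun k => if k = 0 then (1, 0) else (0, 1)) := by
    refine ⟨by simp, by simp, fun k => ?_, by simp⟩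
    by_cases hk : k = 0 <;> simp [hk]
  obtain ⟨w₁, hw₁⟩ := h1.refine 0
  obtain ⟨w₂, hw₂⟩ := hw₁.refine 1
  obtain ⟨w₃, h0, h8, hne, hS⟩ := hw₂.refine 2
  exact ⟨w₃, h0, h8, hne, fun k hk l => hS k hk l (by fin_cases l <;> simp)⟩

theorem IsSymmetricPolygon.comb_ne_zero {m : ℕ} {v : ℤ → Fin 3 → ℤ} (h : IsSymmetricPolygon m v)
    (i : ℤ) {p : ℕ × ℕ} (hp : p ≠ 0) : comb (v i - v (i - 1)) (v (i + 1) - v i) p ≠ 0 := by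
  intro h0
  obtain ⟨s, t⟩ := p
  have hst : (0 : ℝ) < s + t := by
    have : 0 < s + t := by
      rcases Nat.eq_zero_or_pos (s + t) with h1 | h1
      · exfalso; apply hp
        ext <;> simp <;> omega
      · exact h1
    exact_mod_cast this
  have h1 : (s : ℝ) • (toE3 (v i) - toE3 (v (i - 1))) + (t : ℝ) • (toE3 (v (i + 1)) - toE3 (v i))
      = 0 := by
    rw [← toE3_sub, ← toE3_sub, ← toE3_nsmul, ← toE3_nsmul, ← toE3_add, ← toE3_zero]
    exact congrArg toE3 h0
  set a : ℝ := t / (s + t) with ha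
  set b : ℝ := s / (s + t) with hb
  have ha0 : 0 ≤ a := by positivity
  have hb0 : 0 ≤ b := by positivity
  have hab : a + b = 1 := by rw [ha, hb]; field_simp; ring
  have e1 : latticeCurve v (i + a) = toE3 (v i) + a • (toE3 (v (i + 1)) - toE3 (v i)) := by
    rw [latticeCurve, pl_eq _ (i := i) (by linarith) (by linarith)]
    congr 2; ring
  have e2 : latticeCurve v (i - b) = toE3 (v i) - b • (toE3 (v i) - toE3 (v (i - 1))) := by
    rw [latticeCurve, pl_eq _ (i := i - 1) (by push_cast; linarith) (by push_cast; linarith),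
      sub_add_cancel]
    push_cast
    module
  have e3 : latticeCurve v (i + a) = latticeCurve v (i - b) := by
    rw [e1, e2, ← sub_eq_zero]
    have : b • (toE3 (v i) - toE3 (v (i - 1))) + a • (toE3 (v (i + 1)) - toE3 (v i)) = 0 := by
      have h2 := congrArg (fun x => (1 / (s + t : ℝ)) • x) h1
      simp only [smul_add, smul_smul, smul_zero, one_div_mul_eq_div] at h2
      exact h2
    rw [← this]; abel
  obtain ⟨k, hk⟩ := h.inj _ _ e3
  have h3 : (k * ((3 * m : ℕ) : ℤ) : ℤ) = 1 := by
    have : (k : ℝ) * ((3 * m : ℕ) : ℝ) = 1 := by linarith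
    exact_mod_cast this
  have h4 : ((3 * m : ℕ) : ℤ) ∣ 1 := ⟨k, by rw [← h3]; ring⟩
  have h5 := Int.le_of_dvd one_pos h4
  have := h.pos
  push_cast at h5
  omega

/-! ### Cutting the corners -/

theorem pl_mem_of_convex {V : ℤ → E3} {C : Set E3} (hC : Convex ℝ C) {A B : ℤ}
    (h : ∀ x, A ≤ x → x ≤ B → V x ∈ C) {t : ℝ} (h1 : A ≤ t) (h2 : t ≤ B) : pl V t ∈ C := by
  have h3 : (⌊t⌋ : ℝ) ≤ t := Int.floor_le t
  have h4 : t ≤ ⌊t⌋ + 1 := (Int.lt_floor_add_one t).le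
  have h5 : A ≤ ⌊t⌋ := Int.le_floor.2 h1
  have h6 : ⌊t⌋ ≤ B := by exact_mod_cast h3.trans h2
  rcases h6.lt_or_eq with h7 | h7
  · rw [pl_eq V h3 h4]
    exact hC.add_smul_sub_mem (h _ h5 h6) (h _ (by omega) (by omega))
      ⟨by linarith, by linarith⟩
  · have : t = B := le_antisymm h2 (by rw [← h7]; exact h3)
    rw [this, pl_int]
    exact h B (by omega) le_rfl

theorem rot_sum {ι : Type*} (s : Finset ι) (d : ι → Fin 3 → ℤ) :
    rot (∑ l ∈ s, d l) = ∑ l ∈ s, rot (d l) :=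
  map_sum (AddMonoidHom.mk' rot rot_add) d s

theorem rot_comb (a b : Fin 3 → ℤ) (p : ℕ × ℕ) : rot (comb a b p) = comb (rot a) (rot b) p := by
  simp only [comb, rot_add, rot_nsmul]

theorem toE3_comb (a b : Fin 3 → ℤ) (p : ℕ × ℕ) :
    toE3 (comb a b p) = (p.1 : ℝ) • toE3 a + (p.2 : ℝ) • toE3 b := by
  rw [comb, toE3_add, toE3_nsmul, toE3_nsmul]

theorem sum_comb (a b : Fin 3 → ℤ) (s : Finset ℕ) (q : ℕ → ℕ × ℕ) :
    ∑ l ∈ s, comb a b (q l) = comb a b (∑ l ∈ s, q l) := by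
  simp only [comb, Finset.sum_add_distrib, Prod.fst_sum, Prod.snd_sum, Finset.sum_smul]

/-- Each edge of the polygon `u` is replaced by `n` edges with the directions `d i 0, d i 1, …`. -/
def subdivide {A : Type*} [AddCommMonoid A] (n : ℕ) (u : ℤ → A) (d : ℤ → ℕ → A) (x : ℤ) : A :=
  u (x / n) + ∑ l ∈ Finset.range (x % n).toNat, d (x / n) l

section Subdivide

variable {A : Type*} [AddCommGroup A] {n : ℕ} {u : ℤ → A} {d : ℤ → ℕ → A}

theorem subdivide_of_lt (i : ℤ) {k : ℕ} (hk : k < n) :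
    subdivide n u d (n * i + k) = u i + ∑ l ∈ Finset.range k, d i l := by
  have hn : (n : ℤ) ≠ 0 := by omega
  have h1 : ((n : ℤ) * i + k) / n = i := by
    rw [add_comm, Int.add_mul_ediv_left _ _ hn, Int.ediv_eq_zero_of_lt (by omega) (by omega),
      zero_add]
  have h2 : ((n : ℤ) * i + k) % n = k := by
    rw [add_comm, Int.add_mul_emod_self_left, Int.emod_eq_of_lt (by omega) (by omega)]
  rw [subdivide, h1, h2, Int.toNat_natCast]

theorem subdivide_of_le (hn : 0 < n)
    (h : ∀ i, u i + ∑ l ∈ Finset.range n, d i l = u (i + 1)) (i : ℤ) {k : ℕ} (hk : k ≤ n) :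
    subdivide n u d (n * i + k) = u i + ∑ l ∈ Finset.range k, d i l := by
  rcases hk.lt_or_eq with h1 | h1
  · exact subdivide_of_lt i h1
  · subst h1
    have := subdivide_of_lt (u := u) (d := d) (i + 1) hn
    rw [h, show (k : ℤ) * i + k = k * (i + 1) + (0 : ℕ) by push_cast; ring, this]
    simp

theorem subdivide_step (hn : 0 < n)
    (h : ∀ i, u i + ∑ l ∈ Finset.range n, d i l = u (i + 1)) (i : ℤ) {k : ℕ} (hk : k < n) :
    subdivide n u d (n * i + k + 1) - subdivide n u d (n * i + k) = d i k := by
  have := subdivide_of_le hn h i (k := k + 1) hk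
  rw [Nat.cast_add, Nat.cast_one, ← add_assoc] at this
  rw [this, subdivide_of_lt i hk, Finset.sum_range_succ]
  abel

theorem subdivide_equivariant {u : ℤ → Fin 3 → ℤ} {d : ℤ → ℕ → Fin 3 → ℤ} (hn : 0 < n) {m : ℕ}
     (hu : ∀ i, u (i + m) = rot (u i))
    (hd : ∀ i l, d (i + m) l = rot (d i l)) (x : ℤ) :
    subdivide n u d (x + (n * m : ℕ)) = rot (subdivide n u d x) := by
  have hn' : (n : ℤ) ≠ 0 := by omega
  have h1 : (x + (n * m : ℕ)) / n = x / n + m := by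
    push_cast
    rw [Int.add_mul_ediv_left _ _ hn']
  have h2 : (x + (n * m : ℕ)) % n = x % n := by
    push_cast
    rw [Int.add_mul_emod_self_left]
  simp only [subdivide, h1, h2, rot_add, rot_sum, hu, hd]

end Subdivide

/-- Every integer is of the form `n * i + k` with `k < n`. -/
theorem exists_eq_mul_add {n : ℕ} (hn : 0 < n) (x : ℤ) : ∃ (i : ℤ) (k : ℕ), k < n ∧ x = n * i + k := by
  have hn' : (0 : ℤ) < n := by exact_mod_cast hn
  have h1 := Int.emod_nonneg x hn'.ne'
  have h2 := Int.emod_lt_of_pos x hn'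
  refine ⟨x / n, (x % n).toNat, by omega, ?_⟩
  rw [Int.toNat_of_nonneg h1, Int.mul_ediv_add_emod]

theorem not_sameRay_of_comb_ne_zero {a b : Fin 3 → ℤ} (h : ∀ p : ℕ × ℕ, p ≠ 0 → comb a b p ≠ 0) :
    ¬ SameRay ℝ (toE3 a) (-toE3 b) := by
  have ha : a ≠ 0 := by
    have := h (1, 0) (by simp)
    simpa [comb] using this
  have hb : b ≠ 0 := by
    have := h (0, 1) (by simp)
    simpa [comb] using this
  have ha' : toE3 a ≠ 0 := fun h0 => ha (toE3_injective (h0.trans toE3_zero.symm))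
  have hb' : toE3 b ≠ 0 := fun h0 => hb (toE3_injective (h0.trans toE3_zero.symm))
  intro hs
  obtain ⟨r₁, r₂, h1, h2, h3⟩ := hs.exists_pos ha' (neg_ne_zero.2 hb')
  have hl : ∀ l, r₁ * a l = - (r₂ * b l) := by
    intro l
    have := congrArg (fun z : E3 => z l) h3
    simpa [toE3_apply] using this
  obtain ⟨l, hal⟩ := Function.ne_iff.1 ha
  have habs : r₁ * |(a l : ℝ)| = r₂ * |(b l : ℝ)| := by
    have := congrArg abs (hl l)
    rwa [abs_neg, abs_mul, abs_mul, abs_of_pos h1, abs_of_pos h2] at this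
  refine h ((b l).natAbs, (a l).natAbs) ?_ ?_
  · intro h0
    have := congrArg Prod.snd h0
    simp at this
    exact hal this
  · ext l'
    rw [comb_apply]
    simp only [Int.natCast_natAbs, Pi.zero_apply]
    have : r₁ * ((|b l| * a l' + |a l| * b l' : ℤ) : ℝ) = 0 := by
      push_cast
      linear_combination |(b l : ℝ)| * hl l' + b l' * habs
    rcases mul_eq_zero.1 this with h4 | h4
    · exact (h1.ne' h4).elim
    · exact_mod_cast h4

/-- A direction in which two edges, and hence all their nonnegative combinations, ascend. -/
theorem exists_ascending {u w : E3} (hu : u ≠ 0) (hw : w ≠ 0) (h : ¬ SameRay ℝ u (-w)) :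
    ∃ e : E3, ‖u‖ ≤ inner ℝ e u ∧ ‖w‖ ≤ inner ℝ e w := by
  obtain ⟨e, h1, h2⟩ := exists_bisector hu hw h
  have h3 := norm_pos_iff.2 hu
  have h4 := norm_pos_iff.2 hw
  refine ⟨(‖u‖ / inner ℝ e u + ‖w‖ / inner ℝ e w) • e, ?_, ?_⟩
  · rw [inner_smul_left, conj_trivial, add_mul, div_mul_cancel₀ _ h1.ne']
    have : 0 ≤ ‖w‖ / inner ℝ e w * inner ℝ e u := by positivity
    linarith
  · rw [inner_smul_left, conj_trivial, add_mul, div_mul_cancel₀ _ h2.ne']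
    have : 0 ≤ ‖u‖ / inner ℝ e u * inner ℝ e w := by positivity
    linarith

theorem sub_add_mul_mem_of_not_modEq {N : ℕ} {i j : ℤ} (h : ¬ i ≡ j [ZMOD N]) {t : ℝ}
    (ht : t ∈ Icc (j : ℝ) (j + 1)) (k : ℤ) : 1 / 2 ≤ |t - (i + 1 / 2) - k * N| := by
  have h1 : j - i - k * N ≠ 0 := by
    intro h0
    apply h
    rw [Int.modEq_iff_dvd]
    exact ⟨k, by linarith⟩
  rcases lt_or_gt_of_ne h1 with h2 | h2
  · have h3 : ((j - i - k * N : ℤ) : ℝ) ≤ -1 := by exact_mod_cast (by omega : j - i - k * N ≤ -1)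
    push_cast at h3
    rw [abs_of_nonpos] <;> linarith [ht.1, ht.2]
  · have h3 : (1 : ℝ) ≤ ((j - i - k * N : ℤ) : ℝ) := by exact_mod_cast h2
    push_cast at h3
    rw [abs_of_nonneg] <;> linarith [ht.1, ht.2]

/-- Two curves which differ only near the points `f (i + 1 / 2)`. -/
theorem graphs_far {N : ℕ} {f g : ℝ → E3} {e : ℤ → E3} {η ρ c : ℝ} (hc0 : 0 ≤ c) (hc1 : c ≤ 1)
    (hη : 4 * η ≤ c * ρ) (hη0 : 0 ≤ η) (hρ : 0 < ρ)
    (sep : ∀ s t : ℝ, (∀ k : ℤ, 1 / 2 ≤ |s - t - k * N|) → ρ ≤ ‖f s - f t‖)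
    (hg : ∀ i : ℤ, ∀ t ∈ Icc (i : ℝ) (i + 1), (∃ t' ∈ Icc (i : ℝ) (i + 1), g t = f t') ∨
      ‖g t - f (i + 1 / 2)‖ ≤ η)
    (same : ∀ i : ℤ, ∀ s ∈ Icc (i : ℝ) (i + 1), ∀ s' ∈ Icc (i : ℝ) (i + 1),
      inner ℝ (e i) (f s) = inner ℝ (e i) (g s') → g s' = f s ∨
        (‖g s' - f (i + 1 / 2)‖ ≤ η ∧ ‖f s - f (i + 1 / 2)‖ ≤ η)) :
    ∀ i j : ℤ, ¬ i ≡ j [ZMOD N] → ∀ s ∈ Icc (i : ℝ) (i + 1), ∀ s' ∈ Icc (i : ℝ) (i + 1),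
      inner ℝ (e i) (f s) = inner ℝ (e i) (g s') → ∀ t ∈ Icc (j : ℝ) (j + 1), ∀ y,
      y = f t ∨ y = g t → inner ℝ (e i) y ≤ inner ℝ (e i) (f i) ∨
        inner ℝ (e i) (f (i + 1)) ≤ inner ℝ (e i) y ∨ ‖g s' - f s‖ ≤ c * ‖y - f s‖ := by
  intro i j hij s hs s' hs' hh t ht y hy
  refine Or.inr (Or.inr ?_)
  have hcρ : c * ρ ≤ ρ := mul_le_of_le_one_left hρ.le hc1
  rcases same i s hs s' hs' hh with h1 | ⟨h1, h2⟩
  · rw [h1, sub_self, norm_zero]; positivity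
  have h3 : ∃ t' ∈ Icc (j : ℝ) (j + 1), ‖y - f t'‖ ≤ η := by
    rcases hy with rfl | rfl
    · exact ⟨t, ht, by simpa using hη0⟩
    · rcases hg j t ht with ⟨t', ht', h4⟩ | h4
      · exact ⟨t', ht', by rw [h4]; simpa using hη0⟩
      · exact ⟨j + 1 / 2, ⟨by linarith, by linarith⟩, h4⟩
  obtain ⟨t', ht', h4⟩ := h3
  have h5 := sep t' (i + 1 / 2) (sub_add_mul_mem_of_not_modEq hij ht')
  have h6 : f t' - f (i + 1 / 2) = (y - f s) - (y - f t') + (f s - f (i + 1 / 2)) := by abel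
  have h7 : ρ ≤ ‖y - f s‖ + η + η := by
    rw [h6] at h5
    exact h5.trans ((norm_add_le _ _).trans (add_le_add ((norm_sub_le _ _).trans
      (add_le_add le_rfl h4)) h2))
  have h8 : g s' - f s = (g s' - f (i + 1 / 2)) - (f s - f (i + 1 / 2)) := by abel
  have h9 : ‖g s' - f s‖ ≤ η + η := by
    rw [h8]
    exact (norm_sub_le _ _).trans (add_le_add h1 h2)
  have h10 : c * (ρ / 2) ≤ c * ‖y - f s‖ := mul_le_mul_of_nonneg_left (by linarith) hc0
  linarith

theorem IsSymmetricPolygon.periodic {m : ℕ} {v : ℤ → Fin 3 → ℤ} (h : IsSymmetricPolygon m v)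
    (i : ℤ) : v (i + (3 * m : ℕ)) = v i := by
  rw [show i + ((3 * m : ℕ) : ℤ) = i + m + m + m by push_cast; ring, h.equivariant, h.equivariant,
    h.equivariant, rot_cube]

set_option maxHeartbeats 800000 in
/-- After an isotopy, consecutive edges of a symmetric polygon lie in a common octant. -/
theorem exists_sameOctant_polygon {m : ℕ} {v : ℤ → Fin 3 → ℤ}
    (h : IsSymmetricPolygon m v) :
    ∃ (W : ℤ → Fin 3 → ℤ), IsSymmetricPolygon (9 * m) W ∧
      AmbientIsotopic (range (latticeCurve v)) (range (latticeCurve W)) ∧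
      ∀ x, SameOctant (W x - W (x - 1)) (W (x + 1) - W x) := by
  have hm := h.pos
  set N : ℕ := 3 * m with hN
  have hN0 : 0 < N := by omega
  have hNR : (0 : ℝ) < N := by exact_mod_cast hN0
  let a : ℤ → Fin 3 → ℤ := fun i => v i - v (i - 1)
  have ha : ∀ i, a (i + m) = rot (a i) := by
    intro i
    simp only [a]
    rw [show i + (m : ℤ) - 1 = i - 1 + m by ring, h.equivariant, h.equivariant, rot_sub]
  have ha1 : ∀ i, a (i + 1) = v (i + 1) - v i := fun i => by simp only [a, add_sub_cancel_right]
  have haN : ∀ i, a (i + N) = a i := by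
    intro i
    simp only [a]
    rw [show i + (N : ℤ) - 1 = i - 1 + N by ring, hN, h.periodic, h.periodic]
  have hcomb : ∀ i (p : ℕ × ℕ), p ≠ 0 → comb (a i) (a (i + 1)) p ≠ 0 := fun i p hp => by
    rw [ha1]; exact h.comb_ne_zero i hp
  -- the intermediate directions
  choose w hw0 hw8 hwne hwS using fun i => exists_octant_chain (a i) (a (i + 1))
  let C : ℤ → ℕ → ℕ × ℕ := fun i k => w (i % m) k
  have hCm : ∀ i k, C (i + m) k = C i k := fun i k => by simp only [C, Int.add_emod_right]
  have hCS : ∀ i, ∀ k < 8, SameOctant (comb (a i) (a (i + 1)) (C i k))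
      (comb (a i) (a (i + 1)) (C i (k + 1))) := by
    refine int_induction_mod hm (fun i => ?_) (fun r hr k hk => ?_)
    · simp only [hCm, add_right_comm i (m : ℤ) 1, ha, ← rot_comb, sameOctant_rot]
    · simp only [C, Int.emod_eq_of_lt (Int.natCast_nonneg r) (by exact_mod_cast hr : (r : ℤ) < m)]
      exact hwS r k hk
  have hC0 : ∀ i, C i 0 = (1, 0) := fun i => hw0 _
  have hC8 : ∀ i, C i 8 = (0, 1) := fun i => hw8 _
  let ST : ℤ → ℕ × ℕ := fun i => ∑ k ∈ Finset.Ico 1 8, C i k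
  have hSTm : ∀ i, ST (i + m) = ST i := fun i => by simp only [ST, hCm]
  have hSTN : ∀ i, ST (i + N) = ST i := fun i => by
    rw [show i + (N : ℤ) = i + m + m + m by rw [hN]; push_cast; ring, hSTm, hSTm, hSTm]
  -- the ascending directions
  have hasc : ∀ i, ∃ e : E3, ‖toE3 (a i)‖ ≤ inner ℝ e (toE3 (a i)) ∧
      ‖toE3 (a (i + 1))‖ ≤ inner ℝ e (toE3 (a (i + 1))) := by
    intro i
    have h1 : toE3 (a i) ≠ 0 := by
      rw [← toE3_zero]
      refine toE3_injective.ne ?_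
      have := hcomb i (1, 0) (by simp)
      simpa [comb] using this
    have h2 : toE3 (a (i + 1)) ≠ 0 := by
      rw [← toE3_zero]
      refine toE3_injective.ne ?_
      have := hcomb i (0, 1) (by simp)
      simpa [comb] using this
    exact exists_ascending h1 h2 (not_sameRay_of_comb_ne_zero (hcomb i))
  choose e' he1' he2' using hasc
  let e : ℤ → E3 := fun i => e' (i % N)
  have heN : ∀ i, e (i + N) = e i := fun i => by simp only [e, Int.add_emod_right]
  have he : ∀ i, ‖toE3 (a i)‖ ≤ inner ℝ (e i) (toE3 (a i)) ∧
      ‖toE3 (a (i + 1))‖ ≤ inner ℝ (e i) (toE3 (a (i + 1))) := by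
    refine int_induction_mod hN0 (fun i => ?_) (fun r hr => ?_)
    · rw [heN, haN, show i + (N : ℤ) + 1 = i + 1 + N by ring, haN]
    · simp only [e, Int.emod_eq_of_lt (Int.natCast_nonneg r) (by exact_mod_cast hr : (r : ℤ) < N)]
      exact ⟨he1' r, he2' r⟩
  have hecomb : ∀ i p, ‖toE3 (comb (a i) (a (i + 1)) p)‖ ≤
      inner ℝ (e i) (toE3 (comb (a i) (a (i + 1)) p)) := by
    intro i p
    rw [toE3_comb, inner_add_right, inner_smul_right, inner_smul_right]
    refine (norm_add_le _ _).trans ?_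
    rw [norm_smul, norm_smul, Real.norm_natCast, Real.norm_natCast]
    exact add_le_add (mul_le_mul_of_nonneg_left (he i).1 (Nat.cast_nonneg _))
      (mul_le_mul_of_nonneg_left (he i).2 (Nat.cast_nonneg _))
  -- bounds
  obtain ⟨B, hB0, hB⟩ := exists_bound_of_periodic hN0
    (F := fun i => ((ST i).1 + (ST i).2 : ℝ)) (fun i => by simp only [hSTN])
  obtain ⟨C₁, hC₁0, hC₁⟩ := exists_bound_of_periodic hN0
    (F := fun i => (1 + ‖e i‖) * ((ST i).1 * ‖toE3 (a i)‖ + (ST i).2 * ‖toE3 (a (i + 1))‖))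
    (fun i => by
      simp only [hSTN, heN, haN, show i + (N : ℤ) + 1 = i + 1 + N by ring])
  -- the curve `f`
  let V : ℤ → E3 := fun x => toE3 (halve v x)
  let f : ℝ → E3 := fun t => latticeCurve (halve v) (2 * t - 1)
  have hV0 : ∀ i : ℤ, V (2 * i) = toE3 (v i) + toE3 (v i) := fun i => by
    simp only [V, halve_even, toE3_add]
  have hV1 : ∀ i : ℤ, V (2 * i - 1) = toE3 (v i) + toE3 (v i) - toE3 (a i) := fun i => by
    simp only [V, a]
    rw [show 2 * i - 1 = 2 * (i - 1) + 1 by ring, halve_odd, sub_add_cancel, toE3_add, toE3_sub]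
    abel
  have hV2 : ∀ i : ℤ, V (2 * i + 1) = toE3 (v i) + toE3 (v i) + toE3 (a (i + 1)) := fun i => by
    simp only [V, ha1]
    rw [halve_odd, toE3_add, toE3_sub]
    abel
  have hfc : Continuous f := (pl_continuous V).comp (by fun_prop)
  have hfN : ∀ t, f (t + N) = f t := by
    intro t
    have := latticeCurve_periodic h.halve.equivariant (2 * t - 1)
    simp only [f]
    rw [← this]
    congr 1
    rw [hN]; push_cast; ring
  have hfinj : ∀ s t, f s = f t → ∃ k : ℤ, s - t = k * N := by
    intro s t hst
    obtain ⟨k, hk⟩ := h.halve.inj _ _ hst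
    refine ⟨k, ?_⟩
    rw [hN]; push_cast at hk ⊢; linarith
  have hfmid : ∀ i : ℤ, f (i + 1 / 2) = toE3 (v i) + toE3 (v i) := by
    intro i
    rw [← hV0, ← pl_int V]
    simp only [f, latticeCurve]
    congr 1; push_cast; ring
  have hfm : ∀ i : ℤ, ∀ s t : ℝ, i ≤ s → s ≤ t → t ≤ i + 1 →
      ‖f t - f s‖ ≤ 1 * inner ℝ (e i) (f t - f s) := by
    intro i s t h1 h2 h3
    refine pl_graph (V := V) (A := 2 * i - 1) (B := 2 * i + 1) (fun x hx hx' => ?_) _ _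
      (by push_cast; linarith) (by linarith) (by push_cast; linarith)
    rw [one_mul]
    obtain rfl | rfl : x = 2 * i - 1 ∨ x = 2 * i := by omega
    · rw [sub_add_cancel, hV0, hV1, sub_sub_cancel]; exact (he i).1
    · rw [hV0, hV2, add_sub_cancel_left]; exact (he i).2
  obtain ⟨ρ, hρ, sep⟩ := exists_separation hNR hfc hfN hfinj (μ := 1 / 2) (by norm_num)
  -- constants
  set κ := (lipschitzExtensionConstant E3 : ℝ) with hκ
  have hκ0 : 0 ≤ κ := NNReal.coe_nonneg _
  set c : ℝ := 1 / (2 * (κ + 1)) with hc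
  have hc0 : 0 < c := by positivity
  have hc1 : c < 1 := by
    rw [hc, div_lt_one (by positivity)]; linarith
  have hκc : κ * c < 1 := by
    rw [hc, mul_one_div, div_lt_one (by positivity)]; linarith
  obtain ⟨Q, hQ⟩ := exists_nat_gt (B + 4 * C₁ / (c * ρ))
  have hcρ : 0 < c * ρ := mul_pos hc0 hρ
  have hQB : B < Q := lt_of_le_of_lt (by have : 0 ≤ 4 * C₁ / (c * ρ) := by positivity
                                         linarith) hQ
  have hQ0 : (0 : ℝ) < Q := hB0.trans hQB
  have hη : 4 * (C₁ / Q) ≤ c * ρ := by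
    rw [← mul_div_assoc, div_le_iff₀ hQ0]
    have := (div_le_iff₀ hcρ).1 (by linarith : 4 * C₁ / (c * ρ) ≤ Q)
    linarith
  have hSQ : ∀ i, (ST i).1 < Q ∧ (ST i).2 < Q := by
    intro i
    have h1 := (hB i).trans_lt hQB
    have h2 : (ST i).1 + (ST i).2 < Q := by exact_mod_cast h1
    omega
  -- the new polygon
  let q : ℤ → ℕ → ℕ × ℕ := fun i k =>
    if k = 0 then (Q - (ST i).1, 0) else if k = 8 then (0, Q - (ST i).2) else C i k
  have hq0 : ∀ i, q i 0 = (Q - (ST i).1, 0) := fun i => rfl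
  have hq8 : ∀ i, q i 8 = (0, Q - (ST i).2) := fun i => rfl
  have hqk : ∀ i k, k ≠ 0 → k ≠ 8 → q i k = C i k := fun i k h1 h2 => by simp only [q, h1, h2, if_false]
  have hqm : ∀ i k, q (i + m) k = q i k := fun i k => by simp only [q, hCm, hSTm]
  have hqne : ∀ i k, q i k ≠ 0 := by
    intro i k
    have h1 := hSQ i
    by_cases hk0 : k = 0
    · subst hk0
      rw [hq0]; intro h0
      have := congrArg Prod.fst h0
      simp only [Prod.fst_zero] at this
      omega
    by_cases hk8 : k = 8
    · subst hk8
      rw [hq8]; intro h0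
      have := congrArg Prod.snd h0
      simp only [Prod.snd_zero] at this
      omega
    · rw [hqk i k hk0 hk8]; exact hwne _ _
  have hqsum : ∀ i, ∀ k, 1 ≤ k → k ≤ 8 →
      ∑ l ∈ Finset.range k, q i l = (Q - (ST i).1, 0) + ∑ l ∈ Finset.Ico 1 k, C i l := by
    intro i k h1 h2
    rw [Finset.range_eq_Ico, Finset.sum_eq_sum_Ico_succ_bot (by omega), hq0]
    congr 1
    refine Finset.sum_congr rfl fun l hl => ?_
    rw [Finset.mem_Ico] at hl
    exact hqk i l (by omega) (by omega)
  have hqsum9 : ∀ i, ∑ l ∈ Finset.range 9, q i l = (Q, Q) := by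
    intro i
    have h1 := hSQ i
    rw [Finset.sum_range_succ, hqsum i 8 (by norm_num) le_rfl, hq8]
    change (Q - (ST i).1, 0) + ST i + (0, Q - (ST i).2) = (Q, Q)
    ext
    · simp only [Prod.fst_add]; omega
    · simp only [Prod.snd_add]; omega
  let d : ℤ → ℕ → Fin 3 → ℤ := fun i k => comb (a i) (a (i + 1)) (q i k)
  let u : ℤ → Fin 3 → ℤ := fun i => Q • (v (i - 1) + v i)
  let W := subdivide 9 u d
  have hud : ∀ i, u i + ∑ l ∈ Finset.range 9, d i l = u (i + 1) := by
    intro i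
    have h1 : ∑ l ∈ Finset.range 9, d i l = Q • (a i + a (i + 1)) := by
      rw [smul_add]
      exact (sum_comb _ _ _ _).trans (by rw [hqsum9, comb])
    rw [h1]
    simp only [u, a, ← smul_add]
    congr 1
    rw [add_sub_cancel_right]; abel
  have hWm : ∀ x, W (x + (9 * m : ℕ)) = rot (W x) := by
    refine subdivide_equivariant (by norm_num) (fun i => ?_) (fun i l => ?_)
    · simp only [u]
      rw [show i + (m : ℤ) - 1 = i - 1 + m by ring, h.equivariant, h.equivariant, rot_nsmul,
        rot_add]
    · simp only [d]
      rw [hqm, rot_comb, ← ha, ← ha, add_right_comm]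
  have hstep : ∀ (i : ℤ) (k : ℕ), k < 9 → W (9 * i + k + 1) - W (9 * i + k) = d i k :=
    fun i k hk => subdivide_step (n := 9) (by norm_num) hud i hk
  let g : ℝ → E3 := fun t => (Q : ℝ)⁻¹ • latticeCurve W (9 * t)
  have hgc : Continuous g := by
    have h1 : Continuous (latticeCurve W) := pl_continuous fun x => toE3 (W x)
    fun_prop
  have hgN : ∀ t, g (t + N) = g t := by
    intro t
    have := latticeCurve_periodic hWm (9 * t)
    simp only [g]
    rw [← this]
    congr 2
    rw [hN]; push_cast; ring
  have hstepx : ∀ i x : ℤ, 9 * i ≤ x → x < 9 * i + 9 → ∃ k : ℕ, W (x + 1) - W x = d i k := by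
    intro i x h1 h2
    refine ⟨(x - 9 * i).toNat, ?_⟩
    have := hstep i (x - 9 * i).toNat (by omega)
    rwa [show 9 * i + ((x - 9 * i).toNat : ℤ) = x by omega] at this
  have hgm : ∀ i : ℤ, ∀ s t : ℝ, i ≤ s → s ≤ t → t ≤ i + 1 →
      ‖g t - g s‖ ≤ 1 * inner ℝ (e i) (g t - g s) := by
    intro i s t h1 h2 h3
    have := pl_graph (V := fun x => toE3 (W x)) (e := e i) (L := 1) (A := 9 * i) (B := 9 * i + 9)
      (fun x hx hx' => by
        obtain ⟨k, hk⟩ := hstepx i x hx hx'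
        rw [← toE3_sub, hk, one_mul]; exact hecomb i _) (9 * s) (9 * t)
      (by push_cast; linarith) (by linarith) (by push_cast; linarith)
    simp only [g]
    rw [← smul_sub, norm_smul, inner_smul_right, Real.norm_of_nonneg (by positivity), mul_left_comm]
    exact mul_le_mul_of_nonneg_left this (by positivity)
  have hgm' : ∀ i : ℤ, ∀ s t : ℝ, i ≤ s → s < t → t ≤ i + 1 → g s ≠ g t := by
    intro i s t h1 h2 h3 hst
    have := pl_strict (V := fun x => toE3 (W x)) (e := e i) (A := 9 * i) (B := 9 * i + 9)
      (fun x hx hx' => by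
        obtain ⟨k, hk⟩ := hstepx i x hx hx'
        rw [← toE3_sub, hk]
        refine lt_of_lt_of_le (norm_pos_iff.2 ?_) (hecomb i _)
        rw [← toE3_zero]
        exact toE3_injective.ne (hcomb i _ (hqne i k))) (9 * s) (9 * t)
      (by push_cast; linarith) (by linarith) (by push_cast; linarith)
    have h4 := smul_right_injective E3 (inv_ne_zero hQ0.ne') hst
    exact this.ne (congrArg (fun z => (inner ℝ (e i) z : ℝ)) h4)
  have hW0 : ∀ i : ℤ, toE3 (W (9 * i)) = (Q : ℝ) • V (2 * i - 1) := by
    intro i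
    have := subdivide_of_lt (n := 9) (u := u) (d := d) i (k := 0) (by norm_num)
    simp only [Nat.cast_zero, add_zero, Finset.range_zero, Finset.sum_empty] at this
    change W (9 * i) = u i at this
    rw [this, toE3_nsmul, hV1]
    simp only [a, toE3_sub, toE3_add]
    congr 1; abel
  have hend : ∀ i : ℤ, f i = g i := by
    intro i
    have h1 := pl_int V (2 * i - 1)
    have h2 := pl_int (fun x => toE3 (W x)) (9 * i)
    push_cast at h1 h2
    simp only [f, g, latticeCurve]
    rw [h2, hW0, smul_smul, inv_mul_cancel₀ hQ0.ne', one_smul]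
    exact h1
  have hgcase : ∀ i : ℤ, ∀ t ∈ Icc (i : ℝ) (i + 1), (∃ t' ∈ Icc (i : ℝ) (i + 1), g t = f t') ∨
      ‖g t - f (i + 1 / 2)‖ ≤ ((ST i).1 * ‖toE3 (a i)‖ + (ST i).2 * ‖toE3 (a (i + 1))‖) / Q := by
    intro i t ht
    have hS1 : ((ST i).1 : ℝ) ≤ Q := by exact_mod_cast (hSQ i).1.le
    have hS2 : ((ST i).2 : ℝ) ≤ Q := by exact_mod_cast (hSQ i).2.le
    have e0 : toE3 (W (9 * i + 1)) - toE3 (W (9 * i)) = (Q - (ST i).1 : ℝ) • toE3 (a i) := by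
      have := hstep i 0 (by norm_num)
      simp only [Nat.cast_zero, add_zero] at this
      rw [← toE3_sub, this]
      simp only [d, hq0, toE3_comb, Nat.cast_zero, zero_smul, add_zero,
        Nat.cast_sub (hSQ i).1.le]
    have e8 : toE3 (W (9 * i + 8 + 1)) - toE3 (W (9 * i + 8)) =
        (Q - (ST i).2 : ℝ) • toE3 (a (i + 1)) := by
      have := hstep i 8 (by norm_num)
      push_cast at this
      rw [← toE3_sub, this]
      simp only [d, hq8, toE3_comb, Nat.cast_zero, zero_smul, zero_add,
        Nat.cast_sub (hSQ i).2.le]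
    have e9 : toE3 (W (9 * i + 8 + 1)) = (Q : ℝ) • V (2 * i + 1) := by
      rw [show 9 * i + 8 + 1 = 9 * (i + 1) by ring, hW0, show 2 * (i + 1) - 1 = 2 * i + 1 by ring]
    rcases le_total (9 * t) (9 * (i : ℝ) + 1) with h1 | h1
    · left
      set θ : ℝ := (9 * t - 9 * i) * ((Q - (ST i).1) / Q) with hθ
      have hr0 : 0 ≤ (Q - (ST i).1 : ℝ) / Q := div_nonneg (by linarith) hQ0.le
      have hr1 : (Q - (ST i).1 : ℝ) / Q ≤ 1 := by
        rw [div_le_one hQ0]; linarith [Nat.cast_nonneg (α := ℝ) (ST i).1]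
      have hθ0 : 0 ≤ θ := mul_nonneg (by linarith [ht.1]) hr0
      have hθ1 : θ ≤ 1 := mul_le_one₀ (by linarith) hr0 hr1
      refine ⟨i + θ / 2, ⟨by linarith, by linarith⟩, ?_⟩
      simp only [f, g, latticeCurve]
      rw [pl_eq (fun x => toE3 (W x)) (i := 9 * i) (by push_cast; linarith [ht.1])
          (by push_cast; linarith),
        pl_eq (fun x => toE3 (halve v x)) (i := 2 * i - 1) (by push_cast; linarith)
          (by push_cast; linarith), e0, hW0]
      change _ = V (2 * i - 1) + _ • (V (2 * i - 1 + 1) - V (2 * i - 1))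
      rw [sub_add_cancel, hV0, hV1, sub_sub_cancel, smul_add, smul_smul, smul_smul, smul_smul,
        inv_mul_cancel₀ hQ0.ne', one_smul]
      congr 2
      rw [hθ]; push_cast; field_simp; ring
    rcases le_total (9 * (i : ℝ) + 8) (9 * t) with h2 | h2
    · left
      set θ : ℝ := (9 * i + 9 - 9 * t) * ((Q - (ST i).2) / Q) with hθ
      have hr0 : 0 ≤ (Q - (ST i).2 : ℝ) / Q := div_nonneg (by linarith) hQ0.le
      have hr1 : (Q - (ST i).2 : ℝ) / Q ≤ 1 := by
        rw [div_le_one hQ0]; linarith [Nat.cast_nonneg (α := ℝ) (ST i).2]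
      have hθ0 : 0 ≤ θ := mul_nonneg (by linarith [ht.2]) hr0
      have hθ1 : θ ≤ 1 := mul_le_one₀ (by linarith) hr0 hr1
      refine ⟨i + 1 - θ / 2, ⟨by linarith, by linarith⟩, ?_⟩
      simp only [f, g, latticeCurve]
      rw [pl_eq (fun x => toE3 (W x)) (i := 9 * i + 8) (by push_cast; linarith)
          (by push_cast; linarith [ht.2]),
        pl_eq (fun x => toE3 (halve v x)) (i := 2 * i) (by push_cast; linarith)
          (by push_cast; linarith)]
      change _ = V (2 * i) + _ • (V (2 * i + 1) - V (2 * i))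
      have e8' : toE3 (W (9 * i + 8)) = (Q : ℝ) • V (2 * i + 1) -
          (Q - (ST i).2 : ℝ) • toE3 (a (i + 1)) := by
        rw [← e9, ← e8]; abel
      have e10 : V (2 * i + 1) = V (2 * i) + toE3 (a (i + 1)) := by rw [hV0, hV2]
      rw [e8, e8', e10, hθ]
      push_cast
      match_scalars
      · field_simp; ring
      · field_simp; ring
    · right
      rw [hfmid]
      have hconv := convex_closedBall ((Q : ℝ) • (toE3 (v i) + toE3 (v i)))
        ((ST i).1 * ‖toE3 (a i)‖ + (ST i).2 * ‖toE3 (a (i + 1))‖)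
      have := pl_mem_of_convex (V := fun x => toE3 (W x)) hconv (A := 9 * i + 1) (B := 9 * i + 8)
        (fun x hx hx' => ?_) (t := 9 * t) (by push_cast; linarith) (by push_cast; linarith)
      · rw [mem_closedBall_iff_norm] at this
        have e1 : g t - (toE3 (v i) + toE3 (v i)) = (Q : ℝ)⁻¹ •
            (pl (fun x => toE3 (W x)) (9 * t) - (Q : ℝ) • (toE3 (v i) + toE3 (v i))) := by
          rw [smul_sub, smul_smul, inv_mul_cancel₀ hQ0.ne', one_smul]; rfl
        rw [e1, norm_smul, Real.norm_of_nonneg (by positivity), div_eq_inv_mul]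
        exact mul_le_mul_of_nonneg_left this (by positivity)
      · obtain ⟨k, rfl⟩ : ∃ k : ℕ, x = 9 * i + k := ⟨(x - 9 * i).toNat, by omega⟩
        have hk1 : 1 ≤ k := by omega
        have hk8 : k ≤ 8 := by omega
        rw [mem_closedBall_iff_norm]
        have e1 : W (9 * i + k) = u i + ∑ l ∈ Finset.range k, d i l :=
          subdivide_of_lt (n := 9) i (by omega)
        have e2 : ∑ l ∈ Finset.range k, d i l = comb (a i) (a (i + 1))
            ((Q - (ST i).1, 0) + ∑ l ∈ Finset.Ico 1 k, C i l) := by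
          simp only [d, sum_comb, hqsum i k hk1 hk8]
        set y := ∑ l ∈ Finset.Ico 1 k, C i l with hy
        have hyle : y ≤ ST i := Finset.sum_le_sum_of_subset (Finset.Ico_subset_Ico_right hk8)
        have e3 : toE3 (u i) = (Q : ℝ) • (toE3 (v i) + toE3 (v i)) - (Q : ℝ) • toE3 (a i) := by
          simp only [u, a, toE3_nsmul, toE3_add, toE3_sub, smul_add, smul_sub]
          abel
        have e4 : toE3 (W (9 * i + k)) - (Q : ℝ) • (toE3 (v i) + toE3 (v i)) =
            (y.2 : ℝ) • toE3 (a (i + 1)) - ((ST i).1 - y.1 : ℝ) • toE3 (a i) := by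
          rw [e1, e2, toE3_add, e3, toE3_comb]
          simp only [Prod.fst_add, Prod.snd_add, Nat.cast_add, Nat.cast_sub (hSQ i).1.le,
            Nat.cast_zero]
          module
        have hy1 : (y.1 : ℝ) ≤ (ST i).1 := by exact_mod_cast hyle.1
        have hy2 : (y.2 : ℝ) ≤ (ST i).2 := by exact_mod_cast hyle.2
        have hy0 : (0 : ℝ) ≤ y.1 := Nat.cast_nonneg _
        rw [e4, add_comm (((ST i).1 : ℝ) * _)]
        refine (norm_sub_le _ _).trans ?_
        rw [norm_smul, norm_smul, Real.norm_of_nonneg (Nat.cast_nonneg _),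
          Real.norm_of_nonneg (by linarith)]
        exact add_le_add (mul_le_mul_of_nonneg_right hy2 (norm_nonneg _))
          (mul_le_mul_of_nonneg_right (by linarith) (norm_nonneg _))
  have hbound : ∀ i, ((ST i).1 * ‖toE3 (a i)‖ + (ST i).2 * ‖toE3 (a (i + 1))‖) / Q * (1 + ‖e i‖)
      ≤ C₁ / Q := by
    intro i
    rw [div_mul_eq_mul_div, mul_comm]
    exact div_le_div_of_nonneg_right (hC₁ i) hQ0.le
  have hη1 : ∀ i, ((ST i).1 * ‖toE3 (a i)‖ + (ST i).2 * ‖toE3 (a (i + 1))‖) / Q ≤ C₁ / Q := by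
    intro i
    refine le_trans (le_mul_of_one_le_right (by positivity) ?_) (hbound i)
    linarith [norm_nonneg (e i)]
  have hcmp : ∀ i : ℤ, ∀ s ∈ Icc (i : ℝ) (i + 1), ∀ s' ∈ Icc (i : ℝ) (i + 1),
      ‖f s - f s'‖ ≤ |(inner ℝ (e i) (f s - f s') : ℝ)| := by
    intro i s hs s' hs'
    rcases le_total s s' with h1 | h1
    · have := hfm i s s' hs.1 h1 hs'.2
      rw [one_mul] at this
      rw [show f s - f s' = -(f s' - f s) by abel, norm_neg, inner_neg_right, abs_neg]
      exact this.trans (le_abs_self _)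
    · have := hfm i s' s hs'.1 h1 hs.2
      rw [one_mul] at this
      exact this.trans (le_abs_self _)
  have far := graphs_far (e := e) hc0.le hc1.le hη (by positivity) hρ sep
    (fun i t ht => (hgcase i t ht).imp_right fun h1 => h1.trans (hη1 i))
    (fun i s hs s' hs' hss => by
      rcases hgcase i s' hs' with ⟨s'', hs'', h1⟩ | h1
      · left
        rw [h1] at hss ⊢
        have := hcmp i s'' hs'' s hs
        rw [inner_sub_right, hss, sub_self, abs_zero] at this
        exact sub_eq_zero.1 (norm_le_zero_iff.1 this)
      · refine Or.inr ⟨h1.trans (hη1 i), ?_⟩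
        refine (hcmp i s hs (i + 1 / 2) ⟨by linarith, by linarith⟩).trans ?_
        rw [inner_sub_right, hss, ← inner_sub_right]
        refine (abs_real_inner_le_norm _ _).trans ?_
        rw [mul_comm]
        refine le_trans ?_ (hbound i)
        exact mul_le_mul h1 (by linarith) (norm_nonneg _) (by positivity))
  refine ⟨W, ⟨by omega, hWm, fun s t hst => ?_⟩, ?_, fun x => ?_⟩
  · have := injective_of_graphs hfc hgN zero_le_one hc1 hgm hgm' hend hfinj far (s / 9) (t / 9) (by
      simp only [g, mul_div_cancel₀ _ (by norm_num : (9 : ℝ) ≠ 0), hst])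
    obtain ⟨k, hk⟩ := this
    refine ⟨k, ?_⟩
    rw [hN] at hk
    push_cast at hk ⊢
    linarith
  · have h1 := ambientIsotopic_range_of_graphs hN0 hfc hgc hfN hgN zero_le_one hc0.le hκc hfm hgm
      hend far
    have h2 : range f = (fun x => (2 : ℝ) • x) '' range (latticeCurve v) := by
      rw [← range_latticeCurve_halve]
      apply Subset.antisymm
      · rintro _ ⟨t, rfl⟩; exact ⟨_, rfl⟩
      · rintro _ ⟨t, rfl⟩
        exact ⟨(t + 1) / 2, by simp only [f]; congr 1; ring⟩
    have h3 : (fun x => (Q : ℝ) • x) '' range g = range (latticeCurve W) := by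
      rw [← range_comp]
      apply Subset.antisymm
      · rintro _ ⟨t, rfl⟩
        exact ⟨9 * t, by simp only [g, Function.comp_apply, smul_smul, mul_inv_cancel₀ hQ0.ne', one_smul]⟩
      · rintro _ ⟨t, rfl⟩
        refine ⟨t / 9, ?_⟩
        simp only [g, Function.comp_apply, smul_smul, mul_inv_cancel₀ hQ0.ne', one_smul]
        congr 1; ring
    have h4 := ambientIsotopic_smul hQ0 (range g)
    rw [h3] at h4
    have h5 := ambientIsotopic_smul two_pos (range (latticeCurve v))
    rw [← h2] at h5
    exact (h5.trans h1).trans h4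
  · obtain ⟨i, k, hk, rfl⟩ := exists_eq_mul_add (n := 9) (by norm_num) x
    push_cast
    rw [hstep i k hk]
    rcases Nat.eq_zero_or_pos k with rfl | hk0
    · have := hstep (i - 1) 8 (by norm_num)
      push_cast at this
      rw [show 9 * (i - 1) + 8 + 1 = 9 * i by ring, show 9 * (i - 1) + 8 = 9 * i - 1 by ring] at this
      simp only [Nat.cast_zero, add_zero]
      rw [this]
      simp only [d, hq8, hq0, comb, zero_smul, zero_add, add_zero, sub_add_cancel]
      exact ((SameOctant.refl _).nsmul_left _).nsmul_right _
    · have := hstep i (k - 1) (by omega)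
      rw [show 9 * i + ((k - 1 : ℕ) : ℤ) = 9 * i + k - 1 by omega, sub_add_cancel] at this
      rw [this]
      have key : ∀ k, ∃ n : ℕ, d i k = n • comb (a i) (a (i + 1)) (C i k) := by
        intro k
        simp only [d]
        by_cases hk0 : k = 0
        · subst hk0
          exact ⟨Q - (ST i).1, by simp only [hq0, hC0, comb, zero_smul, one_smul, add_zero]⟩
        by_cases hk8 : k = 8
        · subst hk8
          exact ⟨Q - (ST i).2, by simp only [hq8, hC8, comb, zero_smul, one_smul, zero_add]⟩
        · exact ⟨1, by rw [hqk i k hk0 hk8, one_smul]⟩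
      obtain ⟨n₁, h1⟩ := key (k - 1)
      obtain ⟨n₂, h2⟩ := key k
      have h3 := hCS i (k - 1) (by omega)
      rw [Nat.sub_add_cancel hk0] at h3
      rw [h1, h2]
      exact (h3.nsmul_left _).nsmul_right _

/-! ### Octants and directions -/

theorem inner_toE3 (x y : Fin 3 → ℤ) :
    (inner ℝ (toE3 x) (toE3 y) : ℝ) = ((∑ l, x l * y l : ℤ) : ℝ) := by
  simp [toE3, PiLp.inner_apply, mul_comm]

theorem norm_toE3_le_inner {ε y : Fin 3 → ℤ} (hε : ∀ l, ε l = 1 ∨ ε l = -1)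
    (h : SameOctant ε y) : ‖toE3 y‖ ≤ inner ℝ (toE3 ε) (toE3 y) := by
  rw [inner_toE3, Fin.sum_univ_three]
  have hsq : ∀ l, (y l) ^ 2 = (ε l * y l) ^ 2 := by
    intro l; rcases hε l with h1 | h1 <;> rw [h1] <;> ring
  refine le_of_sq_le_sq ?_ ?_
  · rw [EuclideanSpace.norm_sq_eq, Fin.sum_univ_three]
    simp only [toE3_apply, Real.norm_eq_abs, sq_abs]
    have h0 := h 0
    have h1 := h 1
    have h2 := h 2
    have : y 0 ^ 2 + y 1 ^ 2 + y 2 ^ 2 ≤ (ε 0 * y 0 + ε 1 * y 1 + ε 2 * y 2) ^ 2 := by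
      rw [hsq 0, hsq 1, hsq 2]
      nlinarith [mul_nonneg h0 h1, mul_nonneg h0 h2, mul_nonneg h1 h2]
    exact_mod_cast this
  · exact_mod_cast add_nonneg (add_nonneg (h 0) (h 1)) (h 2)

theorem norm_toE3_octant {ε : Fin 3 → ℤ} (hε : ∀ l, ε l = 1 ∨ ε l = -1) : ‖toE3 ε‖ ≤ 2 := by
  refine (norm_le_of_coord zero_le_one fun l => ?_).trans (by norm_num)
  rw [toE3_apply]
  rcases hε l with h | h <;> rw [h] <;> simp

theorem exists_common_octant {a b c : Fin 3 → ℤ} (hab : SameOctant a b) (hac : SameOctant a c)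
    (hbc : SameOctant b c) : ∃ ε : Fin 3 → ℤ, (∀ l, ε l = 1 ∨ ε l = -1) ∧ SameOctant ε a ∧
      SameOctant ε b ∧ SameOctant ε c := by
  have key : ∀ l, ∃ s : ℤ, (s = 1 ∨ s = -1) ∧ 0 ≤ s * a l ∧ 0 ≤ s * b l ∧ 0 ≤ s * c l := by
    intro l
    have aux : ∀ x y : ℤ, 0 ≤ x * y → x < 0 → y ≤ 0 := fun x y h hx => by
      by_contra hy
      push Not at hy
      exact absurd (mul_neg_of_neg_of_pos hx hy) (not_lt.2 h)
    have h1 := hab l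
    have h2 := hac l
    have h3 := hbc l
    by_cases ha : a l < 0
    · have := aux _ _ h1 ha
      have := aux _ _ h2 ha
      exact ⟨-1, Or.inr rfl, by omega, by omega, by omega⟩
    by_cases hb : b l < 0
    · have := aux _ _ (by rw [mul_comm]; exact h1) hb
      have := aux _ _ h3 hb
      exact ⟨-1, Or.inr rfl, by omega, by omega, by omega⟩
    by_cases hc : c l < 0
    · have := aux _ _ (by rw [mul_comm]; exact h2) hc
      have := aux _ _ (by rw [mul_comm]; exact h3) hc
      exact ⟨-1, Or.inr rfl, by omega, by omega, by omega⟩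
    · exact ⟨1, Or.inl rfl, by omega, by omega, by omega⟩
  choose ε h0 h1 h2 h3 using key
  exact ⟨ε, h0, h1, h2, h3⟩

/-- The nonzero vector `y` makes progress along `D` in each of its coordinates. -/
def Fits (y D : Fin 3 → ℤ) : Prop := y ≠ 0 ∧ ∀ l, y l ≠ 0 → 0 < y l * D l

theorem fits_rot {y D : Fin 3 → ℤ} : Fits (rot y) (rot D) ↔ Fits y D := by
  have h0 : rot y ≠ 0 ↔ y ≠ 0 := by
    rw [Ne, Ne, ← Equiv.eq_symm_apply]
    have : rot.symm 0 = 0 := by ext l; fin_cases l <;> rfl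
    rw [this]
  rw [Fits, Fits, h0]
  refine and_congr_right fun _ => ⟨fun h l => ?_, fun h l => ?_⟩
  · fin_cases l
    · exact h 1
    · exact h 2
    · exact h 0
  · fin_cases l
    · exact h 2
    · exact h 0
    · exact h 1

theorem Fits.sameOctant {y D ε : Fin 3 → ℤ} (h : Fits y D) (hε : SameOctant ε D) :
    SameOctant ε y := by
  intro l
  by_cases h0 : y l = 0
  · simp [h0]
  have h1 := h.2 l h0
  have h2 := hε l
  by_contra h3
  push Not at h3
  have h4 : 0 < D l * D l := by
    refine mul_self_pos.2 ?_
    rintro h5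
    simp [h5] at h1
  have h5 := mul_neg_of_neg_of_pos h3 h4
  have h6 := mul_nonneg h2 h1.le
  have : ε l * D l * (y l * D l) = ε l * y l * (D l * D l) := by ring
  linarith

/-- A word which leads from the origin to `D`, without detours. -/
def straightWord (D : Fin 3 → ℤ) : List Direction :=
  List.replicate (D 0).toNat .F ++ List.replicate (-D 0).toNat .B ++
    (List.replicate (D 1).toNat .R ++ List.replicate (-D 1).toNat .L) ++
    (List.replicate (D 2).toNat .U ++ List.replicate (-D 2).toNat .D)

/-- The vector along which a word leads. -/
def wordVec (w : List Direction) : Fin 3 → ℤ := (w.map Direction.vec).sum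

theorem wordVec_append (w w' : List Direction) : wordVec (w ++ w') = wordVec w + wordVec w' := by
  simp [wordVec]

theorem wordVec_nil : wordVec [] = 0 := rfl

theorem wordVec_straightWord (D : Fin 3 → ℤ) : wordVec (straightWord D) = D := by
  simp only [wordVec, straightWord, List.map_append, List.map_replicate, List.sum_append,
    List.sum_replicate]
  ext l
  fin_cases l <;> simp [Direction.vec] <;> omega

theorem fits_of_mem_straightWord {D : Fin 3 → ℤ} {s : Direction} (h : s ∈ straightWord D) :
    Fits s.vec D := by
  simp only [straightWord, List.mem_append, List.mem_replicate] at h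
  refine ⟨?_, fun l => ?_⟩
  · intro h0
    have e0 := congrFun h0 0
    have e1 := congrFun h0 1
    have e2 := congrFun h0 2
    cases s <;> simp [Direction.vec] at e0 e1 e2
  · cases s <;> fin_cases l <;> simp [Direction.vec] at h ⊢ <;> omega

theorem length_straightWord_pos {D : Fin 3 → ℤ} (h : D ≠ 0) : 0 < (straightWord D).length := by
  rcases Nat.eq_zero_or_pos (straightWord D).length with h0 | h0
  · rw [List.length_eq_zero_iff] at h0
    have := wordVec_straightWord D
    rw [h0, wordVec_nil] at this
    exact (h this.symm).elim
  · exact h0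

theorem norm_toE3_vec (s : Direction) : ‖toE3 s.vec‖ = 1 := by
  rw [EuclideanSpace.norm_eq, Fin.sum_univ_three]
  cases s <;> simp [toE3, Direction.vec]

theorem norm_toE3_wordVec (w : List Direction) : ‖toE3 (wordVec w)‖ ≤ w.length := by
  induction w with
  | nil => simp [wordVec_nil, toE3_zero]
  | cons s w ih =>
    have : wordVec (s :: w) = s.vec + wordVec w := by simp [wordVec]
    rw [this, toE3_add, List.length_cons]
    refine (norm_add_le _ _).trans ?_
    rw [norm_toE3_vec]
    push_cast; linarith

/-- The word `w`, repeated `M` times. -/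
def repeatWord (M : ℕ) (w : List Direction) : List Direction := (List.replicate M w).flatten

theorem length_repeatWord (M : ℕ) (w : List Direction) :
    (repeatWord M w).length = M * w.length := by
  simp [repeatWord]

theorem mem_of_mem_repeatWord {M : ℕ} {w : List Direction} {s : Direction}
    (h : s ∈ repeatWord M w) : s ∈ w := by
  simp only [repeatWord, List.mem_flatten, List.mem_replicate] at h
  obtain ⟨_, ⟨_, rfl⟩, h⟩ := h
  exact h

theorem wordVec_repeatWord (M : ℕ) (w : List Direction) :
    wordVec (repeatWord M w) = M • wordVec w := by
  induction M with
  | zero => simp [repeatWord, wordVec_nil]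
  | succ M ih =>
    have : repeatWord (M + 1) w = w ++ repeatWord M w := by
      simp [repeatWord, List.replicate_succ]
    rw [this, wordVec_append, ih, succ_nsmul']

theorem exists_wordVec_take_repeatWord (M : ℕ) (w : List Direction) (k : ℕ) :
    ∃ a b : ℕ, a ≤ M ∧
      wordVec ((repeatWord M w).take k) = a • wordVec w + wordVec (w.take b) := by
  induction M generalizing k with
  | zero => exact ⟨0, 0, le_rfl, by simp [repeatWord, wordVec_nil]⟩
  | succ M ih =>
    have : repeatWord (M + 1) w = w ++ repeatWord M w := by
      simp [repeatWord, List.replicate_succ]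
    rw [this, List.take_append]
    rcases le_total k w.length with h | h
    · refine ⟨0, k, Nat.zero_le _, ?_⟩
      rw [Nat.sub_eq_zero_of_le h]; simp
    · obtain ⟨a, b, h1, h2⟩ := ih (k - w.length)
      refine ⟨a + 1, b, by omega, ?_⟩
      rw [wordVec_append, h2, List.take_of_length_le h, succ_nsmul']
      abel

theorem wordVec_take_succ (w : List Direction) (k : ℕ) (hk : k < w.length) :
    wordVec (w.take (k + 1)) = wordVec (w.take k) + (w[k]).vec := by
  rw [List.take_succ_eq_append_getElem hk, wordVec_append]
  simp [wordVec]

/-! ### Staircases -/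

/-- A symmetric polygon is followed by a lattice path all of whose steps go along the edges: the
edge from `v i` to `v (i + 1)`, magnified by the factor `M`, is replaced by the path through the
vertices of `X` between the times `T i` and `T (i + 1)`. -/
structure IsStaircase (m : ℕ) (v : ℤ → Fin 3 → ℤ) (C : ℝ) (M : ℕ) (G : List Direction)
    (X : ℤ → Fin 3 → ℤ) (T : ℤ → ℤ) : Prop where
  pos : 0 < G.length
  equivariant : ∀ x, X (x + G.length) = rot (X x)
  word : ∀ k ≤ G.length, X k = X 0 + wordVec (G.take k)
  lt : ∀ i, T i < T (i + 1)
  shift : ∀ i, T (i + m) = T i + G.length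
  vertex : ∀ i, X (T i) = M • v i
  fits : ∀ i x, T i ≤ x → x < T (i + 1) → Fits (X (x + 1) - X x) (v (i + 1) - v i)
  norm_step : ∀ x, ‖toE3 (X (x + 1)) - toE3 (X x)‖ ≤ 1
  close : ∀ i x, T i ≤ x → x < T (i + 1) →
    ∃ a ∈ Icc (0 : ℝ) 1, ‖toE3 (X x) - (M : ℝ) • latticeCurve v (i + a)‖ ≤ C

theorem exists_isStaircase {m : ℕ} (hm : 0 < m) {v : ℤ → Fin 3 → ℤ}
    (hv : ∀ i, v (i + m) = rot (v i)) (hD : ∀ i, v (i + 1) - v i ≠ 0) :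
    ∃ C : ℝ, ∀ M : ℕ, 0 < M → ∃ G X T, IsStaircase m v C M G X T := by
  let w : ℕ → List Direction := fun j => straightWord (v (j + 1) - v j)
  have hwpos : ∀ j, 0 < (w j).length := fun j => length_straightWord_pos (hD j)
  have hwvec : ∀ j : ℕ, wordVec (w j) = v (j + 1) - v j := fun j => wordVec_straightWord _
  refine ⟨∑ j ∈ Finset.range m, ((w j).length : ℝ), fun M hM => ?_⟩
  have hmz : (m : ℤ) ≠ 0 := by exact_mod_cast hm.ne'
  let blk : ℕ → List Direction := fun j => repeatWord M (w j)
  have hblk : ∀ j, 0 < (blk j).length := fun j => by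
    simp only [blk, length_repeatWord]; exact Nat.mul_pos hM (hwpos j)
  let H : ℕ → List Direction := fun i => (List.range i).flatMap blk
  have hHs : ∀ i, H (i + 1) = H i ++ blk i := fun i => by
    simp only [H, List.range_succ, List.flatMap_append, List.flatMap_singleton]
  have hHpre : ∀ i n, ∃ R, H (i + n) = H i ++ R := by
    intro i n
    induction n with
    | zero => exact ⟨[], by simp⟩
    | succ n ih =>
      obtain ⟨R, hR⟩ := ih
      exact ⟨R ++ blk (i + n), by rw [← add_assoc, hHs, hR, List.append_assoc]⟩
  have hHvec : ∀ i : ℕ, wordVec (H i) = M • v i - M • v 0 := by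
    intro i
    induction i with
    | zero => simp [H, wordVec_nil]
    | succ i ih =>
      rw [hHs, wordVec_append, ih]
      simp only [blk]
      rw [wordVec_repeatWord, hwvec, nsmul_sub]
      push_cast; abel
  set G := H m with hG
  have hGpos : 0 < G.length := by
    obtain ⟨n, rfl⟩ : ∃ n, m = n + 1 := ⟨m - 1, by omega⟩
    rw [hG, hHs, List.length_append]
    have := hblk n
    omega
  let X : ℤ → Fin 3 → ℤ := equivariantExt G.length fun k => M • v 0 + wordVec (G.take k)
  have hX : ∀ x, X (x + G.length) = rot (X x) := equivariantExt_add hGpos _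
  have hXk : ∀ k ≤ G.length, X k = M • v 0 + wordVec (G.take k) := by
    intro k hk
    rcases hk.lt_or_eq with h1 | h1
    · exact equivariantExt_of_lt _ h1
    · have h2 := hX 0
      rw [zero_add] at h2
      have h3 : X 0 = M • v 0 + wordVec (G.take 0) := equivariantExt_of_lt _ hGpos
      rw [h1, h2, h3, List.take_length, hG, hHvec, List.take_zero, wordVec_nil, add_zero]
      have h4 := hv 0
      rw [zero_add] at h4
      rw [h4, rot_nsmul]; abel
  have hX0 : X 0 = M • v 0 := by
    have := hXk 0 (Nat.zero_le _)
    simpa [wordVec_nil] using this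
  let T : ℤ → ℤ := subdivide m (fun q => G.length * q) fun _ j => ((blk j).length : ℤ)
  have hlen : ∀ i, ∑ j ∈ Finset.range i, ((blk j).length : ℤ) = (H i).length := by
    intro i
    induction i with
    | zero => simp [H]
    | succ i ih => rw [Finset.sum_range_succ, ih, hHs, List.length_append]; push_cast; rfl
  have hsum : ∀ q : ℤ, (G.length * q : ℤ) + ∑ j ∈ Finset.range m, ((blk j).length : ℤ) =
      G.length * (q + 1) := fun q => by rw [hlen]; ring
  have hTshift : ∀ i, T (i + m) = T i + G.length := by
    intro i
    simp only [T, subdivide, Int.add_emod_right, Int.add_ediv_of_dvd_right (dvd_refl (m : ℤ)),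
      Int.ediv_self hmz]
    ring
  have hTr : ∀ r ≤ m, T r = (H r).length := by
    intro r hr
    have := subdivide_of_le (u := fun q : ℤ => (G.length * q : ℤ))
      (d := fun _ j => ((blk j).length : ℤ)) hm hsum 0 hr
    simp only [mul_zero, zero_add] at this
    rw [← hlen]; exact this
  have hTs : ∀ r : ℕ, r < m → T (r + 1) = (H r).length + (blk r).length := by
    intro r hr
    have := hTr (r + 1) hr
    rw [hHs, List.length_append] at this
    push_cast at this
    exact this
  -- the steps over a period
  have hXblk : ∀ r < m, ∀ k ≤ (blk r).length,
      X ((H r).length + k) = M • v r + wordVec ((blk r).take k) := by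
    intro r hr k hk
    obtain ⟨R, hR⟩ := hHpre (r + 1) (m - (r + 1))
    rw [Nat.add_sub_cancel' (by omega : r + 1 ≤ m), hHs, List.append_assoc] at hR
    have hle : (H r).length + k ≤ G.length := by
      rw [hG, hR]; simp only [List.length_append]; omega
    have := hXk _ hle
    push_cast at this
    rw [this, hG, hR, List.take_length_add_append, List.take_append_of_le_length hk, wordVec_append,
      hHvec]
    abel
  have hrange : ∀ r < m, ∀ x : ℤ, T r ≤ x → x < T (r + 1) →
      ∃ k, k < (blk r).length ∧ x = (H r).length + k := by
    intro r hr x h1 h2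
    rw [hTr r hr.le] at h1
    rw [hTs r hr] at h2
    exact ⟨(x - (H r).length).toNat, by omega, by omega⟩
  have hTshift' : ∀ i : ℤ, T (i + m + 1) = T (i + 1) + G.length := fun i => by
    rw [add_right_comm, hTshift]
  have hv' : ∀ i : ℤ, v (i + m + 1) = rot (v (i + 1)) := fun i => by rw [add_right_comm, hv]
  have hX' : ∀ x : ℤ, X (x + G.length + 1) = rot (X (x + 1)) := fun i => by
    rw [add_right_comm, hX]
  have hstep : ∀ r < m, ∀ k (hk : k < (blk r).length),
      X ((H r).length + k + 1) - X ((H r).length + k) = ((blk r)[k]).vec := by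
    intro r hr k hk
    have h1 := hXblk r hr (k + 1) hk
    push_cast at h1
    rw [add_assoc, h1, hXblk r hr k hk.le, wordVec_take_succ _ _ hk]
    abel
  have hTlt : ∀ i, T i < T (i + 1) := by
    refine int_induction_mod hm (fun i => ?_) (fun r hr => ?_)
    · rw [hTshift, hTshift']; omega
    · rw [hTr r hr.le, hTs r hr]
      have := hblk r
      omega
  refine ⟨G, X, T, hGpos, hX, fun k hk => by rw [hXk k hk, hX0], hTlt, hTshift, ?_, ?_, ?_, ?_⟩
  · refine int_induction_mod hm (fun i => ?_) (fun r hr => ?_)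
    · rw [hTshift, hX, hv, ← rot_nsmul, rot.apply_eq_iff_eq]
    · have := hXblk r hr 0 (Nat.zero_le _)
      rw [hTr r hr.le]
      simpa [wordVec_nil] using this
  · refine int_induction_mod hm (fun i => ⟨fun h x h1 h2 => ?_, fun h x h1 h2 => ?_⟩)
      (fun r hr x h1 h2 => ?_)
    · rw [hTshift] at h1
      rw [hTshift'] at h2
      have := h (x - G.length) (by omega) (by omega)
      have e1 := hX (x - G.length)
      have e2 := hX' (x - G.length)
      rw [sub_add_cancel] at e1 e2
      rwa [e1, e2, hv', hv, ← rot_sub, ← rot_sub, fits_rot]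
    · have := h (x + G.length) (by rw [hTshift]; omega) (by rw [hTshift']; omega)
      rwa [hX', hX, hv', hv, ← rot_sub, ← rot_sub, fits_rot] at this
    · obtain ⟨k, hk, rfl⟩ := hrange r hr x h1 h2
      rw [hstep r hr k hk]
      exact fits_of_mem_straightWord (mem_of_mem_repeatWord (List.getElem_mem hk))
  · have hnorm : ∀ i x : ℤ, T i ≤ x → x < T (i + 1) → ‖toE3 (X (x + 1)) - toE3 (X x)‖ ≤ 1 := by
      refine int_induction_mod hm (fun i => ⟨fun h x h1 h2 => ?_, fun h x h1 h2 => ?_⟩)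
        (fun r hr x h1 h2 => ?_)
      · rw [hTshift] at h1
        rw [hTshift'] at h2
        have := h (x - G.length) (by omega) (by omega)
        have e1 := hX (x - G.length)
        have e2 := hX' (x - G.length)
        rw [sub_add_cancel] at e1 e2
        rwa [e1, e2, toE3_rot, toE3_rot, ← map_sub, LinearIsometryEquiv.norm_map]
      · have := h (x + G.length) (by rw [hTshift]; omega) (by rw [hTshift']; omega)
        rwa [hX', hX, toE3_rot, toE3_rot, ← map_sub, LinearIsometryEquiv.norm_map] at this
      · obtain ⟨k, hk, rfl⟩ := hrange r hr x h1 h2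
        rw [← toE3_sub, hstep r hr k hk, norm_toE3_vec]
    refine int_induction_mod hGpos (fun x => ?_) (fun x hx => ?_)
    · rw [hX', hX, toE3_rot, toE3_rot, ← map_sub, LinearIsometryEquiv.norm_map]
    · rw [← toE3_sub]
      have h1 := hXk (x + 1) hx
      push_cast at h1
      rw [h1, hXk x hx.le, wordVec_take_succ _ _ hx]
      rw [show M • v 0 + (wordVec (G.take x) + (G[x]).vec) - (M • v 0 + wordVec (G.take x)) =
        (G[x]).vec by abel, norm_toE3_vec]
  · refine int_induction_mod hm (fun i => ⟨fun h x h1 h2 => ?_, fun h x h1 h2 => ?_⟩)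
      (fun r hr x h1 h2 => ?_)
    · rw [hTshift] at h1
      rw [hTshift'] at h2
      obtain ⟨a, ha, h3⟩ := h (x - G.length) (by omega) (by omega)
      refine ⟨a, ha, ?_⟩
      have e1 := hX (x - G.length)
      rw [sub_add_cancel] at e1
      have e2 := latticeCurve_equivariant hv (i + a)
      rw [show ((i + m : ℤ) : ℝ) + a = i + a + m by push_cast; ring, e2, e1, toE3_rot, ← map_smul,
        ← map_sub, LinearIsometryEquiv.norm_map]
      exact h3
    · obtain ⟨a, ha, h3⟩ := h (x + G.length) (by rw [hTshift]; omega) (by rw [hTshift']; omega)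
      refine ⟨a, ha, ?_⟩
      have e2 := latticeCurve_equivariant hv (i + a)
      rwa [show ((i + m : ℤ) : ℝ) + a = i + a + m by push_cast; ring, e2, hX, toE3_rot, ← map_smul,
        ← map_sub, LinearIsometryEquiv.norm_map] at h3
    · obtain ⟨k, hk, rfl⟩ := hrange r hr x h1 h2
      obtain ⟨a, b, hab, h3⟩ := exists_wordVec_take_repeatWord M (w r) k
      have hM0 : (0 : ℝ) < M := by exact_mod_cast hM
      have ha0 : (0 : ℝ) ≤ (a : ℝ) / M := by positivity
      have ha1 : (a : ℝ) / M ≤ 1 := by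
        rw [div_le_one hM0]; exact_mod_cast hab
      refine ⟨a / M, ⟨ha0, ha1⟩, ?_⟩
      have h4 : wordVec ((blk r).take k) = a • wordVec (w r) + wordVec ((w r).take b) := h3
      rw [hXblk r hr k hk.le, h4, hwvec, latticeCurve,
        pl_eq _ (i := (r : ℤ)) (by linarith) (by linarith), toE3_add, toE3_add, toE3_nsmul,
        toE3_nsmul, toE3_sub, add_sub_cancel_left, smul_add, smul_smul, mul_div_cancel₀ _ hM0.ne',
        ← add_assoc, add_sub_cancel_left]
      refine (norm_toE3_wordVec _).trans ?_
      have h5 : ((w r).take b).length ≤ (w r).length := by simp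
      have h6 : ((w r).length : ℝ) ≤ ∑ j ∈ Finset.range m, ((w j).length : ℝ) :=
        Finset.single_le_sum (f := fun j => ((w j).length : ℝ)) (fun _ _ => Nat.cast_nonneg _)
          (Finset.mem_range.2 hr)
      exact le_trans (by exact_mod_cast h5) h6

theorem pl_strictMono {τ : ℤ → ℝ} (h : ∀ i, τ i < τ (i + 1)) : StrictMono (pl τ) := by
  intro s t hst
  have := glue_all (Q := fun s t => s = t ∨ s < t ∧ pl τ s < pl τ t) (fun s => Or.inl rfl)
    (by
      rintro s t u _ _ (rfl | h1) (rfl | h2)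
      · exact Or.inl rfl
      · exact Or.inr h2
      · exact Or.inr h1
      · exact Or.inr ⟨h1.1.trans h2.1, h1.2.trans h2.2⟩)
    (by
      intro i s t h1 h2 h4
      rcases h2.eq_or_lt with rfl | h5
      · exact Or.inl rfl
      · refine Or.inr ⟨h5, ?_⟩
        have := pl_sub τ h1 (by linarith) (by linarith) h4
        rw [smul_eq_mul] at this
        have h6 := mul_pos (sub_pos.2 h5) (sub_pos.2 (h i))
        linarith) hst.le
  rcases this with h1 | h1
  · exact (hst.ne h1).elim
  · exact h1.2

theorem one_le_abs_of_modEq {N : ℕ} {i j : ℤ} (h : ∀ k : ℤ, j - i - k * N ≠ 0 ∧ j - i - k * N ≠ 1 ∧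
    j - i - k * N ≠ -1) {s t : ℝ} (hs : s ∈ Icc (i : ℝ) (i + 1)) (ht : t ∈ Icc (j : ℝ) (j + 1))
    (k : ℤ) : 1 ≤ |t - s - k * N| := by
  obtain ⟨h0, h1, h2⟩ := h k
  rcases lt_or_gt_of_ne h0 with h3 | h3
  · have h4 : ((j - i - k * N : ℤ) : ℝ) ≤ -2 := by exact_mod_cast (by omega : j - i - k * N ≤ -2)
    push_cast at h4
    rw [abs_of_nonpos] <;> linarith [ht.1, ht.2, hs.1, hs.2]
  · have h4 : (2 : ℝ) ≤ ((j - i - k * N : ℤ) : ℝ) := by exact_mod_cast (by omega : 2 ≤ j - i - k * N)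
    push_cast at h4
    rw [abs_of_nonneg] <;> linarith [ht.1, ht.2, hs.1, hs.2]

set_option maxHeartbeats 800000 in
theorem exists_staircase_isotopic {m : ℕ} {v : ℤ → Fin 3 → ℤ} (h : IsSymmetricPolygon m v)
    (hoct : ∀ i, ∃ ε : Fin 3 → ℤ, (∀ l, ε l = 1 ∨ ε l = -1) ∧ SameOctant ε (v i - v (i - 1)) ∧
      SameOctant ε (v (i + 1) - v i) ∧ SameOctant ε (v (i + 1 + 1) - v (i + 1))) :
    ∃ (G : List Direction) (X : ℤ → Fin 3 → ℤ), IsSymmetricPolygon G.length X ∧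
      (∀ k ≤ G.length, X k = X 0 + wordVec (G.take k)) ∧
      AmbientIsotopic (range (latticeCurve v)) (range (latticeCurve X)) := by
  have hm := h.pos
  set N : ℕ := 3 * m with hN
  have hN0 : 0 < N := by omega
  have hNR : (0 : ℝ) < N := by exact_mod_cast hN0
  choose ε hε hεp hεi hεn using hoct
  have hDne : ∀ i, v (i + 1) - v i ≠ 0 := by
    intro i
    have := h.comb_ne_zero i (p := (0, 1)) (by simp)
    simpa [comb] using this
  obtain ⟨C, hC⟩ := exists_isStaircase hm h.equivariant hDne
  let f := latticeCurve v
  let e : ℤ → E3 := fun i => toE3 (ε i)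
  have hfc : Continuous f := pl_continuous fun i => toE3 (v i)
  have hfN : ∀ t, f (t + N) = f t := latticeCurve_periodic h.equivariant
  have hfm' : ∀ i j : ℤ, SameOctant (ε i) (v (j + 1) - v j) → ∀ s t : ℝ, j ≤ s → s ≤ t → t ≤ j + 1 →
      ‖f t - f s‖ ≤ 1 * inner ℝ (e i) (f t - f s) := by
    intro i j hij s t h1 h2 h3
    refine pl_graph (V := fun i => toE3 (v i)) (A := j) (B := j + 1) (fun x hx hx' => ?_) _ _ h1 h2
      (by push_cast; exact h3)
    obtain rfl : x = j := by omega
    rw [one_mul, ← toE3_sub]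
    exact norm_toE3_le_inner (hε i) hij
  have hfm : ∀ i : ℤ, ∀ s t : ℝ, i ≤ s → s ≤ t → t ≤ i + 1 →
      ‖f t - f s‖ ≤ 1 * inner ℝ (e i) (f t - f s) := fun i => hfm' i i (hεi i)
  obtain ⟨ρ, hρ, sep⟩ := exists_separation hNR hfc hfN h.inj (μ := 1) one_pos
  set κ := (lipschitzExtensionConstant E3 : ℝ) with hκ
  have hκ0 : 0 ≤ κ := NNReal.coe_nonneg _
  set c : ℝ := 1 / (2 * (κ + 1)) with hc
  have hc0 : 0 < c := by positivity
  have hc1 : c < 1 := by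
    rw [hc, div_lt_one (by positivity)]; linarith
  have hκc : κ * c < 1 := by
    rw [hc, mul_one_div, div_lt_one (by positivity)]; linarith
  have hcρ : 0 < c * ρ := mul_pos hc0 hρ
  set C' : ℝ := |C| + 1 with hC'
  have hC'0 : 0 < C' := by positivity
  obtain ⟨M, hM⟩ := exists_nat_gt (4 * C' / (c * ρ))
  have hM0 : (0 : ℝ) < M := lt_trans (by positivity) hM
  obtain ⟨G, X, T, hS⟩ := hC M (by exact_mod_cast hM0)
  set η : ℝ := C' / M with hη
  have hη0 : 0 < η := by positivity
  have hηc : 4 * η ≤ c * ρ := by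
    rw [hη, ← mul_div_assoc, div_le_iff₀ hM0]
    have := (div_le_iff₀ hcρ).1 hM.le
    linarith
  -- the second curve
  let τ : ℝ → ℝ := pl fun i => (T i : ℝ)
  have hτ : StrictMono τ := pl_strictMono fun i => by exact_mod_cast hS.lt i
  have hτi : ∀ i : ℤ, τ i = T i := fun i => pl_int _ i
  have hτm : ∀ t, τ (t + m) = τ t + G.length := by
    intro s
    have h1 := pl_shift (fun i => (T i : ℝ)) m s
    push_cast at h1
    simp only [τ, h1, hS.shift]
    simp only [pl, AffineMap.lineMap_apply, vsub_eq_sub, vadd_eq_add, smul_eq_mul]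
    push_cast; ring
  have hτN : ∀ t, τ (t + N) = τ t + (3 * G.length : ℕ) := by
    intro t
    rw [show t + (N : ℝ) = t + m + m + m by rw [hN]; push_cast; ring, hτm, hτm, hτm]
    push_cast; ring
  have hτk : ∀ (t : ℝ) (k : ℤ), τ (t + k * N) = τ t + k * (3 * G.length : ℕ) := by
    intro t k
    induction k using Int.induction_on with
    | zero => simp
    | succ n ih =>
      have := hτN (t + n * N)
      push_cast at ih this ⊢
      rw [show t + ((n : ℝ) + 1) * N = t + n * N + N by ring, this, ih]
      ring
    | pred n ih =>
      have := hτN (t + (-(n : ℝ) - 1) * N)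
      push_cast at ih this ⊢
      rw [show t + (-(n : ℝ) - 1) * N + N = t + -(n : ℝ) * N by ring, ih] at this
      linarith
  have hτmem : ∀ (i : ℤ) (t : ℝ), t ∈ Icc (i : ℝ) (i + 1) → (T i : ℝ) ≤ τ t ∧ τ t ≤ T (i + 1) := by
    intro i t ht
    rw [← hτi, ← hτi]
    push_cast
    exact ⟨hτ.monotone ht.1, hτ.monotone ht.2⟩
  let g : ℝ → E3 := fun t => (M : ℝ)⁻¹ • latticeCurve X (τ t)
  have hXc : Continuous (latticeCurve X) := pl_continuous fun x => toE3 (X x)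
  have hτc : Continuous τ := pl_continuous _
  have hgc : Continuous g := by fun_prop
  have hgN : ∀ t, g (t + N) = g t := by
    intro t
    simp only [g, hτN, latticeCurve_periodic hS.equivariant]
  have hgm0 : ∀ i j : ℤ, SameOctant (ε i) (v (j + 1) - v j) → ∀ s t : ℝ, j ≤ s → s ≤ t → t ≤ j + 1 →
      ‖g t - g s‖ ≤ 1 * inner ℝ (e i) (g t - g s) := by
    intro i j hij s t h1 h2 h3
    have h4 := hτmem j s ⟨h1, h2.trans h3⟩
    have h5 := hτmem j t ⟨h1.trans h2, h3⟩
    have := pl_graph (V := fun x => toE3 (X x)) (e := e i) (L := 1) (A := T j) (B := T (j + 1))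
      (fun x hx hx' => by
        rw [← toE3_sub, one_mul]
        exact norm_toE3_le_inner (hε i) ((hS.fits j x hx hx').sameOctant hij)) (τ s) (τ t)
      h4.1 (hτ.monotone h2) h5.2
    simp only [g]
    rw [← smul_sub, norm_smul, inner_smul_right, Real.norm_of_nonneg (by positivity), mul_left_comm]
    exact mul_le_mul_of_nonneg_left this (by positivity)
  have hgm : ∀ i : ℤ, ∀ s t : ℝ, i ≤ s → s ≤ t → t ≤ i + 1 →
      ‖g t - g s‖ ≤ 1 * inner ℝ (e i) (g t - g s) := fun i => hgm0 i i (hεi i)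
  have hgm' : ∀ i : ℤ, ∀ s t : ℝ, i ≤ s → s < t → t ≤ i + 1 → g s ≠ g t := by
    intro i s t h1 h2 h3 hst
    have h4 := hτmem i s ⟨h1, h2.le.trans h3⟩
    have h5 := hτmem i t ⟨h1.trans h2.le, h3⟩
    have := pl_strict (V := fun x => toE3 (X x)) (e := e i) (A := T i) (B := T (i + 1))
      (fun x hx hx' => by
        rw [← toE3_sub]
        refine lt_of_lt_of_le (norm_pos_iff.2 ?_)
          (norm_toE3_le_inner (hε i) ((hS.fits i x hx hx').sameOctant (hεi i)))
        rw [← toE3_zero]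
        exact toE3_injective.ne (hS.fits i x hx hx').1) (τ s) (τ t)
      h4.1 (hτ h2) h5.2
    have h4 := smul_right_injective E3 (inv_ne_zero hM0.ne') hst
    exact this.ne (congrArg (fun z => (inner ℝ (e i) z : ℝ)) h4)
  have hend : ∀ i : ℤ, f i = g i := by
    intro i
    have h1 := pl_int (fun i => toE3 (v i)) i
    have h2 := pl_int (fun x => toE3 (X x)) (T i)
    simp only [f, g, latticeCurve]
    rw [hτi, h2, h1, hS.vertex, toE3_nsmul, smul_smul, inv_mul_cancel₀ hM0.ne', one_smul]
  have hnear : ∀ i : ℤ, ∀ t ∈ Icc (i : ℝ) (i + 1), ∃ t' ∈ Icc (i : ℝ) (i + 1), ‖g t - f t'‖ ≤ η := by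
    intro i t ht
    obtain ⟨h1, h2⟩ := hτmem i t ht
    rcases h2.lt_or_eq with h3 | h3
    · set x := ⌊τ t⌋ with hx
      have h4 : (x : ℝ) ≤ τ t := Int.floor_le _
      have h5 : τ t ≤ x + 1 := (Int.lt_floor_add_one _).le
      have h6 : T i ≤ x := Int.le_floor.2 h1
      have h7 : x < T (i + 1) := by exact_mod_cast h4.trans_lt h3
      obtain ⟨a, ha, h8⟩ := hS.close i x h6 h7
      refine ⟨i + a, ⟨by linarith [ha.1], by linarith [ha.2]⟩, ?_⟩
      have e1 : g t - f (i + a) = (M : ℝ)⁻¹ • ((toE3 (X x) - (M : ℝ) • latticeCurve v (i + a)) +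
          (τ t - x) • (toE3 (X (x + 1)) - toE3 (X x))) := by
        simp only [g, f, latticeCurve]
        rw [pl_eq (fun x => toE3 (X x)) h4 h5, smul_add, smul_add,
          smul_sub (M : ℝ)⁻¹ (toE3 (X x)), smul_smul (M : ℝ)⁻¹ (M : ℝ),
          inv_mul_cancel₀ hM0.ne', one_smul]
        abel
      rw [e1, norm_smul, Real.norm_of_nonneg (by positivity), hη, div_eq_inv_mul]
      refine mul_le_mul_of_nonneg_left ((norm_add_le _ _).trans (add_le_add
        (h8.trans (le_abs_self C)) ?_)) (by positivity)
      rw [norm_smul, Real.norm_of_nonneg (by linarith)]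
      exact mul_le_one₀ (by linarith) (norm_nonneg _) (hS.norm_step x)
    · have h4 : t = ((i + 1 : ℤ) : ℝ) := hτ.injective (by rw [h3, hτi])
      refine ⟨t, ht, ?_⟩
      rw [h4, hend, sub_self, norm_zero]; exact hη0.le
  have hcmp : ∀ i : ℤ, ∀ s ∈ Icc (i : ℝ) (i + 1), ∀ s' ∈ Icc (i : ℝ) (i + 1),
      ‖f s - f s'‖ ≤ |(inner ℝ (e i) (f s - f s') : ℝ)| := by
    intro i s hs s' hs'
    rcases le_total s s' with h1 | h1
    · have := hfm i s s' hs.1 h1 hs'.2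
      rw [one_mul] at this
      rw [show f s - f s' = -(f s' - f s) by abel, norm_neg, inner_neg_right, abs_neg]
      exact this.trans (le_abs_self _)
    · have := hfm i s' s hs'.1 h1 hs.2
      rw [one_mul] at this
      exact this.trans (le_abs_self _)
  have hclose : ∀ i : ℤ, ∀ s ∈ Icc (i : ℝ) (i + 1), ∀ s' ∈ Icc (i : ℝ) (i + 1),
      inner ℝ (e i) (f s) = inner ℝ (e i) (g s') → ‖g s' - f s‖ ≤ 3 * η := by
    intro i s hs s' hs' hss
    obtain ⟨t', ht', h1⟩ := hnear i s' hs'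
    have h2 := hcmp i t' ht' s hs
    rw [inner_sub_right, hss, ← inner_sub_right] at h2
    have h3 : ‖f t' - f s‖ ≤ 2 * η := by
      refine h2.trans ((abs_real_inner_le_norm _ _).trans ?_)
      rw [norm_sub_rev]
      exact mul_le_mul (norm_toE3_octant (hε i)) h1 (norm_nonneg _) (by norm_num)
    have h4 : g s' - f s = (g s' - f t') + (f t' - f s) := by abel
    rw [h4]
    refine (norm_add_le _ _).trans ?_
    linarith
  have hmono : ∀ {x y u : E3}, ‖y - x‖ ≤ 1 * inner ℝ u (y - x) →
      (inner ℝ u x : ℝ) ≤ inner ℝ u y := by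
    intro x y u hxy
    rw [inner_sub_right] at hxy
    linarith [norm_nonneg (y - x)]
  have hfk : ∀ (t : ℝ) (k : ℤ), f (t + k * N) = f t := periodic_int_mul hfN
  have hgk : ∀ (t : ℝ) (k : ℤ), g (t + k * N) = g t := periodic_int_mul hgN
  have hεk : ∀ (i k : ℤ), v (i + k * N) = v i := by
    intro i k
    have h1 := hfk i k
    have h2 := pl_int (fun i => toE3 (v i)) i
    have h3 := pl_int (fun i => toE3 (v i)) (i + k * N)
    push_cast at h3
    exact toE3_injective (h3.symm.trans (h1.trans h2))
  have far : ∀ i j : ℤ, ¬ i ≡ j [ZMOD N] → ∀ s ∈ Icc (i : ℝ) (i + 1), ∀ s' ∈ Icc (i : ℝ) (i + 1),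
      inner ℝ (e i) (f s) = inner ℝ (e i) (g s') → ∀ t ∈ Icc (j : ℝ) (j + 1), ∀ y,
      y = f t ∨ y = g t → inner ℝ (e i) y ≤ inner ℝ (e i) (f i) ∨
        inner ℝ (e i) (f (i + 1)) ≤ inner ℝ (e i) y ∨ ‖g s' - f s‖ ≤ c * ‖y - f s‖ := by
    intro i j hij s hs s' hs' hss t ht y hy
    by_cases hfar : ∀ k : ℤ, j - i - k * N ≠ 0 ∧ j - i - k * N ≠ 1 ∧ j - i - k * N ≠ -1
    · refine Or.inr (Or.inr ?_)
      have h1 : ∃ t' ∈ Icc (j : ℝ) (j + 1), ‖y - f t'‖ ≤ η := by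
        rcases hy with rfl | rfl
        · exact ⟨t, ht, by simpa using hη0.le⟩
        · exact hnear j t ht
      obtain ⟨t', ht', h2⟩ := h1
      have h3 := sep t' s (one_le_abs_of_modEq hfar hs ht')
      have h4 : f t' - f s = (y - f s) - (y - f t') := by abel
      have h5 : ρ ≤ ‖y - f s‖ + η := by
        rw [h4] at h3
        exact h3.trans ((norm_sub_le _ _).trans (add_le_add le_rfl h2))
      have h6 := mul_le_mul_of_nonneg_left h5 hc0.le
      have h7 : c * η ≤ η := mul_le_of_le_one_left hη0.le hc1.le
      have h8 := hclose i s hs s' hs' hss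
      linarith
    · push Not at hfar
      obtain ⟨k, hk⟩ := hfar
      have hk0 : j - i - k * N ≠ 0 := by
        intro h0
        apply hij
        rw [Int.modEq_iff_dvd]
        exact ⟨k, by linarith⟩
      by_cases hk1 : j - i - k * N = 1
      · right; left
        obtain rfl : j = i + 1 + k * N := by linarith
        have hoc : SameOctant (ε i) (v (i + 1 + k * N + 1) - v (i + 1 + k * N)) := by
          rw [show i + 1 + k * (N : ℤ) + 1 = i + 1 + 1 + k * N by ring, hεk, hεk]; exact hεn i
        have e1 : f (i + 1) = f ((i + 1 + k * N : ℤ) : ℝ) := by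
          push_cast; exact (hfk _ _).symm
        rw [e1]
        rcases hy with rfl | rfl
        · exact hmono (hfm' i _ hoc _ _ le_rfl ht.1 ht.2)
        · rw [hend]; exact hmono (hgm0 i _ hoc _ _ le_rfl ht.1 ht.2)
      · left
        have hk2 := hk hk0 hk1
        obtain rfl : j = i - 1 + k * N := by linarith
        have hoc : SameOctant (ε i) (v (i - 1 + k * N + 1) - v (i - 1 + k * N)) := by
          rw [show i - 1 + k * (N : ℤ) + 1 = i + k * N by ring, hεk, hεk]; exact hεp i
        have e1 : f i = f ((i - 1 + k * N : ℤ) + 1 : ℝ) := by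
          rw [show ((i - 1 + k * N : ℤ) + 1 : ℝ) = i + k * N by push_cast; ring]
          exact (hfk _ _).symm
        rw [e1]
        rcases hy with rfl | rfl
        · exact hmono (hfm' i _ hoc _ _ ht.1 ht.2 le_rfl)
        · have := hend (i - 1 + k * N + 1)
          rw [Int.cast_add (i - 1 + k * N) 1, Int.cast_one] at this
          rw [this]
          exact hmono (hgm0 i _ hoc _ _ ht.1 ht.2 le_rfl)
  have hsurj : ∀ x, ∃ t, τ t = x := by
    intro x
    have hG0 : (0 : ℝ) < (3 * G.length : ℕ) := by
      have := hS.pos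
      exact_mod_cast (by omega : 0 < 3 * G.length)
    have h1 := hτk 0 ⌊(x - τ 0) / (3 * G.length : ℕ)⌋
    have h2 := hτk 0 ⌈(x - τ 0) / (3 * G.length : ℕ)⌉
    obtain ⟨t, ht⟩ := mem_range_of_exists_le_of_exists_ge (c := x) hτc
      ⟨_, show τ _ ≤ x by
        rw [h1]
        have := (le_div_iff₀ hG0).1 (Int.floor_le ((x - τ 0) / (3 * G.length : ℕ)))
        linarith⟩
      ⟨_, show x ≤ τ _ by
        rw [h2]
        have := (div_le_iff₀ hG0).1 (Int.le_ceil ((x - τ 0) / (3 * G.length : ℕ)))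
        linarith⟩
    exact ⟨t, ht⟩
  refine ⟨G, X, ⟨hS.pos, hS.equivariant, fun s t hst => ?_⟩, hS.word, ?_⟩
  · obtain ⟨s', rfl⟩ := hsurj s
    obtain ⟨t', rfl⟩ := hsurj t
    obtain ⟨k, hk⟩ := injective_of_graphs hfc hgN zero_le_one hc1 hgm hgm' hend h.inj far s' t' (by
      simp only [g, hst])
    refine ⟨k, ?_⟩
    have : s' = t' + k * N := by linarith
    rw [this, hτk]; ring
  · have h1 := ambientIsotopic_range_of_graphs hN0 hfc hgc hfN hgN zero_le_one hc0.le hκc hfm hgm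
      hend far
    have h3 : (fun x => (M : ℝ) • x) '' range g = range (latticeCurve X) := by
      rw [← range_comp]
      apply Subset.antisymm
      · rintro _ ⟨t, rfl⟩
        exact ⟨τ t, by simp only [g, Function.comp_apply, smul_smul, mul_inv_cancel₀ hM0.ne', one_smul]⟩
      · rintro _ ⟨x, rfl⟩
        obtain ⟨t, rfl⟩ := hsurj x
        exact ⟨t, by simp only [g, Function.comp_apply, smul_smul, mul_inv_cancel₀ hM0.ne', one_smul]⟩
    have h4 := ambientIsotopic_smul hM0 (range g)
    rw [h3] at h4
    exact h1.trans h4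

/-- Every symmetric polygon is isotopic to a symmetric lattice path. -/
theorem IsSymmetricPolygon.exists_word {m : ℕ} {v : ℤ → Fin 3 → ℤ} (h : IsSymmetricPolygon m v) :
    ∃ (G : List Direction) (X : ℤ → Fin 3 → ℤ), IsSymmetricPolygon G.length X ∧
      (∀ k ≤ G.length, X k = X 0 + wordVec (G.take k)) ∧
      AmbientIsotopic (range (latticeCurve v)) (range (latticeCurve X)) := by
  obtain ⟨W, hW, h1, h2⟩ := exists_sameOctant_polygon h
  have hstep : ∀ i, CubicKnot.halve W (i + 1) - CubicKnot.halve W i = W (i / 2 + 1) - W (i / 2) := by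
    intro i
    simp only [CubicKnot.halve]
    rw [show (i + 1 + 1) / 2 = i / 2 + 1 by omega]
    abel
  have hpair : ∀ i j : ℤ, i ≤ j → j ≤ i + 1 → SameOctant (W (i + 1) - W i) (W (j + 1) - W j) := by
    intro i j h3 h4
    obtain rfl | rfl : j = i ∨ j = i + 1 := by omega
    · exact SameOctant.refl _
    · have := h2 (i + 1)
      rwa [add_sub_cancel_right] at this
  obtain ⟨G, X, hX, hG, h3⟩ := exists_staircase_isotopic hW.halve (fun i => by
    have h4 := hstep (i - 1)
    rw [sub_add_cancel] at h4
    rw [h4, hstep, hstep]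
    exact exists_common_octant (hpair _ _ (by omega) (by omega)) (hpair _ _ (by omega) (by omega))
      (hpair _ _ (by omega) (by omega)))
  refine ⟨G, X, hX, hG, h1.trans (AmbientIsotopic.trans ?_ h3)⟩
  rw [range_latticeCurve_halve]
  exact ambientIsotopic_smul two_pos _

/-! ### Threefold words -/

theorem length_threefoldWord (σ : Equiv.Perm Direction) (g : List Direction) :
    (threefoldWord σ g).length = 3 * g.length := by
  simp [threefoldWord]; omega

theorem wordVec_take_threefoldWord₀ (σ : Equiv.Perm Direction) (g : List Direction) {k : ℕ}
    (hk : k ≤ g.length) :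
    wordVec ((threefoldWord σ g).take k) = wordVec (g.take k) := by
  rw [threefoldWord, List.append_assoc, List.take_append_of_le_length hk]

theorem wordVec_take_threefoldWord₁ (σ : Equiv.Perm Direction) (g : List Direction) {k : ℕ}
    (hk : k ≤ g.length) :
    wordVec ((threefoldWord σ g).take (g.length + k)) =
      wordVec g + wordVec ((g.take k).map σ) := by
  rw [threefoldWord, List.append_assoc, List.take_length_add_append, wordVec_append,
    List.take_append_of_le_length (by simpa using hk), List.map_take]

theorem wordVec_take_threefoldWord₂ (σ : Equiv.Perm Direction) (g : List Direction) {k : ℕ} :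
    wordVec ((threefoldWord σ g).take (g.length + g.length + k)) =
      wordVec g + wordVec (g.map σ) + wordVec (((g.take k).map σ).map σ) := by
  have h : (g ++ g.map σ).length = g.length + g.length := by simp
  rw [threefoldWord, ← h, List.take_length_add_append, wordVec_append, wordVec_append,
    ← List.map_take, List.map_map]
  rfl

theorem galleryCenters_eq (p : Fin 3 → ℤ) (w : List Direction) (i : ℕ) :
    galleryCenters p w i = center p + toE3 (wordVec (w.take i)) := by
  ext l
  simp [galleryCenters, center, cubeAt, toE3, wordVec]
  ring

theorem center_eq (p : Fin 3 → ℤ) : center p = toE3 p + center 0 := by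
  ext l
  simp [center, toE3]

/-! ### Polygonal paths over the integers -/

theorem polyline_eq_pl {n : ℕ} {c : ℕ → E3} {V : ℤ → E3} (h : ∀ k ≤ n, V k = c k) {t : ℝ}
    (ht : t ∈ Icc (0 : ℝ) n) : polyline c t = pl V t := by
  have hfl : ((⌊t⌋₊ : ℕ) : ℤ) = ⌊t⌋ := Int.natCast_floor_eq_floor ht.1
  have hle : ⌊t⌋₊ ≤ n := Nat.floor_le_of_le ht.2
  rcases hle.lt_or_eq with h1 | h1
  · have h2 := h _ hle
    have h3 := h (⌊t⌋₊ + 1) h1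
    push_cast at h3
    rw [hfl] at h2 h3
    rw [polyline, pl, h2, h3]
  · have h2 : (n : ℝ) ≤ t := by
      rw [← h1]; exact Nat.floor_le ht.1
    obtain rfl : t = n := le_antisymm ht.2 h2
    have h3 := pl_int V n
    rw [Int.cast_natCast] at h3
    rw [h3, h n le_rfl, polyline]
    simp

theorem range_pl_of_periodic {n : ℕ} (hn : 0 < n) {V : ℤ → E3} (h : ∀ t, pl V (t + n) = pl V t) :
    range (pl V) = pl V '' Icc (0 : ℝ) n := by
  apply Subset.antisymm
  · rintro _ ⟨t, rfl⟩
    obtain ⟨k, hk⟩ := exists_shift_mem_Icc (p := n) (by exact_mod_cast hn) t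
    exact ⟨_, hk, periodic_int_mul h t k⟩
  · exact image_subset_range _ _

theorem polygonSet_eq_range {n : ℕ} (hn : 0 < n) {c : ℕ → E3} {V : ℤ → E3}
    (h : ∀ k ≤ n, V k = c k) (hV : ∀ t, pl V (t + n) = pl V t) :
    polygonSet n c = range (pl V) := by
  rw [range_pl_of_periodic hn hV, polygonSet]
  exact image_congr fun t ht => polyline_eq_pl h ht

/-! ### The cyclic permutation of the axes -/

/-- The permutation of the directions which codifies the cyclic permutation of the axes. -/
def cycPerm : Equiv.Perm Direction where
  toFun
    | .F => .R
    | .R => .U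
    | .U => .F
    | .B => .L
    | .L => .D
    | .D => .B
  invFun
    | .R => .F
    | .U => .R
    | .F => .U
    | .L => .B
    | .D => .L
    | .B => .D
  left_inv s := by cases s <;> rfl
  right_inv s := by cases s <;> rfl

theorem vec_cycPerm (s : Direction) : (cycPerm s).vec = rot s.vec := by
  cases s <;> ext l <;> fin_cases l <;> rfl

theorem wordVec_map_cycPerm (w : List Direction) :
    wordVec (w.map cycPerm) = rot (wordVec w) := by
  induction w with
  | nil => ext l; fin_cases l <;> rfl
  | cons s w ih =>
    simp only [wordVec, List.map_cons, List.sum_cons] at ih ⊢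
    rw [ih, rot_add, vec_cycPerm]

theorem det_eq_one_of_cube {A : E3 →ₗ[ℝ] E3} (h : ∀ x, A (A (A x)) = x) : LinearMap.det A = 1 := by
  have h1 : A * A * A = 1 := LinearMap.ext fun x => h x
  have h2 := congrArg LinearMap.det h1
  rw [map_mul, map_mul, map_one] at h2
  set d := LinearMap.det A
  have h3 : (d - 1) * (d ^ 2 + d + 1) = 0 := by linear_combination h2
  rcases mul_eq_zero.1 h3 with h4 | h4
  · linarith
  · nlinarith [sq_nonneg (d + 1 / 2)]

theorem orderOf_eq_three {R : E3 ≃ᵃⁱ[ℝ] E3} (h : ∀ x, R (R (R x)) = x) (h1 : ∃ x, R x ≠ x) :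
    orderOf R = 3 := by
  refine orderOf_eq_prime ?_ ?_
  · ext1 x
    exact h x
  · rintro rfl
    obtain ⟨x, hx⟩ := h1
    exact hx rfl

theorem isThreefoldRotation_of_cube {R : E3 ≃ᵃⁱ[ℝ] E3} (h : ∀ x, R (R (R x)) = x)
    (h1 : ∃ x, R x ≠ x) : IsThreefoldRotation R := by
  have hadd : ∀ x y, R (x + y) = R.linearIsometryEquiv x + R y := fun x y => by
    rw [affineIsometry_apply R (x + y) y, add_sub_cancel_right]
  refine ⟨det_eq_one_of_cube fun x => ?_, ⟨(1 / 3 : ℝ) • (0 + R 0 + R (R 0)), ?_⟩,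
    orderOf_eq_three h h1⟩
  · have := h (x + 0)
    rw [hadd, hadd, hadd, h] at this
    exact add_right_cancel this
  · have e0 := affineIsometry_apply R ((1 / 3 : ℝ) • (0 + R 0 + R (R 0))) 0
    have e1 := affineIsometry_apply R (R 0) 0
    have e2 := affineIsometry_apply R (R (R 0)) 0
    rw [h] at e2
    rw [e0]
    rw [sub_zero] at e0 e1 e2 ⊢
    have e2' : R.linearIsometryEquiv (R (R 0)) = - R 0 := eq_neg_of_add_eq_zero_left e2.symm
    have e1' : R.linearIsometryEquiv (R 0) = R (R 0) - R 0 := eq_sub_of_add_eq e1.symm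
    rw [map_smul, map_add, map_add, map_zero, e1', e2']
    module

theorem isThreefoldLatticeRotation_cyc : IsThreefoldLatticeRotation cyc cycPerm := by
  have himg : ∀ m, cyc '' cube m = cube (rot m) := by
    intro m
    ext x
    constructor
    · rintro ⟨y, hy, rfl⟩ l
      rw [cyc_apply, cycLin_apply]
      fin_cases l
      · exact hy 2
      · exact hy 0
      · exact hy 1
    · intro hx
      refine ⟨cycLin (cycLin x), fun l => ?_, cycLin_cube x⟩
      rw [cycLin_apply, cycLin_apply]
      fin_cases l
      · exact hx 1
      · exact hx 2
      · exact hx 0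
  refine ⟨isThreefoldRotation_of_cube cycLin_cube ⟨!₂[1, 0, 0], fun h => ?_⟩,
    ⟨fun m => ⟨_, himg m⟩, fun m => ⟨rot (rot m), by rw [himg, rot_cube]⟩⟩, fun s => ?_⟩
  · rw [cyc_apply, cycLin_apply] at h
    have := congrArg (fun z : E3 => z 0) h
    simp at this
  · rw [vec_cycPerm, toE3_rot]; rfl

theorem HasThreefoldRotationalSymmetry.exists_gallery {K : Set E3}
    (h : HasThreefoldRotationalSymmetry K) :
    ∃ (p : Fin 3 → ℤ) (g : List Direction) (R : E3 ≃ᵃⁱ[ℝ] E3) (σ : Equiv.Perm Direction),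
      IsThreefoldLatticeRotation R σ ∧ GalleryKnotsAs p (threefoldWord σ g) K := by
  obtain ⟨β, hβ, h1⟩ := h.exists_isSymmetricLoop
  obtain ⟨m, v, hv, h2⟩ := hβ.exists_polygon
  obtain ⟨G, X, hX, hG, h3⟩ := hv.exists_word
  refine ⟨X 0, G, cyc, cycPerm, isThreefoldLatticeRotation_cyc, ?_⟩
  have hX1 : X G.length = rot (X 0) := by
    have := hX.equivariant 0
    rwa [zero_add] at this
  have hXG : X 0 + wordVec G = rot (X 0) := by
    rw [← hX1, hG _ le_rfl, List.take_length]
  have hcube : ∀ k ≤ 3 * G.length,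
      X k = X 0 + wordVec ((threefoldWord cycPerm G).take k) := by
    intro k hk
    rcases le_total k G.length with hk1 | hk1
    · rw [wordVec_take_threefoldWord₀ _ _ hk1, hG k hk1]
    obtain ⟨j, rfl⟩ := Nat.exists_eq_add_of_le hk1
    rcases le_total j G.length with hj1 | hj1
    · rw [wordVec_take_threefoldWord₁ _ _ hj1, wordVec_map_cycPerm, ← add_assoc, hXG, ← rot_add,
        ← hG j hj1, ← hX.equivariant]
      congr 1; push_cast; ring
    obtain ⟨j, rfl⟩ := Nat.exists_eq_add_of_le hj1
    have e1 : X ((G.length + (G.length + j) : ℕ) : ℤ) = rot (rot (X j)) := by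
      rw [← hX.equivariant, ← hX.equivariant]
      congr 1; push_cast; ring
    rw [e1, ← add_assoc, wordVec_take_threefoldWord₂, wordVec_map_cycPerm, wordVec_map_cycPerm,
      wordVec_map_cycPerm, ← add_assoc, ← add_assoc, hXG, ← rot_add, hXG, ← rot_add, ← rot_add,
      hG j (by omega)]
  set n := 3 * G.length with hn
  have hn0 : 0 < n := by have := hX.pos; omega
  have hlen : (threefoldWord cycPerm G).length = n := length_threefoldWord _ _
  set c := galleryCenters (X 0) (threefoldWord cycPerm G) with hc
  let V : ℤ → E3 := fun i => toE3 (X i) + center 0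
  have hVc : ∀ k ≤ n, V k = c k := by
    intro k hk
    simp only [V]
    rw [hc, galleryCenters_eq, hcube k hk, toE3_add, center_eq (X 0)]
    abel
  have hV : ∀ t, pl V t = latticeCurve X t + center 0 := by
    intro t
    simp only [V, latticeCurve, pl, AffineMap.lineMap_apply, vsub_eq_sub, vadd_eq_add]
    module
  have hVn : ∀ t, pl V (t + n) = pl V t := by
    intro t
    rw [hV, hV, latticeCurve_periodic hX.equivariant]
  rw [GalleryKnotsAs, hlen]
  refine ⟨⟨hn0, ?_, ?_⟩, ?_⟩
  · change c n = c 0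
    rw [← hVc n le_rfl, ← hVc 0 (Nat.zero_le _)]
    have := hX.periodic 0
    rw [zero_add] at this
    simp only [V, hn, this, Nat.cast_zero]
  · intro s hs t ht hst
    rw [polyline_eq_pl hVc (Ico_subset_Icc_self hs), polyline_eq_pl hVc (Ico_subset_Icc_self ht),
      hV, hV] at hst
    obtain ⟨k, hk⟩ := hX.inj _ _ (add_right_cancel hst)
    have hnR : (0 : ℝ) < n := by exact_mod_cast hn0
    have hk1 : k < 1 := by
      have : (k : ℝ) * n < 1 * n := by linarith [hs.2, ht.1]
      exact_mod_cast lt_of_mul_lt_mul_right this hnR.le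
    have hk2 : -1 < k := by
      have : (-1 : ℝ) * n < k * n := by linarith [hs.1, ht.2]
      exact_mod_cast lt_of_mul_lt_mul_right this hnR.le
    obtain rfl : k = 0 := by omega
    simp at hk
    linarith
  · rw [polygonSet_eq_range hn0 hVc hVn]
    have h4 : range (pl V) = (fun x => x + center 0) '' range (latticeCurve X) := by
      rw [← range_comp]
      congr 1
      ext1 t
      exact hV t
    rw [h4]
    exact ((h1.trans h2).trans h3).trans (ambientIsotopic_add _ _)

/-! ### Regularity of polygons -/

theorem hasDerivWithinAt_pl_right (V : ℤ → E3) {n t : ℝ} (hn : 0 < n) :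
    HasDerivWithinAt (fun t => pl V (n * t)) (n • (V (⌊n * t⌋ + 1) - V ⌊n * t⌋)) (Ici t) t ∧
      ∃ ε > 0, ContDiffOn ℝ 1 (fun t => pl V (n * t)) (Icc t (t + ε)) := by
  set i := ⌊n * t⌋ with hi
  have h1 : (i : ℝ) ≤ n * t := Int.floor_le _
  have h2 : n * t < i + 1 := Int.lt_floor_add_one _
  have hε : 0 < (i + 1 - n * t) / n := div_pos (by linarith) hn
  have heq : ∀ x ∈ Icc t (t + (i + 1 - n * t) / n),
      pl V (n * x) = V i + (n * x - i) • (V (i + 1) - V i) := by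
    intro x hx
    have h3 : n * t ≤ n * x := mul_le_mul_of_nonneg_left hx.1 hn.le
    have h4 := mul_le_mul_of_nonneg_left hx.2 hn.le
    rw [mul_add, mul_div_cancel₀ _ hn.ne'] at h4
    exact pl_eq V (by linarith) (by linarith)
  refine ⟨?_, _, hε, ?_⟩
  · have hd : HasDerivAt (fun x : ℝ => V i + (n * x - i) • (V (i + 1) - V i))
        (n • (V (i + 1) - V i)) t := by
      have := (((hasDerivAt_id t).const_mul n).sub_const (i : ℝ)).smul_const (V (i + 1) - V i)
      simpa using this.const_add (V i)
    refine hd.hasDerivWithinAt.congr_of_eventuallyEq ?_ (heq t ⟨le_rfl, by linarith⟩)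
    filter_upwards [Icc_mem_nhdsGE (by linarith : t < t + (i + 1 - n * t) / n)] with x hx
    exact heq x hx
  · refine ContDiffOn.congr ?_ heq
    fun_prop

theorem hasDerivWithinAt_pl_left (V : ℤ → E3) {n t : ℝ} (hn : 0 < n) :
    HasDerivWithinAt (fun t => pl V (n * t)) (n • (V ⌈n * t⌉ - V (⌈n * t⌉ - 1))) (Iic t) t ∧
      ∃ ε > 0, ContDiffOn ℝ 1 (fun t => pl V (n * t)) (Icc (t - ε) t) := by
  set i := ⌈n * t⌉ - 1 with hi
  have hi' : ⌈n * t⌉ = i + 1 := by omega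
  have h1 : (i : ℝ) < n * t := by
    have := Int.ceil_lt_add_one (n * t)
    rw [hi']at this
    push_cast at this; linarith
  have h2 : n * t ≤ i + 1 := by
    have := Int.le_ceil (n * t)
    rw [hi'] at this
    push_cast at this; linarith
  rw [hi']
  have hε : 0 < (n * t - i) / n := div_pos (by linarith) hn
  have heq : ∀ x ∈ Icc (t - (n * t - i) / n) t,
      pl V (n * x) = V i + (n * x - i) • (V (i + 1) - V i) := by
    intro x hx
    have h3 : n * x ≤ n * t := mul_le_mul_of_nonneg_left hx.2 hn.le
    have h4 := mul_le_mul_of_nonneg_left hx.1 hn.le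
    rw [mul_sub, mul_div_cancel₀ _ hn.ne'] at h4
    exact pl_eq V (by linarith) (by linarith)
  refine ⟨?_, _, hε, ?_⟩
  · have hd : HasDerivAt (fun x : ℝ => V i + (n * x - i) • (V (i + 1) - V i))
        (n • (V (i + 1) - V i)) t := by
      have := (((hasDerivAt_id t).const_mul n).sub_const (i : ℝ)).smul_const (V (i + 1) - V i)
      simpa using this.const_add (V i)
    refine hd.hasDerivWithinAt.congr_of_eventuallyEq ?_ (heq t ⟨by linarith, le_rfl⟩)
    filter_upwards [Icc_mem_nhdsLE (by linarith : t - (n * t - i) / n < t)] with x hx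
    exact heq x hx
  · refine ContDiffOn.congr ?_ heq
    fun_prop

/-- A simple closed polygon with edges of length one is a piecewise regular curve. -/
theorem isPiecewiseRegularCurve_pl {V : ℤ → E3} {n : ℕ} (hn : 3 ≤ n)
    (hV : ∀ t, pl V (t + n) = pl V t) (hinj : InjOn (pl V) (Ico (0 : ℝ) n))
    (hstep : ∀ i, ‖V (i + 1) - V i‖ = 1) :
    IsPiecewiseRegularCurve fun t => pl V (n * t) := by
  have hn0 : (0 : ℝ) < n := by exact_mod_cast (by omega : 0 < n)
  have hVne : ∀ i, V (i + 1) - V i ≠ 0 := fun i h => by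
    have := hstep i
    rw [h, norm_zero] at this
    norm_num at this
  have hVinj : ∀ i, V (i + 1) ≠ V (i - 1) := by
    intro i h
    rw [← pl_int V, ← pl_int V] at h
    obtain ⟨k, hk⟩ : ∃ k : ℤ, (i - 1 : ℝ) + k * n ∈ Ico (0 : ℝ) n := by
      refine ⟨-⌊(i - 1 : ℝ) / n⌋, ?_, ?_⟩
      · have := (le_div_iff₀ hn0).1 (Int.floor_le ((i - 1 : ℝ) / n))
        push_cast; linarith
      · have := (div_lt_iff₀ hn0).1 (Int.lt_floor_add_one ((i - 1 : ℝ) / n))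
        push_cast; linarith
    have hn3 : (3 : ℝ) ≤ n := by exact_mod_cast hn
    push_cast at h
    rw [← periodic_int_mul hV _ k, ← periodic_int_mul hV (i - 1) k] at h
    by_cases h1 : (i + 1 : ℝ) + k * n < n
    · have := hinj ⟨by linarith [hk.1], h1⟩ hk h
      linarith
    · rw [← periodic_int_mul hV _ (-1)] at h
      push_cast at h
      push Not at h1
      have := hinj ⟨by linarith, by linarith [hk.2]⟩ hk h
      linarith
  have hr : ∀ t, derivWithin (fun t => pl V (n * t)) (Ici t) t =
      (n : ℝ) • (V (⌊n * t⌋ + 1) - V ⌊n * t⌋) := fun t =>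
    (hasDerivWithinAt_pl_right V hn0).1.derivWithin (uniqueDiffWithinAt_Ici t)
  have hl : ∀ t, derivWithin (fun t => pl V (n * t)) (Iic t) t =
      (n : ℝ) • (V ⌈n * t⌉ - V (⌈n * t⌉ - 1)) := fun t =>
    (hasDerivWithinAt_pl_left V hn0).1.derivWithin (uniqueDiffWithinAt_Iic t)
  have hVne' : ∀ i, V i - V (i - 1) ≠ 0 := fun i => by
    have := hVne (i - 1)
    rwa [sub_add_cancel] at this
  refine ⟨fun t => ?_, fun s hs t ht hst => ?_, fun t => (hasDerivWithinAt_pl_right V hn0).2,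
    fun t => (hasDerivWithinAt_pl_left V hn0).2, fun t => ?_, fun t => ?_, fun t h => ?_⟩
  · rw [mul_add, mul_one]; exact hV _
  · have h1 : ∀ x ∈ Ico (0 : ℝ) 1, (n : ℝ) * x ∈ Ico (0 : ℝ) n := fun x hx =>
      ⟨mul_nonneg hn0.le hx.1, by nlinarith [hx.2]⟩
    exact mul_left_cancel₀ hn0.ne' (hinj (h1 s hs) (h1 t ht) hst)
  · rw [hr]; exact smul_ne_zero hn0.ne' (hVne _)
  · rw [hl]; exact smul_ne_zero hn0.ne' (hVne' _)
  · rw [hr, hl] at h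
    have h1 : ‖V ⌈n * t⌉ - V (⌈n * t⌉ - 1)‖ = 1 := by
      have := hstep (⌈n * t⌉ - 1)
      rwa [sub_add_cancel] at this
    have h2 : (n : ℝ) • (V ⌈n * t⌉ - V (⌈n * t⌉ - 1)) =
        -((n : ℝ) • (V (⌊n * t⌋ + 1) - V ⌊n * t⌋)) := by
      rw [sameRay_iff_of_norm_eq] at h
      · exact h
      · rw [norm_neg, norm_smul, norm_smul, h1, hstep]
    rw [← smul_neg] at h2
    have h3 := smul_right_injective E3 hn0.ne' h2
    have h4 := Int.floor_le_ceil (n * t)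
    have h5 := Int.ceil_le_floor_add_one (n * t)
    rcases h4.eq_or_lt with h6 | h6
    · rw [← h6] at h3
      apply hVinj ⌊n * t⌋
      have : V (⌊n * t⌋ + 1) - V (⌊n * t⌋ - 1) = (V ⌊n * t⌋ - V (⌊n * t⌋ - 1)) +
        (V (⌊n * t⌋ + 1) - V ⌊n * t⌋) := by abel
      rw [← sub_eq_zero, this, h3, neg_add_cancel]
    · have h7 : ⌈n * t⌉ = ⌊n * t⌋ + 1 := by omega
      rw [h7, add_sub_cancel_right] at h3
      have h8 : (2 : ℝ) • (V (⌊n * t⌋ + 1) - V ⌊n * t⌋) = 0 := by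
        rw [two_smul]
        exact add_eq_zero_iff_eq_neg.2 h3
      exact hVne _ ((smul_eq_zero.1 h8).resolve_left two_ne_zero)

/-! ### Galleries with threefold symmetry -/

theorem IsCodifiedBy.toE3_wordVec_map {R : E3 ≃ᵃⁱ[ℝ] E3} {σ : Equiv.Perm Direction}
    (h : IsCodifiedBy R σ) (w : List Direction) :
    toE3 (wordVec (w.map σ)) = R.linearIsometryEquiv (toE3 (wordVec w)) := by
  induction w with
  | nil => simp [wordVec_nil, toE3_zero]
  | cons s w ih =>
    have h1 : wordVec ((s :: w).map σ) = (σ s).vec + wordVec (w.map σ) := by simp [wordVec]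
    have h2 : wordVec (s :: w) = s.vec + wordVec w := by simp [wordVec]
    rw [h1, h2, toE3_add, toE3_add, map_add, ih, h s]

theorem hasThreefoldRotationalSymmetry_of_gallery {K : Set E3} {p : Fin 3 → ℤ}
    {g : List Direction} {R : E3 ≃ᵃⁱ[ℝ] E3} {σ : Equiv.Perm Direction}
    (hR : IsThreefoldLatticeRotation R σ) (h : GalleryKnotsAs p (threefoldWord σ g) K) :
    HasThreefoldRotationalSymmetry K := by
  obtain ⟨hrot, -, hσ⟩ := hR
  obtain ⟨⟨hpos, hclosed, hinj⟩, hK⟩ := h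
  rw [length_threefoldWord] at hpos hclosed hinj hK
  set l := g.length with hl
  have hl0 : 0 < l := by omega
  set c := galleryCenters p (threefoldWord σ g) with hc
  have hck : ∀ k, c k = center p + toE3 (wordVec ((threefoldWord σ g).take k)) :=
    galleryCenters_eq _ _
  set A := R.linearIsometryEquiv with hA
  have hc0 : ∀ k ≤ l, c k = center p + toE3 (wordVec (g.take k)) := fun k hk => by
    rw [hck, wordVec_take_threefoldWord₀ _ _ hk]
  have hc1 : ∀ k ≤ l, c (l + k) =
      center p + (toE3 (wordVec g) + A (toE3 (wordVec (g.take k)))) := fun k hk => by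
    rw [hck, wordVec_take_threefoldWord₁ _ _ hk, toE3_add, hσ.toE3_wordVec_map]
  have hc2 : ∀ k, c (l + l + k) = center p + (toE3 (wordVec g) + A (toE3 (wordVec g)) +
      A (A (toE3 (wordVec (g.take k))))) := fun k => by
    rw [hck, wordVec_take_threefoldWord₂, toE3_add, toE3_add, hσ.toE3_wordVec_map,
      hσ.toE3_wordVec_map, hσ.toE3_wordVec_map]
  have hcz : c 0 = center p := by rw [hc0 0 (Nat.zero_le _)]; simp [wordVec_nil, toE3_zero]
  have hcl : c l = center p + toE3 (wordVec g) := by rw [hc0 l le_rfl, hl, List.take_length]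
  -- the rotation of the gallery
  let S : E3 ≃ᵃⁱ[ℝ] E3 := R.trans (AffineIsometryEquiv.constVAdd ℝ E3 (c l - R (c 0)))
  have hS : ∀ x, S x = A (x - c 0) + c l := by
    intro x
    change (c l - R (c 0)) + R x = _
    rw [affineIsometry_apply R x (c 0)]
    abel
  have hSk : ∀ k ≤ l + l, S (c k) = c (k + l) := by
    intro k hk
    rcases le_total k l with h1 | h1
    · rw [hS, hc0 k h1, hcz, add_sub_cancel_left, hcl, add_comm k, hc1 k h1]
      abel
    · obtain ⟨j, rfl⟩ := Nat.exists_eq_add_of_le h1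
      rw [hS, hc1 j (by omega), hcz, add_sub_cancel_left, hcl, map_add,
        show l + j + l = l + l + j by omega, hc2]
      abel
  have hSadd : ∀ x y, S (x + y) = A x + S y := fun x y => by
    rw [hS, hS, add_sub_assoc, map_add, add_assoc]
  have hS3 : ∀ x, S (S (S x)) = x := by
    intro x
    have h1 : S (S (S (c 0))) = c 0 := by
      rw [hSk 0 (by omega), hSk _ (by omega), hSk _ (by omega), ← hclosed]
      congr 1; omega
    have h2 : x = (x - c 0) + c 0 := by abel
    have h3 := hrot.linear_cube (x - c 0)
    rw [h2, hSadd, hSadd, hSadd, h1, h3]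
  have hSne : ∃ x, S x ≠ x := by
    by_contra hcon
    push Not at hcon
    obtain ⟨x, hx⟩ := hrot.linear_ne
    apply hx
    have := hSadd x 0
    rw [hcon, hcon, add_zero, add_zero] at this
    exact this.symm
  -- the extension to all integers
  let V : ℤ → E3 := fun i => (S ^ (i / l)) (c (i % l).toNat)
  have hlz : (l : ℤ) ≠ 0 := by exact_mod_cast hl0.ne'
  have hVl : ∀ i, V (i + l) = S (V i) := by
    intro i
    simp only [V]
    rw [Int.add_emod_right, Int.add_ediv_of_dvd_right (dvd_refl _), Int.ediv_self hlz,
      add_comm (i / (l : ℤ)), zpow_one_add]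
    rfl
  have hVlt : ∀ k < l, V k = c k := by
    intro k hk
    have h1 : (k : ℤ) / l = 0 := by exact_mod_cast Nat.div_eq_of_lt hk
    have h2 : (k : ℤ) % l = k := by exact_mod_cast Nat.mod_eq_of_lt hk
    simp only [V, h1, h2]
    simp
  have hVc : ∀ k ≤ 3 * l, V k = c k := by
    intro k
    induction k using Nat.strong_induction_on with
    | _ k ih =>
      intro hk
      rcases lt_or_ge k l with h1 | h1
      · exact hVlt k h1
      · obtain ⟨j, rfl⟩ := Nat.exists_eq_add_of_le' h1
        push_cast
        rw [hVl, ih j (by omega) (by omega), hSk j (by omega)]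
  have hpl : ∀ t, pl V (t + l) = S (pl V t) := by
    intro t
    have h1 := pl_shift V l t
    rw [Int.cast_natCast] at h1
    rw [h1]
    simp only [hVl]
    exact (pl_map V (S.toAffineEquiv : E3 →ᵃ[ℝ] E3) t)
  have hpln : ∀ t, pl V (t + (3 * l : ℕ)) = pl V t := by
    intro t
    rw [show t + ((3 * l : ℕ) : ℝ) = t + l + l + l by push_cast; ring, hpl, hpl, hpl, hS3]
  have hstep : ∀ i, ‖V (i + 1) - V i‖ = 1 := by
    refine int_induction_mod hl0 (fun i => ?_) (fun r hr => ?_)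
    · have h1 : S (V (i + 1)) - S (V i) = A (V (i + 1) - V i) := by
        rw [hS, hS, add_sub_add_right_eq_sub, ← map_sub, sub_sub_sub_cancel_right]
      rw [add_right_comm, hVl, hVl, h1, LinearIsometryEquiv.norm_map]
    · have h1 := hVc (r + 1) (by omega)
      push_cast at h1
      rw [h1, hVc r (by omega), hc0 r hr.le, hc0 (r + 1) hr, wordVec_take_succ _ _ hr,
        toE3_add]
      rw [add_sub_add_left_eq_sub, add_sub_cancel_left, norm_toE3_vec]
  have hinj' : InjOn (pl V) (Ico (0 : ℝ) (3 * l : ℕ)) := by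
    intro s hs t ht hst
    rw [← polyline_eq_pl hVc (Ico_subset_Icc_self hs),
      ← polyline_eq_pl hVc (Ico_subset_Icc_self ht)] at hst
    exact hinj hs ht hst
  have hrange : range (fun t => pl V ((3 * l : ℕ) * t)) = range (pl V) := by
    apply Subset.antisymm
    · rintro _ ⟨t, rfl⟩; exact ⟨_, rfl⟩
    · rintro _ ⟨t, rfl⟩
      refine ⟨t / (3 * l : ℕ), ?_⟩
      have : ((3 * l : ℕ) : ℝ) ≠ 0 := by exact_mod_cast hpos.ne'
      simp only [mul_div_cancel₀ _ this]
  rw [polygonSet_eq_range hpos hVc hpln] at hK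
  refine ⟨range (pl V), ⟨_, isPiecewiseRegularCurve_pl (by omega) hpln hinj' hstep, hrange⟩, hK, S,
    isThreefoldRotation_of_cube hS3 hSne, ?_⟩
  rw [← range_comp]
  apply Subset.antisymm
  · rintro _ ⟨t, rfl⟩
    exact ⟨t + l, hpl t⟩
  · rintro _ ⟨t, rfl⟩
    exact ⟨t - l, by rw [Function.comp_apply, ← hpl, sub_add_cancel]⟩

/-! ### The cycle type of a codifying permutation -/

/-- The opposite direction. -/
def Direction.opp : Direction → Direction
  | .F => .B
  | .B => .F
  | .R => .L
  | .L => .R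
  | .U => .D
  | .D => .U

theorem Direction.vec_opp (s : Direction) : s.opp.vec = -s.vec := by
  cases s <;> ext l <;> fin_cases l <;> rfl

theorem Direction.vec_injective : Function.Injective Direction.vec := by
  intro s t h
  have h0 := congrFun h 0
  have h1 := congrFun h 1
  have h2 := congrFun h 2
  cases s <;> cases t <;> first | rfl | simp [Direction.vec] at h0 h1 h2

/-- The map of the directions which commutes with `opp` and has given values at `F`, `R`, `U`. -/
def Direction.ofAxes (a b c : Direction) : Direction → Direction
  | .F => a
  | .B => a.opp
  | .R => b
  | .L => b.opp
  | .U => c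
  | .D => c.opp

set_option maxRecDepth 100000 in
theorem Direction.ofAxes_eq_of_cube : ∀ a b c : Direction,
    (∀ s, ofAxes a b c (ofAxes a b c (ofAxes a b c s)) = s) →
      (∃ s, ofAxes a b c s = s) → ∀ s, ofAxes a b c s = s := by
  decide

theorem IsThreefoldLatticeRotation.cycleType {R : E3 ≃ᵃⁱ[ℝ] E3} {σ : Equiv.Perm Direction}
    (h : IsThreefoldLatticeRotation R σ) : σ.cycleType = {3, 3} := by
  obtain ⟨hrot, -, hσ⟩ := h
  have hvec : ∀ s t : Direction, toE3 s.vec = toE3 t.vec → s = t := fun s t h =>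
    Direction.vec_injective (toE3_injective h)
  have h3 : ∀ s, σ (σ (σ s)) = s := fun s => hvec _ _ (by
    rw [← hσ, ← hσ, ← hσ, hrot.linear_cube])
  have hneg : ∀ x, toE3 (-x) = -toE3 x := fun x => by
    rw [← zero_sub, toE3_sub, toE3_zero, zero_sub]
  have hopp : ∀ s, σ s.opp = (σ s).opp := fun s => hvec _ _ (by
    rw [← hσ, Direction.vec_opp, Direction.vec_opp, hneg, hneg, map_neg, hσ])
  have hax : ∀ s, Direction.ofAxes (σ .F) (σ .R) (σ .U) s = σ s := by
    intro s
    cases s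
    · rfl
    · exact (hopp .F).symm
    · rfl
    · exact (hopp .R).symm
    · rfl
    · exact (hopp .U).symm
  have hne : ¬ ∀ s, σ s = s := by
    intro hall
    obtain ⟨x, hx⟩ := hrot.linear_ne
    apply hx
    have hx' : x = x 0 • toE3 (Direction.vec .F) + x 1 • toE3 (Direction.vec .R) +
        x 2 • toE3 (Direction.vec .U) := by
      ext l
      fin_cases l <;> simp [toE3, Direction.vec]
    rw [hx', map_add, map_add, map_smul, map_smul, map_smul, hσ, hσ, hσ, hall, hall, hall]
  have hfix : ∀ s, σ s ≠ s := by
    intro s hs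
    refine hne fun t => ?_
    have := Direction.ofAxes_eq_of_cube (σ .F) (σ .R) (σ .U)
      (fun s => by rw [hax, hax, hax, h3]) ⟨s, by rw [hax, hs]⟩ t
    rwa [hax] at this
  have hord : orderOf σ = 3 := by
    refine orderOf_eq_prime (Equiv.ext fun s => ?_) ?_
    · exact h3 s
    · rintro rfl
      exact hne fun s => rfl
  obtain ⟨n, hn⟩ := Equiv.Perm.cycleType_prime_order (σ := σ) (by rw [hord]; exact Nat.prime_three)
  rw [hord] at hn
  have hsupp : σ.support = Finset.univ := by
    ext s; simp [hfix s]
  have hsum := σ.sum_cycleType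
  rw [hn, hsupp, Multiset.sum_replicate, Finset.card_univ] at hsum
  have hcard : Fintype.card Direction = 6 := rfl
  rw [hcard, smul_eq_mul] at hsum
  obtain rfl : n = 1 := by omega
  rw [hn]; rfl

end CubicKnot

theorem proposition4 (K : Set CubicKnot.E3) (hK : CubicKnot.IsTameKnot K) :
    (CubicKnot.HasThreefoldRotationalSymmetry K ↔
      ∃ (p : Fin 3 → ℤ) (g : List CubicKnot.Direction)
        (R : CubicKnot.E3 ≃ᵃⁱ[ℝ] CubicKnot.E3) (σ : Equiv.Perm CubicKnot.Direction),
        CubicKnot.IsThreefoldLatticeRotation R σ ∧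
          CubicKnot.GalleryKnotsAs p (CubicKnot.threefoldWord σ g) K) ∧
    ∀ (R : CubicKnot.E3 ≃ᵃⁱ[ℝ] CubicKnot.E3) (σ : Equiv.Perm CubicKnot.Direction),
      CubicKnot.IsThreefoldLatticeRotation R σ → σ.cycleType = {3, 3} := by
  refine ⟨⟨fun h => h.exists_gallery, ?_⟩, fun R σ h => h.cycleType⟩
  rintro ⟨p, g, R, σ, hR, h⟩
  exact CubicKnot.hasThreefoldRotationalSymmetry_of_gallery hR h
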